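/- **Theorem 2.1 (Aperiodic Nekhoroshev).** Let $n\ge 1$, $\rho,\sigma\in(0,1]$, $M\ge m>0$ and $C_f$ be given. For $\mathcal G\subseteq\mathbb R^n$ put $\mathcal G_\rho=\bigcup_{I\in\mathcal G}\{\hat I\in\mathbb C^n:|\hat I-I|<\rho\}$ (Euclidean norm) and $\mathcal D=\mathcal G_\rho\times\{\varphi\in\mathbb C^n: |\mathrm{Im}\,\varphi_j|<2\sigma\ \forall j\}\times\{\xi\in\mathbb C:|\mathrm{Im}\,\xi|<2\sigma\}$, and let $$\tilde{\mathcal F}=C_f\left(\frac{1+e^{-\sigma/2}}{1-e^{-\sigma/2}}\right)^n,\qquad \lambda=\lambda_{\varepsilon,\mu}=\mu+e\tilde{\mathcal F}\varepsilon,\qquad a=n^2+n.$$ There are constants $\Delta^*>0$ and $\mathcal T>0$, depending only on $\rho,\sigma,M,m,C_f$ and $n$, such that the following holds. Let $\mathcal G\subseteq\mathbb R^n$ be open, let $h=h(I)$ and $f=f(I,\varphi,\xi)$ be bounded and holomorphic on $\mathcal G_\rho$ and on $\mathcal D$ respectively, real at real points, with $f$ $2\pi$-periodic in each $\varphi_j$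 (its dependence on $\xi$ is arbitrary) and $\sup_{\mathcal D}|f|=C_f$, and suppose that $$|\partial_I^2h(I)v|\le M|v|,\qquad |\langle\partial_I^2h(I)v,v\rangle|\ge m|v|^2\qquad\text{for all } I\in\mathcal G_\rho,\ v\in\mathbb R^n.$$ Let $\varepsilon>0$ and $\mu\ge 0$, not otherwise related, satisfy $0<\lambda_{\varepsilon,\mu}<\dfrac{1}{3^4\Delta^*}$. Then every orbit $(I(t),\varphi(t))$, in $(\mathcal G_\rho\cap\mathbb R^n)\times\mathbb T^n$, of the Hamiltonian $$H(I,\varphi,t)=h(I)+\varepsilon f(I,\varphi,\mu t)$$ (that is, $\dot I=-\partial_\varphi H$, $\dot\varphi=\partial_I H$) that starts at a time $t_0\in\mathbb R$ in $\mathcal G\times\mathbb T^n$ can be continued to all times $t$ with $$|t-t_0|<\frac{\mathcal T}{\varepsilon}\exp\left[\left(\frac{1}{\Delta^*\lambda_{\varepsilon,\mu}}\right)^{\frac1{2a}}\right],$$ and for these times it satisfies $$|I(t)-I(t_0)|<(\Delta^*\lambda_{\varepsilon,\mu})^{\frac14}\rho .$$ -/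

import Mathlib

namespace AperiodicNekhoroshev

noncomputable section

/-- The real space of actions, or of (lifted) angles, with the Euclidean norm. -/
abbrev RVec (n : ℕ) : Type := EuclideanSpace ℝ (Fin n)

/-- The complexified space, with the Hermitian norm. -/
abbrev CVec (n : ℕ) : Type := EuclideanSpace ℂ (Fin n)

/-- The inclusion of `ℝⁿ` in `ℂⁿ`. -/
def toC {n : ℕ} (x : RVec n) : CVec n := WithLp.toLp 2 (fun j => (x j : ℂ))

/-- The complex neighbourhood `G_ρ` of `G ⊆ ℝⁿ`: the union of the complex balls of radius `ρ`
centred at the points of `G`. -/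
def complexNhd {n : ℕ} (G : Set (RVec n)) (ρ : ℝ) : Set (CVec n) :=
  ⋃ I ∈ G, Metric.ball (toC I) ρ

/-- The complex strip of the angles (a subset of the universal cover `ℂⁿ` of the complex torus):
every component has imaginary part less than `s` in absolute value. -/
def angleStrip (n : ℕ) (s : ℝ) : Set (CVec n) := {φ | ∀ j, |(φ j).im| < s}

/-- The complex strip of the slow time. -/
def timeStrip (s : ℝ) : Set ℂ := {ξ | |ξ.im| < s}

/-- The complex domain of the variables `(I, φ, ξ)`. The variable `η` conjugate to time does not
appear, since neither `h` nor `f` depends on it. -/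
def complexDomain {n : ℕ} (G : Set (RVec n)) (ρ σ : ℝ) : Set (CVec n × CVec n × ℂ) :=
  complexNhd G ρ ×ˢ angleStrip n (2 * σ) ×ˢ timeStrip (2 * σ)

/-- `h(I)` and `f(I, φ, ξ)` are holomorphic and bounded on the complex domain, real at real points,
`f` is `2π`-periodic in each angle, and the supremum norm of `f` equals `Cf`. -/
structure RegularityHyp {n : ℕ} (G : Set (RVec n)) (ρ σ Cf : ℝ)
    (h : CVec n → ℂ) (f : CVec n × CVec n × ℂ → ℂ) : Prop where
  h_holo : AnalyticOnNhd ℂ h (complexNhd G ρ)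
  h_bdd : ∃ B : ℝ, ∀ I ∈ complexNhd G ρ, ‖h I‖ ≤ B
  h_real : ∀ I : RVec n, toC I ∈ complexNhd G ρ → (h (toC I)).im = 0
  f_holo : AnalyticOnNhd ℂ f (complexDomain G ρ σ)
  f_real : ∀ (I φ : RVec n) (ξ : ℝ), toC I ∈ complexNhd G ρ → (f (toC I, toC φ, (ξ : ℂ))).im = 0
  f_periodic : ∀ (I φ : CVec n) (ξ : ℂ), (I, φ, ξ) ∈ complexDomain G ρ σ → ∀ j : Fin n,
    f (I, φ + EuclideanSpace.single j (2 * Real.pi : ℂ), ξ) = f (I, φ, ξ)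
  f_norm : IsLUB ((fun z => ‖f z‖) '' complexDomain G ρ σ) Cf

/-- The product `∂²h(I) v` of the (complex) Hessian matrix of `h` at `I` and a real vector `v`. -/
def hessianMulVec {n : ℕ} (h : CVec n → ℂ) (I : CVec n) (v : RVec n) : CVec n :=
  WithLp.toLp 2 (fun j => fderiv ℂ (fderiv ℂ h) I (toC v) (EuclideanSpace.single j (1 : ℂ)))

/-- Quantitative convexity: `|∂²h(I) v| ≤ M |v|` and `|⟨∂²h(I) v, v⟩| ≥ m |v|²` for every `I` in the
complex neighbourhood of `G` and every real vector `v`. -/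
structure ConvexityHyp {n : ℕ} (G : Set (RVec n)) (ρ M m : ℝ) (h : CVec n → ℂ) : Prop where
  upper : ∀ I ∈ complexNhd G ρ, ∀ v : RVec n, ‖hessianMulVec h I v‖ ≤ M * ‖v‖
  lower : ∀ I ∈ complexNhd G ρ, ∀ v : RVec n,
    m * ‖v‖ ^ 2 ≤ ‖∑ j, hessianMulVec h I v j * (v j : ℂ)‖

/-- The real Hamiltonian `H(I, φ, t) = h(I) + ε f(I, φ, μ t)`. The real parts only serve to land
in `ℝ`: `h` and `f` are real at real points. -/
def hamiltonian {n : ℕ} (h : CVec n → ℂ) (f : CVec n × CVec n × ℂ → ℂ) (ε μ : ℝ)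
    (I φ : RVec n) (t : ℝ) : ℝ :=
  (h (toC I)).re + ε * (f (toC I, toC φ, ((μ * t : ℝ) : ℂ))).re

/-- `(I, φ)` is an orbit of the Hamiltonian on the time interval `J`: it stays in the real points
of the domain and solves `I' = -∂H/∂φ`, `φ' = ∂H/∂I`. The angles are lifted from the torus
to `ℝⁿ`. -/
structure IsOrbit {n : ℕ} (G : Set (RVec n)) (ρ : ℝ) (h : CVec n → ℂ)
    (f : CVec n × CVec n × ℂ → ℂ) (ε μ : ℝ) (J : Set ℝ) (I φ : ℝ → RVec n) : Prop where
  mem : ∀ t ∈ J, toC (I t) ∈ complexNhd G ρ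
  deriv_I : ∀ t ∈ J,
    HasDerivWithinAt I (-gradient (fun y => hamiltonian h f ε μ (I t) y t) (φ t)) J t
  deriv_φ : ∀ t ∈ J,
    HasDerivWithinAt φ (gradient (fun x => hamiltonian h f ε μ x (φ t) t) (I t)) J t

/-- `F̃ = C_f ((1 + e^{-σ/2}) / (1 - e^{-σ/2}))ⁿ`. -/
def Ftilde (n : ℕ) (σ Cf : ℝ) : ℝ :=
  Cf * ((1 + Real.exp (-(σ / 2))) / (1 - Real.exp (-(σ / 2)))) ^ n

/-- `λ = μ + e F̃ ε`. -/
def lam (n : ℕ) (σ Cf ε μ : ℝ) : ℝ := μ + Real.exp 1 * Ftilde n σ Cf * ε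

/-- The stability time `(𝒯 / ε) exp[(1 / (Δ* λ))^{1 / (2a)}]` with `a = n² + n`. -/
def stabilityTime (n : ℕ) (Δs T ε l : ℝ) : ℝ :=
  T / ε * Real.exp ((1 / (Δs * l)) ^ (1 / (2 * ((n : ℝ) ^ 2 + (n : ℝ)))))

end

end AperiodicNekhoroshev

/-!
The actions of an orbit are confined by Nekhoroshev's method. No energy argument is available,
since the dependence of the perturbation on the slow time `ξ = μ t` is arbitrary; only the convexity
of `h`, in the form of the monotonicity of the frequency map `∂h`, is used in the geometric part.

*Almost integrals.* Near a point whose frequency is nonresonant for all integer vectors up to order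
`N K` outside a subspace `E`, the linear forms `v · I` with `v` orthogonal to `E` are almost
integrals: there is a function close to `v · I` whose derivative along the orbits is of size
`2^{-N}` (`Frame.exists_almost_integral`). No canonical transformations are constructed. In the Lie
algebra of the functions `F(I, φ, ξ) + a η`, with `η` conjugate to `ξ`, the homological equations of
the normal form are solved order by order, and the generating series yields a formal integral
(`convLie_eq_zero_of_generator`), which is truncated at order `N`. The estimates are a majorant
argument in a scale in which the order of an object bounds both its number of harmonics and its
loss of domain, so that brackets add orders and multiply sizes, with one constant for all orders
(`IsTrig.pb`, `exists_formal_integral`). Fourier coefficients of bounded holomorphic functions decay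
exponentially, which splits the perturbation into trigonometric polynomials of increasing order
(`exists_trig_approx`). Because the slow time is one of the variables, with its own complex strip,
`μ` enters the smallness condition in the same way as `ε`.

*Geometry.* With scales `δ 0 < δ 1 < … < δ n`, there is a time in the interval considered at which
the frequency is resonant with respect to some `E` of dimension `j` at scale `δ j`, and nonresonant
outside `E` at scale `δ (j + 1)`, where `j` is chosen so that resonances of dimension `j` exist at
all times; the Gram determinants of integer vectors are integers, which bounds the angles between
resonances from below (`exists_resonant_block`). As long as the orbit stays near that point, its
frequencies remain resonant with respect to the same `E`. The actions cannot move orthogonally to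
`E`, by the almost integrals, nor along `E`, because the frequencies would move with them, by
convexity (`norm_sub_le_of_resonant`). A continuity argument turns this into confinement
(`norm_sub_le_of_scales`).

*Constants.* The choice `N ∼ (Δ λ)^{-1/(2a)}` and `δ 0 ∼ (Δ λ)^{1/2}` gives `δ n ∼ (Δ λ)^{1/4}` and
a drift of the almost integrals that is exponentially small in `N` (`exists_confinement`).

*Existence.* With the actions retracted to a ball, Hamilton's equations are globally Lipschitz,
hence solvable for all times, and the confinement shows that the retraction has no effect within the
stability time (`exists_curve`).
-/

namespace AperiodicNekhoroshev

noncomputable section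

open Metric Set Filter Topology MeasureTheory

/-! ### Cauchy's estimate and Osgood's lemma -/

section SeveralVariables

variable {E : Type*} [NormedAddCommGroup E] [NormedSpace ℂ E]

/-- Cauchy's estimate for a directional derivative, on a complex disc in that direction. -/
theorem norm_fderiv_apply_le {U : Set E} (hU : IsOpen U) {g : E → ℂ} (hg : DifferentiableOn ℂ g U)
    {x w : E} {R C : ℝ} (hR : 0 < R)
    (h : ∀ z : ℂ, ‖z‖ ≤ R → x + z • w ∈ U ∧ ‖g (x + z • w)‖ ≤ C) :
    ‖fderiv ℂ g x w‖ ≤ C / R := by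
  have hd : ∀ z : ℂ, ‖z‖ ≤ R →
      HasDerivAt (fun z : ℂ => g (x + z • w)) (fderiv ℂ g (x + z • w) w) z := by
    intro z hz
    have h1 : HasFDerivAt g (fderiv ℂ g (x + z • w)) (x + z • w) :=
      (hg.differentiableAt (hU.mem_nhds (h z hz).1)).hasFDerivAt
    have h2 : HasDerivAt (fun z : ℂ => x + z • w) w z := by
      simpa using ((hasDerivAt_id z).smul_const w).const_add x
    exact h1.comp_hasDerivAt z h2
  have h0 := (hd 0 (by simpa using hR.le)).deriv
  simp only [zero_smul, add_zero] at h0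
  rw [← h0]
  refine Complex.norm_deriv_le_of_forall_mem_sphere_norm_le hR ?_ ?_
  · refine DifferentiableOn.diffContOnCl ?_
    rw [closure_ball _ hR.ne']
    intro z hz
    exact (hd z (by simpa using hz)).differentiableAt.differentiableWithinAt
  · intro z hz
    exact (h z (by simpa using hz.le)).2

variable [FiniteDimensional ℂ E]

theorem differentiableAt_of_forall_apply {L : E → E →L[ℂ] ℂ} {x : E}
    (h : ∀ w, DifferentiableAt ℂ (fun y => L y w) x) : DifferentiableAt ℂ L x := by
  let d := Module.finrank ℂ E
  have hd : d = Module.finrank ℂ (Fin d → ℂ) := (Module.finrank_fin_fun ℂ).symm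
  let e₁ := ContinuousLinearEquiv.ofFinrankEq hd
  let e₂ := (e₁.arrowCongr (1 : ℂ ≃L[ℂ] ℂ)).trans (ContinuousLinearEquiv.piRing (Fin d))
  rw [← Function.id_comp L, ← e₂.symm_comp_self]
  exact e₂.symm.differentiableAt.comp x (differentiableAt_pi.mpr fun i => h _)

set_option maxHeartbeats 1000000 in
/-- Osgood's lemma in the form used here: the directional derivatives of a complex differentiable
function of several variables are complex differentiable, being Cauchy integrals over circles in
the given direction. -/
theorem differentiableOn_fderiv_apply {U : Set E} (hU : IsOpen U) {g : E → ℂ}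
    (hg : DifferentiableOn ℂ g U) (w : E) :
    DifferentiableOn ℂ (fun x => fderiv ℂ g x w) U := by
  intro x₀ hx₀
  refine DifferentiableAt.differentiableWithinAt ?_
  have hcont : ContinuousAt g x₀ := (hg.differentiableAt (hU.mem_nhds hx₀)).continuousAt
  obtain ⟨R, hR, hball⟩ : ∃ R > 0, ∀ y ∈ ball x₀ (3 * R), y ∈ U ∧ ‖g y‖ ≤ ‖g x₀‖ + 1 := by
    have h1 : ∀ᶠ y in 𝓝 x₀, y ∈ U ∧ ‖g y‖ < ‖g x₀‖ + 1 :=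
      Filter.Eventually.and (hU.mem_nhds hx₀)
        (hcont.norm.eventually (gt_mem_nhds (by linarith)))
    obtain ⟨R, hR, h⟩ := Metric.eventually_nhds_iff_ball.1 h1
    refine ⟨R / 3, by positivity, fun y hy => ?_⟩
    have := h y (by convert hy using 2; ring)
    exact ⟨this.1, this.2.le⟩
  set s : ℝ := R / (‖w‖ + 1) with hs
  have hspos : 0 < s := by positivity
  have hsw : s * ‖w‖ < R := by
    rw [hs, div_mul_eq_mul_div, div_lt_iff₀ (by positivity)]
    nlinarith [norm_nonneg w]
  have hmem : ∀ y ∈ ball x₀ R, ∀ z : ℂ, ‖z‖ ≤ s → y + z • w ∈ ball x₀ (2 * R) := by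
    intro y hy z hz
    rw [mem_ball, dist_eq_norm] at hy ⊢
    have : ‖z • w‖ ≤ s * ‖w‖ := by rw [norm_smul]; gcongr
    calc ‖y + z • w - x₀‖ = ‖(y - x₀) + z • w‖ := by congr 1; abel
      _ ≤ _ := norm_add_le _ _
      _ < _ := by linarith
  have hbd : ∀ y ∈ ball x₀ (2 * R), ‖fderiv ℂ g y‖ ≤ (‖g x₀‖ + 1) / R * 2 := by
    intro y hy
    refine ContinuousLinearMap.opNorm_le_bound _ (by positivity) fun v => ?_
    rcases eq_or_ne v 0 with rfl | hv
    · simp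
    have hvpos : 0 < ‖v‖ := norm_pos_iff.2 hv
    have := norm_fderiv_apply_le hU hg (x := y) (w := v) (R := R / (2 * ‖v‖)) (C := ‖g x₀‖ + 1)
      (by positivity) (by
        intro z hz
        apply hball
        rw [mem_ball, dist_eq_norm] at hy ⊢
        have h1 : ‖z • v‖ ≤ R / 2 := by
          rw [norm_smul]
          calc ‖z‖ * ‖v‖ ≤ R / (2 * ‖v‖) * ‖v‖ := by gcongr
            _ = R / 2 := by field_simp
        calc ‖y + z • v - x₀‖ = ‖(y - x₀) + z • v‖ := by congr 1; abel
          _ ≤ _ := norm_add_le _ _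
          _ < _ := by linarith)
    refine this.trans (le_of_eq ?_)
    field_simp
  have hder : ∀ y ∈ ball x₀ (2 * R), HasFDerivAt g (fderiv ℂ g y) y := fun y hy =>
    (hg.differentiableAt (hU.mem_nhds (hball y (ball_subset_ball (by linarith) hy)).1)).hasFDerivAt
  -- the Cauchy integral formula
  have hform : ∀ y ∈ ball x₀ R, fderiv ℂ g y w = (2 * ↑Real.pi * Complex.I)⁻¹ *
      ∫ θ in Ioc 0 (2 * Real.pi), deriv (circleMap 0 s) θ •
        ((circleMap 0 s θ - 0) ^ 2)⁻¹ • g (y + circleMap 0 s θ • w) := by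
    intro y hy
    rw [← intervalIntegral.integral_of_le Real.two_pi_pos.le]
    change _ = (2 * ↑Real.pi * Complex.I)⁻¹ • ∮ z in C(0, s), ((z - 0) ^ 2)⁻¹ • g (y + z • w)
    have hd : ∀ z : ℂ, ‖z‖ ≤ s →
        HasDerivAt (fun z : ℂ => g (y + z • w)) (fderiv ℂ g (y + z • w) w) z := by
      intro z hz
      have h2 : HasDerivAt (fun z : ℂ => y + z • w) w z := by
        simpa using ((hasDerivAt_id z).smul_const w).const_add y
      exact (hder _ (hmem y hy z hz)).comp_hasDerivAt z h2
    have hV : IsOpen {z : ℂ | y + z • w ∈ ball x₀ (2 * R)} :=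
      isOpen_ball.preimage (by fun_prop)
    have h0 := (hd 0 (by simpa using hspos.le)).deriv
    simp only [zero_smul, add_zero] at h0
    rw [← h0]
    refine (Complex.two_pi_I_inv_smul_circleIntegral_sub_sq_inv_smul_of_differentiable hV
      (fun z hz => hmem y hy z (by simpa using hz)) ?_ (mem_ball_self hspos)).symm
    intro z hz
    have h2 : HasDerivAt (fun z : ℂ => y + z • w) w z := by
      simpa using ((hasDerivAt_id z).smul_const w).const_add y
    exact ((hder _ hz).comp_hasDerivAt z h2).differentiableAt.differentiableWithinAt
  have heq : (fun x => fderiv ℂ g x w) =ᶠ[𝓝 x₀] fun y => (2 * ↑Real.pi * Complex.I)⁻¹ *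
      ∫ θ in Ioc 0 (2 * Real.pi), deriv (circleMap 0 s) θ •
        ((circleMap 0 s θ - 0) ^ 2)⁻¹ • g (y + circleMap 0 s θ • w) :=
    Filter.eventuallyEq_of_mem (ball_mem_nhds _ hR) hform
  rw [heq.differentiableAt_iff]
  refine DifferentiableAt.const_mul ?_ _
  let _ : MeasurableSpace E := borel E
  have _ : BorelSpace E := ⟨rfl⟩
  have hnorm : ∀ θ : ℝ, ‖circleMap 0 s θ‖ = s := fun θ => by simp [abs_of_pos hspos]
  have hne : ∀ θ : ℝ, circleMap 0 s θ ≠ 0 := fun θ => by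
    rw [← norm_pos_iff, hnorm]; exact hspos
  have hker : Continuous fun θ : ℝ => deriv (circleMap 0 s) θ • ((circleMap 0 s θ - 0) ^ 2)⁻¹ := by
    simp only [deriv_circleMap, sub_zero]
    have h1 : Continuous fun θ : ℝ => circleMap 0 s θ := continuous_circleMap 0 s
    exact (h1.mul continuous_const).smul ((h1.pow 2).inv₀ fun θ => pow_ne_zero _ (hne θ))
  have hFc : ∀ y ∈ ball x₀ R, Continuous fun θ : ℝ => g (y + circleMap 0 s θ • w) := by
    intro y hy
    rw [continuous_iff_continuousAt]
    intro θ
    have h1 : ContinuousAt g (y + circleMap 0 s θ • w) :=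
      (hder _ (hmem y hy _ (hnorm θ).le)).continuousAt
    exact ContinuousAt.comp (f := fun θ : ℝ => y + circleMap 0 s θ • w) h1 (by fun_prop)
  have hF : ∀ y ∈ ball x₀ R, Continuous fun θ : ℝ =>
      deriv (circleMap 0 s) θ • ((circleMap 0 s θ - 0) ^ 2)⁻¹ • g (y + circleMap 0 s θ • w) := by
    intro y hy
    refine (hker.smul (hFc y hy)).congr fun θ => ?_
    simp [mul_assoc]
  refine (hasFDerivAt_integral_of_dominated_of_fderiv_le (𝕜 := ℂ) (s := ball x₀ R)
    (bound := fun _ => s * (s ^ 2)⁻¹ * ((‖g x₀‖ + 1) / R * 2))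
    (F' := fun y θ => deriv (circleMap 0 s) θ • ((circleMap 0 s θ - 0) ^ 2)⁻¹ •
      fderiv ℂ g (y + circleMap 0 s θ • w))
    (ball_mem_nhds _ hR) ?_ ?_ ?_ ?_ ?_ ?_).differentiableAt
  · filter_upwards [ball_mem_nhds x₀ hR] with y hy
    exact (hF y hy).aestronglyMeasurable
  · exact (hF x₀ (mem_ball_self hR)).integrableOn_Ioc
  · have h1 : Measurable fun θ : ℝ => fderiv ℂ g (x₀ + circleMap 0 s θ • w) :=
      (measurable_fderiv ℂ g).comp (by fun_prop : Continuous fun θ : ℝ =>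
        x₀ + circleMap 0 s θ • w).measurable
    have : ProperSpace (E →L[ℂ] ℂ) := FiniteDimensional.proper ℂ _
    have h3 : Measurable fun θ : ℝ => deriv (circleMap 0 s) θ • ((circleMap 0 s θ - 0) ^ 2)⁻¹ •
      fderiv ℂ g (x₀ + circleMap 0 s θ • w) := by
      have h2 := hker.measurable.smul h1
      convert h2 using 2 with θ
      simp [smul_smul]
    exact h3.aestronglyMeasurable
  · refine Eventually.of_forall fun θ y hy => ?_
    rw [norm_smul, norm_smul, norm_inv, norm_pow, sub_zero, hnorm, deriv_circleMap, norm_mul,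
      hnorm, Complex.norm_I, mul_one, mul_assoc]
    gcongr
    exact hbd _ (hmem y hy _ (hnorm θ).le)
  · exact integrable_const _
  · refine Eventually.of_forall fun θ y hy => ?_
    refine HasFDerivAt.fun_const_smul (HasFDerivAt.fun_const_smul ?_ _) _
    have h1 := hder _ (hmem y hy _ (hnorm θ).le)
    have h2 : HasFDerivAt (fun y : E => y + circleMap 0 s θ • w) (ContinuousLinearMap.id ℂ E) y :=
      (hasFDerivAt_id y).add_const _
    rw [← ContinuousLinearMap.comp_id (fderiv ℂ g (y + circleMap 0 s θ • w))]
    exact h1.comp y h2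

theorem differentiableOn_fderiv {U : Set E} (hU : IsOpen U) {g : E → ℂ}
    (hg : DifferentiableOn ℂ g U) : DifferentiableOn ℂ (fderiv ℂ g) U := fun _ hx =>
  (differentiableAt_of_forall_apply fun w => (differentiableOn_fderiv_apply hU hg w).differentiableAt
    (hU.mem_nhds hx)).differentiableWithinAt

theorem fderiv_fderiv_comm {U : Set E} (hU : IsOpen U) {g : E → ℂ}
    (hg : DifferentiableOn ℂ g U) {x : E} (hx : x ∈ U) (v w : E) :
    fderiv ℂ (fun y => fderiv ℂ g y v) x w = fderiv ℂ (fun y => fderiv ℂ g y w) x v := by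
  have h2 : HasFDerivAt (fderiv ℂ g) (fderiv ℂ (fderiv ℂ g) x) x :=
    ((differentiableOn_fderiv hU hg).differentiableAt (hU.mem_nhds hx)).hasFDerivAt
  have h := second_derivative_symmetric_of_eventually
    (f := g) (f' := fderiv ℂ g) (x := x) (by
      filter_upwards [hU.mem_nhds hx] with y hy
      exact (hg.differentiableAt (hU.mem_nhds hy)).hasFDerivAt) h2 v w
  rw [fderiv_clm_apply h2.differentiableAt (differentiableAt_const _),
    fderiv_clm_apply h2.differentiableAt (differentiableAt_const _)]
  simpa using h.symm

end SeveralVariables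

end

end AperiodicNekhoroshev

namespace AperiodicNekhoroshev

noncomputable section

open Metric Set Filter Topology MeasureTheory

/-! ### The algebra of holomorphic functions on an open set -/

section Holomorphic

variable {E : Type*} [NormedAddCommGroup E]

/-- The extension by zero of a function on an open set. -/
def extendZero {Ω : TopologicalSpace.Opens E} (g : Ω → ℂ) : E → ℂ :=
  Function.extend Subtype.val g 0

variable {Ω : TopologicalSpace.Opens E}

theorem extendZero_apply (g : Ω → ℂ) {x : E} (hx : x ∈ Ω) : extendZero g x = g ⟨x, hx⟩ :=
  Subtype.val_injective.extend_apply g 0 ⟨x, hx⟩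

theorem extendZero_of_notMem (g : Ω → ℂ) {x : E} (hx : x ∉ Ω) : extendZero g x = 0 :=
  Function.extend_apply' _ _ _ (by rintro ⟨y, rfl⟩; exact hx y.2)

theorem extendZero_add (g g' : Ω → ℂ) : extendZero (g + g') = extendZero g + extendZero g' := by
  ext x
  by_cases hx : x ∈ Ω
  · simp [extendZero_apply _ hx]
  · simp [extendZero_of_notMem _ hx]

theorem extendZero_mul (g g' : Ω → ℂ) : extendZero (g * g') = extendZero g * extendZero g' := by
  ext x
  by_cases hx : x ∈ Ω
  · simp [extendZero_apply _ hx]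
  · simp [extendZero_of_notMem _ hx]

theorem extendZero_smul (c : ℂ) (g : Ω → ℂ) : extendZero (c • g) = c • extendZero g := by
  ext x
  by_cases hx : x ∈ Ω
  · simp [extendZero_apply _ hx]
  · simp [extendZero_of_notMem _ hx]

theorem extendZero_eqOn (f : E → ℂ) : EqOn (extendZero fun x : Ω => f x) f Ω :=
  fun _ hx => extendZero_apply _ hx

theorem extendZero_eventuallyEq (f : E → ℂ) {x : E} (hx : x ∈ Ω) :
    extendZero (fun x : Ω => f x) =ᶠ[𝓝 x] f :=
  (extendZero_eqOn f).eventuallyEq_of_mem (Ω.isOpen.mem_nhds hx)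

variable [NormedSpace ℂ E]

/-- The functions on the open set `Ω` that are holomorphic there, as a subalgebra of all functions
on the subtype `Ω`. -/
def holSubalgebra (Ω : TopologicalSpace.Opens E) : Subalgebra ℂ (Ω → ℂ) where
  carrier := {g | DifferentiableOn ℂ (extendZero g) Ω}
  mul_mem' {a b} ha hb := by
    simp only [mem_ofPred_eq, extendZero_mul] at *
    exact ha.mul hb
  add_mem' {a b} ha hb := by
    simp only [mem_ofPred_eq, extendZero_add] at *
    exact ha.add hb
  algebraMap_mem' c :=
    (differentiableOn_const c).congr fun _ hx => extendZero_apply _ hx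

/-- The algebra of holomorphic functions on the open set `Ω`. The elements are functions on the
subtype `Ω`, so that functions which agree on `Ω` are equal. -/
def Hol (Ω : TopologicalSpace.Opens E) : Type _ := holSubalgebra Ω

instance : CommRing (Hol Ω) := inferInstanceAs (CommRing (holSubalgebra Ω))

instance : Algebra ℂ (Hol Ω) := inferInstanceAs (Algebra ℂ (holSubalgebra Ω))

/-- A holomorphic function as a function on the whole space, zero outside of `Ω`. -/
def Hol.fn (F : Hol Ω) : E → ℂ := extendZero F.1

theorem Hol.differentiableOn (F : Hol Ω) : DifferentiableOn ℂ F.fn Ω := F.2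

/-- The element of `Hol Ω` given by a function that is holomorphic on `Ω`. -/
def Hol.of (f : E → ℂ) (hf : DifferentiableOn ℂ f Ω) : Hol Ω :=
  ⟨fun x => f x, hf.congr (extendZero_eqOn f)⟩

theorem Hol.fn_of {f : E → ℂ} {hf : DifferentiableOn ℂ f Ω} {x : E} (hx : x ∈ Ω) :
    (Hol.of f hf).fn x = f x := extendZero_apply _ hx

theorem Hol.fderiv_fn_of {f : E → ℂ} {hf : DifferentiableOn ℂ f Ω} {x : E} (hx : x ∈ Ω) :
    fderiv ℂ (Hol.of f hf).fn x = fderiv ℂ f x := (extendZero_eventuallyEq f hx).fderiv_eq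

theorem Hol.ext_fn {F G : Hol Ω} (h : ∀ x ∈ Ω, F.fn x = G.fn x) : F = G := by
  refine Subtype.ext (funext fun ⟨x, hx⟩ => ?_)
  simpa [Hol.fn, extendZero_apply _ hx] using h x hx

theorem Hol.fn_add (F G : Hol Ω) : (F + G).fn = F.fn + G.fn := extendZero_add _ _

theorem Hol.fn_mul (F G : Hol Ω) : (F * G).fn = F.fn * G.fn := extendZero_mul _ _

theorem Hol.fn_smul (c : ℂ) (F : Hol Ω) : (c • F).fn = c • F.fn := extendZero_smul _ _

theorem Hol.fn_zero : (0 : Hol Ω).fn = 0 := by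
  simpa using Hol.fn_smul (0 : ℂ) (0 : Hol Ω)

/-- `Hol.fn` as a linear map. -/
def Hol.fnₗ : Hol Ω →ₗ[ℂ] (E → ℂ) where
  toFun := Hol.fn
  map_add' := Hol.fn_add
  map_smul' := Hol.fn_smul

theorem Hol.fn_sub (F G : Hol Ω) : (F - G).fn = F.fn - G.fn := map_sub Hol.fnₗ F G

theorem Hol.fn_sum {ι : Type*} (s : Finset ι) (F : ι → Hol Ω) :
    (∑ i ∈ s, F i).fn = ∑ i ∈ s, (F i).fn := map_sum Hol.fnₗ F s

theorem Hol.differentiableAt (F : Hol Ω) {x : E} (hx : x ∈ Ω) : DifferentiableAt ℂ F.fn x :=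
  F.differentiableOn.differentiableAt (Ω.isOpen.mem_nhds hx)

variable [FiniteDimensional ℂ E]

/-- The derivative in the direction `w`, as a derivation of the algebra of holomorphic functions. -/
def Hol.D (w : E) : Derivation ℂ (Hol Ω) (Hol Ω) :=
  Derivation.mk'
    { toFun := fun F => Hol.of (fun x => fderiv ℂ F.fn x w)
        (differentiableOn_fderiv_apply Ω.isOpen F.differentiableOn w)
      map_add' := fun F G => Hol.ext_fn fun x hx => by
        simp [Hol.fn_add, Hol.fn_of hx,
          fderiv_add (F.differentiableAt hx) (G.differentiableAt hx)]
      map_smul' := fun c F => Hol.ext_fn fun x hx => by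
        simp [Hol.fn_smul, Hol.fn_of hx, fderiv_const_smul (F.differentiableAt hx)] }
    fun F G => Hol.ext_fn fun x hx => by
      simp only [LinearMap.coe_mk, AddHom.coe_mk, smul_eq_mul]
      simp [Hol.fn_mul, Hol.fn_add, Hol.fn_of hx,
        fderiv_mul (F.differentiableAt hx) (G.differentiableAt hx)]

theorem Hol.D_apply (w : E) (F : Hol Ω) {x : E} (hx : x ∈ Ω) :
    (Hol.D w F).fn x = fderiv ℂ F.fn x w := Hol.fn_of hx

theorem Hol.D_comm (v w : E) (F : Hol Ω) : Hol.D v (Hol.D w F) = Hol.D w (Hol.D v F) := by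
  have h : ∀ (w : E) {x : E} (_ : x ∈ Ω), (Hol.D w F).fn =ᶠ[𝓝 x] fun y => fderiv ℂ F.fn y w :=
    fun w x hx => extendZero_eventuallyEq (fun y => fderiv ℂ F.fn y w) hx
  refine Hol.ext_fn fun x hx => ?_
  rw [Hol.D_apply _ _ hx, Hol.D_apply _ _ hx, (h w hx).fderiv_eq, (h v hx).fderiv_eq]
  exact fderiv_fderiv_comm Ω.isOpen F.differentiableOn hx w v

end Holomorphic

/-! ### Poisson brackets -/

section Poisson

variable {R ι : Type*} [CommRing R] [Algebra ℂ R] [Fintype ι] {P Q : ι → Derivation ℂ R R}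

/-- The Poisson bracket `∑ⱼ (Qⱼ F · Pⱼ G - Pⱼ F · Qⱼ G)` built from two families of derivations. -/
def poisson (P Q : ι → Derivation ℂ R R) (F G : R) : R :=
  ∑ j, (Q j F * P j G - P j F * Q j G)

theorem poisson_jacobi (hPP : ∀ i j x, P i (P j x) = P j (P i x))
    (hQQ : ∀ i j x, Q i (Q j x) = Q j (Q i x)) (hPQ : ∀ i j x, P i (Q j x) = Q j (P i x))
    (F G H : R) :
    poisson P Q F (poisson P Q G H) =
      poisson P Q (poisson P Q F G) H + poisson P Q G (poisson P Q F H) := by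
  rw [← sub_eq_zero]
  simp only [poisson, map_sum, map_sub, Derivation.leibniz, smul_eq_mul, Finset.mul_sum,
    Finset.sum_mul, ← Finset.sum_sub_distrib, ← Finset.sum_add_distrib, hPQ]
  -- the summand is antisymmetric in the two indices
  set S : ι → ι → R := fun i j => _ with hS
  change ∑ i, ∑ j, S i j = 0
  have h : ∀ i j, S i j = - S j i := by
    intro i j
    simp only [hS, hPP j i, hQQ j i]
    ring
  have h2 : ∑ i, ∑ j, S i j = -∑ i, ∑ j, S i j := by
    conv_lhs => rw [Finset.sum_comm]
    rw [← Finset.sum_neg_distrib]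
    refine Finset.sum_congr rfl fun i _ => ?_
    rw [← Finset.sum_neg_distrib]
    exact Finset.sum_congr rfl fun j _ => h j i
  have h3 : (2 : ℂ) • ∑ i, ∑ j, S i j = 0 := by
    rw [two_smul]
    nth_rewrite 1 [h2]
    exact neg_add_cancel _
  have h4 := congrArg ((2 : ℂ)⁻¹ • ·) h3
  simpa using h4

end Poisson

end

end AperiodicNekhoroshev

namespace AperiodicNekhoroshev

noncomputable section

/-! ### Formal integrals in a Lie algebra -/

section Formal

open Finset hiding mem_antidiagonal
open Finset.HasAntidiagonal (mem_antidiagonal)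

theorem sum_antidiagonal_assoc {M : Type*} [AddCommMonoid M] (f : ℕ → ℕ → ℕ → M) (s : ℕ) :
    ∑ p ∈ antidiagonal s, ∑ q ∈ antidiagonal p.1, f q.1 q.2 p.2 =
      ∑ p ∈ antidiagonal s, ∑ q ∈ antidiagonal p.2, f p.1 q.1 q.2 := by
  rw [sum_sigma', sum_sigma']
  refine sum_nbij' (fun x => ⟨(x.2.1, x.2.2 + x.1.2), (x.2.2, x.1.2)⟩)
    (fun x => ⟨(x.1.1 + x.2.1, x.2.2), (x.1.1, x.2.1)⟩) ?_ ?_ ?_ ?_ ?_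
  all_goals rintro ⟨⟨a, b⟩, c, d⟩
  all_goals simp only [mem_sigma, mem_antidiagonal]
  all_goals rintro ⟨h1, h2⟩
  all_goals subst h2
  all_goals try subst h1
  all_goals simp [add_assoc]

variable {L : Type*} [LieRing L] [LieAlgebra ℂ L]

/-- The coefficients of the bracket of two formal power series with coefficients in a Lie
algebra. -/
def convLie (F G : ℕ → L) (s : ℕ) : L := ∑ p ∈ antidiagonal s, ⁅F p.1, G p.2⁆

omit [LieAlgebra ℂ L] in
theorem convLie_jacobi (F X H : ℕ → L) (s : ℕ) :
    convLie (convLie F X) H s = convLie F (convLie X H) s + convLie (convLie F H) X s := by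
  have h1 : convLie (convLie F X) H s =
      ∑ p ∈ antidiagonal s, ∑ q ∈ antidiagonal p.2, ⁅⁅F p.1, X q.1⁆, H q.2⁆ := by
    rw [← sum_antidiagonal_assoc fun i j k => ⁅⁅F i, X j⁆, H k⁆]
    simp only [convLie, sum_lie]
  have h2 : convLie (convLie F H) X s =
      ∑ p ∈ antidiagonal s, ∑ q ∈ antidiagonal p.2, ⁅⁅F p.1, H q.1⁆, X q.2⁆ := by
    rw [← sum_antidiagonal_assoc fun i j k => ⁅⁅F i, H j⁆, X k⁆]
    simp only [convLie, sum_lie]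
  rw [h1, h2]
  simp only [convLie, lie_sum, ← sum_add_distrib]
  refine sum_congr rfl fun p _ => ?_
  rw [sum_add_distrib, ← Nat.sum_antidiagonal_swap (f := fun q : ℕ × ℕ => ⁅⁅F p.1, H q.1⁆, X q.2⁆),
    ← sum_add_distrib]
  refine sum_congr rfl fun q _ => ?_
  simp only [Prod.fst_swap, Prod.snd_swap]
  rw [leibniz_lie, add_assoc, ← lie_skew (X q.1), neg_add_cancel, add_zero]

omit [LieAlgebra ℂ L] in
theorem convLie_skew (F G : ℕ → L) (s : ℕ) : convLie F G s = -convLie G F s := by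
  rw [convLie, convLie, ← Nat.sum_antidiagonal_swap, ← sum_neg_distrib]
  exact sum_congr rfl fun p _ => (lie_skew _ _).symm

omit [LieAlgebra ℂ L] in
theorem convLie_add_right (F G G' : ℕ → L) (s : ℕ) :
    convLie F (fun i => G i + G' i) s = convLie F G s + convLie F G' s := by
  simp only [convLie, lie_add, sum_add_distrib]

theorem convLie_smul_right (F G : ℕ → L) (c : ℂ) (s : ℕ) :
    convLie F (fun i => c • G i) s = c • convLie F G s := by
  simp only [convLie, lie_smul, smul_sum]

/-- The Euler operator is a derivation of the bracket of formal power series. -/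
theorem smul_convLie (F G : ℕ → L) (s : ℕ) : (s : ℂ) • convLie F G s =
    convLie (fun i => (i : ℂ) • F i) G s + convLie F (fun i => (i : ℂ) • G i) s := by
  simp only [convLie, smul_sum, ← sum_add_distrib]
  refine sum_congr rfl fun p hp => ?_
  rw [mem_antidiagonal] at hp
  rw [smul_lie, lie_smul, ← add_smul, ← hp]
  push_cast
  rfl

omit [LieAlgebra ℂ L] in
theorem convLie_congr {F F' G G' : ℕ → L} {s : ℕ} (hF : ∀ i ≤ s, F i = F' i)
    (hG : ∀ i ≤ s, G i = G' i) : convLie F G s = convLie F' G' s := by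
  refine sum_congr rfl fun p hp => ?_
  rw [hF _ (HasAntidiagonal.antidiagonal.fst_le hp), hG _ (HasAntidiagonal.antidiagonal.snd_le hp)]

omit [LieAlgebra ℂ L] in
theorem convLie_eq_zero {F X : ℕ → L} {s : ℕ} (h0 : X 0 = 0) (h : ∀ i < s, F i = 0) :
    convLie F X s = 0 := by
  refine sum_eq_zero fun p hp => ?_
  rw [mem_antidiagonal] at hp
  rcases Nat.eq_zero_or_pos p.2 with h2 | h2
  · rw [h2, h0, lie_zero]
  · rw [h p.1 (by omega), zero_lie]

/-- **Formal integrals.** Let `H` be a formal power series with coefficients in a Lie algebra, `X` a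
generating series and `Φ` the solution of `Φ' = [Φ, X]` (the prime is the Euler operator). If
`[X, H] + H'` is the sum of the transforms `w l` of elements `w l l`, in the sense that
`(w l)' - l w l = [w l, X]`, and if `Φ 0` commutes with `H 0` and with all the `w l l`, then `Φ`
commutes with `H` up to the order to which these equations hold. -/
theorem convLie_eq_zero_of_generator {N : ℕ} {H X Φ : ℕ → L} {w : ℕ → ℕ → L} (hX : X 0 = 0)
    (hw : ∀ l s, s < l → w l s = 0)
    (hH : ∀ s ≤ N, convLie X H s + (s : ℂ) • H s = ∑ l ∈ range (N + 1), w l s)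
    (hwX : ∀ l : ℕ, ∀ s ≤ N, ((s : ℂ) - l) • w l s = convLie (w l) X s)
    (hΦ : ∀ s ≤ N, (s : ℂ) • Φ s = convLie Φ X s)
    (h0 : ⁅Φ 0, H 0⁆ = 0) (h0w : ∀ l ≤ N, ⁅Φ 0, w l l⁆ = 0) :
    ∀ s ≤ N, convLie Φ H s = 0 := by
  have hU : ∀ l ≤ N, ∀ s ≤ N, convLie Φ (w l) s = 0 := by
    intro l hl s
    induction s using Nat.strong_induction_on with
    | _ s ih =>
      intro hs
      rcases lt_trichotomy s l with hsl | rfl | hsl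
      · refine sum_eq_zero fun p hp => ?_
        rw [hw l p.2 ((HasAntidiagonal.antidiagonal.snd_le hp).trans_lt hsl), lie_zero]
      · rw [convLie, sum_eq_single (0, s)]
        · exact h0w s hl
        · intro p hp hne
          rw [mem_antidiagonal] at hp
          rw [hw s p.2, lie_zero]
          by_contra hcon
          exact hne (Prod.ext (by simp only; omega) (by simp only; omega))
        · simp
      · have h1 := smul_convLie Φ (w l) s
        have h2 : convLie Φ (fun i => (i : ℂ) • w l i) s =
            convLie Φ (convLie (w l) X) s + (l : ℂ) • convLie Φ (w l) s := by
          rw [← convLie_smul_right, ← convLie_add_right]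
          refine convLie_congr (fun i _ => rfl) fun i hi => ?_
          rw [← hwX l i (hi.trans hs), sub_smul, sub_add_cancel]
        have h3 : convLie (fun i => (i : ℂ) • Φ i) (w l) s = convLie Φ (convLie X (w l)) s := by
          rw [convLie_congr (F' := convLie Φ X) (fun i hi => hΦ i (hi.trans hs)) (fun i _ => rfl),
            convLie_jacobi, convLie_eq_zero (F := convLie Φ (w l)) hX
              (fun i hi => ih i hi (hi.le.trans hs)), add_zero]
        have h4 : convLie Φ (convLie X (w l)) s + convLie Φ (convLie (w l) X) s = 0 := by
          rw [← convLie_add_right]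
          refine sum_eq_zero fun p _ => ?_
          simp only
          rw [convLie_skew X (w l), neg_add_cancel, lie_zero]
        rw [h2, h3, ← add_assoc, h4, zero_add, ← sub_eq_zero, ← sub_smul] at h1
        refine (smul_eq_zero.1 h1).resolve_left ?_
        rw [sub_eq_zero]
        exact_mod_cast hsl.ne'
  intro s
  induction s using Nat.strong_induction_on with
  | _ s ih =>
    intro hs
    rcases Nat.eq_zero_or_pos s with rfl | hpos
    · simpa [convLie] using h0
    have h1 := smul_convLie Φ H s
    have h3 : convLie (fun i => (i : ℂ) • Φ i) H s = convLie Φ (convLie X H) s := by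
      rw [convLie_congr (F' := convLie Φ X) (fun i hi => hΦ i (hi.trans hs)) (fun i _ => rfl),
        convLie_jacobi, convLie_eq_zero (F := convLie Φ H) hX
          (fun i hi => ih i hi (hi.le.trans hs)), add_zero]
    rw [h3, ← convLie_add_right, convLie_congr (fun i _ => rfl) (fun i hi => hH i (hi.trans hs))]
      at h1
    have h5 : convLie Φ (fun i => ∑ l ∈ range (N + 1), w l i) s = 0 := by
      simp only [convLie, lie_sum]
      rw [sum_comm]
      exact sum_eq_zero fun l hl => hU l (by simpa [Nat.lt_succ_iff] using hl) s hs
    rw [h5] at h1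
    refine (smul_eq_zero.1 h1).resolve_left ?_
    exact_mod_cast hpos.ne'

end Formal

end

end AperiodicNekhoroshev

namespace AperiodicNekhoroshev

noncomputable section

open Metric Set Filter Topology MeasureTheory

/-! ### The Lie algebra of time-dependent observables -/

section PoissonBilinear

variable {R ι : Type*} [CommRing R] [Algebra ℂ R] [Fintype ι] (P Q : ι → Derivation ℂ R R)

/-- The Poisson bracket as a bilinear map. -/
def poissonₗ : R →ₗ[ℂ] R →ₗ[ℂ] R :=
  LinearMap.mk₂ ℂ (poisson P Q)
    (fun F F' G => by
      simp only [poisson, map_add, ← Finset.sum_add_distrib]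
      exact Finset.sum_congr rfl fun j _ => by ring)
    (fun c F G => by
      simp only [poisson, Derivation.map_smul, Finset.smul_sum, smul_sub, smul_mul_assoc])
    (fun F G G' => by
      simp only [poisson, map_add, ← Finset.sum_add_distrib]
      exact Finset.sum_congr rfl fun j _ => by ring)
    (fun c F G => by
      simp only [poisson, Derivation.map_smul, Finset.smul_sum, smul_sub, mul_smul_comm])

theorem poissonₗ_apply (F G : R) : poissonₗ P Q F G = poisson P Q F G := rfl

theorem poissonₗ_skew (F G : R) : poissonₗ P Q G F = -poissonₗ P Q F G := by
  simp only [poissonₗ_apply, poisson, ← Finset.sum_neg_distrib]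
  exact Finset.sum_congr rfl fun j _ => by ring

omit P Q in
theorem derivation_poissonₗ {P Q : ι → Derivation ℂ R R} {T : Derivation ℂ R R}
    (hP : ∀ i x, T (P i x) = P i (T x))
    (hQ : ∀ i x, T (Q i x) = Q i (T x)) (F G : R) :
    T (poissonₗ P Q F G) = poissonₗ P Q (T F) G + poissonₗ P Q F (T G) := by
  simp only [poissonₗ_apply, poisson, map_sum, map_sub, Derivation.leibniz, hP, hQ, smul_eq_mul,
    ← Finset.sum_add_distrib]
  exact Finset.sum_congr rfl fun j _ => by ring

end PoissonBilinear

/-- The complexified phase space of the variables `(I, φ, ξ)`. -/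
abbrev Phase (n : ℕ) : Type := CVec n × CVec n × ℂ

variable {n : ℕ} {Ω : TopologicalSpace.Opens (Phase n)}

/-- The derivative with respect to the action `I j`. -/
def dAct (j : Fin n) : Derivation ℂ (Hol Ω) (Hol Ω) := Hol.D (EuclideanSpace.single j 1, 0, 0)

/-- The derivative with respect to the angle `φ j`. -/
def dAng (j : Fin n) : Derivation ℂ (Hol Ω) (Hol Ω) := Hol.D (0, EuclideanSpace.single j 1, 0)

/-- The derivative with respect to the slow time `ξ`. -/
def dTime : Derivation ℂ (Hol Ω) (Hol Ω) := Hol.D (0, 0, 1)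

/-- The Poisson bracket of holomorphic functions of `(I, φ, ξ)`. -/
def pb : Hol Ω →ₗ[ℂ] Hol Ω →ₗ[ℂ] Hol Ω := poissonₗ dAct dAng

theorem pb_jacobi (F G H : Hol Ω) : pb F (pb G H) = pb (pb F G) H + pb G (pb F H) :=
  poisson_jacobi (P := dAct) (Q := dAng) (fun _ _ _ => Hol.D_comm _ _ _)
    (fun _ _ _ => Hol.D_comm _ _ _) (fun _ _ _ => Hol.D_comm _ _ _) F G H

theorem dTime_pb (F G : Hol Ω) : dTime (pb F G) = pb (dTime F) G + pb F (dTime G) :=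
  derivation_poissonₗ (P := dAct) (Q := dAng) (T := dTime) (fun _ _ => Hol.D_comm _ _ _)
    (fun _ _ => Hol.D_comm _ _ _) F G

theorem pb_skew (F G : Hol Ω) : pb G F = -pb F G := poissonₗ_skew _ _ F G

/-- The functions `F(I, φ, ξ) + a η`, where `η` is the variable conjugate to the slow time `ξ`:
the pair `(F, a)` stands for `F + a η`. -/
def Obs (Ω : TopologicalSpace.Opens (Phase n)) : Type := Hol Ω × ℂ

instance : AddCommGroup (Obs Ω) := inferInstanceAs (AddCommGroup (Hol Ω × ℂ))

instance : Module ℂ (Obs Ω) := inferInstanceAs (Module ℂ (Hol Ω × ℂ))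

namespace Obs

/-- The part of an observable that does not contain `η`. -/
def fst : Obs Ω →ₗ[ℂ] Hol Ω := LinearMap.fst ℂ (Hol Ω) ℂ

/-- The coefficient of `η`. -/
def snd : Obs Ω →ₗ[ℂ] ℂ := LinearMap.snd ℂ (Hol Ω) ℂ

/-- The observable `F + a η`. -/
def mk (F : Hol Ω) (a : ℂ) : Obs Ω := (F, a)

@[simp] theorem fst_mk (F : Hol Ω) (a : ℂ) : fst (mk F a) = F := rfl

@[simp] theorem snd_mk (F : Hol Ω) (a : ℂ) : snd (mk F a) = a := rfl

theorem ext {x y : Obs Ω} (h1 : fst x = fst y) (h2 : snd x = snd y) : x = y := Prod.ext h1 h2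

/-- The Poisson bracket in the phase space extended by the pair `(ξ, η)`. -/
instance : Bracket (Obs Ω) (Obs Ω) :=
  ⟨fun x y => mk (pb (fst x) (fst y) + snd y • dTime (fst x) - snd x • dTime (fst y)) 0⟩

theorem fst_lie (x y : Obs Ω) :
    fst ⁅x, y⁆ = pb (fst x) (fst y) + snd y • dTime (fst x) - snd x • dTime (fst y) := rfl

@[simp] theorem snd_lie (x y : Obs Ω) : snd ⁅x, y⁆ = 0 := rfl

instance : LieRing (Obs Ω) where
  add_lie x y z := ext (by simp only [fst_lie, map_add, LinearMap.add_apply]; module) (by simp)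
  lie_add x y z := ext (by simp only [fst_lie, map_add]; module) (by simp)
  lie_self x := by
    have h : pb (fst x) (fst x) = 0 := by
      simp only [pb, poissonₗ_apply, poisson]
      exact Finset.sum_eq_zero fun j _ => by ring
    exact ext (by rw [fst_lie, h, map_zero]; module) (by simp)
  leibniz_lie x y z := by
    refine ext ?_ (by simp)
    simp only [fst_lie, snd_lie, map_add, map_sub, map_smul, Derivation.map_smul,
      LinearMap.add_apply, LinearMap.sub_apply, LinearMap.smul_apply]
    simp only [pb_jacobi (fst x) (fst y) (fst z), dTime_pb, pb_skew (dTime (fst x)) (fst y)]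
    module

instance : LieAlgebra ℂ (Obs Ω) where
  lie_smul c x y := ext (by
    simp only [fst_lie, map_smul, Derivation.map_smul, smul_eq_mul]; module) (by simp)

end Obs

end

end AperiodicNekhoroshev

namespace AperiodicNekhoroshev

noncomputable section

open Metric Set Filter Topology MeasureTheory

/-! ### Trigonometric polynomials with holomorphic coefficients -/

variable {n : ℕ}

theorem isOpen_angleStrip (n : ℕ) (s : ℝ) : IsOpen (angleStrip n s) := by
  have : angleStrip n s = ⋂ j, (fun φ : CVec n => |(φ j).im|) ⁻¹' Iio s := by
    ext φ; simp [angleStrip]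
  rw [this]
  exact isOpen_iInter_of_finite fun j => isOpen_Iio.preimage
    (Complex.continuous_im.comp (EuclideanSpace.proj j : CVec n →L[ℂ] ℂ).continuous).abs

theorem isOpen_timeStrip (s : ℝ) : IsOpen (timeStrip s) :=
  isOpen_Iio.preimage Complex.continuous_im.abs

/-- The `ℓ¹` norm of an integer vector. -/
def l1 (k : Fin n → ℤ) : ℕ := ∑ j, (k j).natAbs

theorem l1_add_le (k l : Fin n → ℤ) : l1 (k + l) ≤ l1 k + l1 l := by
  rw [l1, l1, l1, ← Finset.sum_add_distrib]
  exact Finset.sum_le_sum fun j _ => Int.natAbs_add_le _ _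

theorem l1_cast (k : Fin n → ℤ) : (l1 k : ℝ) = ∑ j, |(k j : ℝ)| := by
  simp [l1, Nat.cast_natAbs]

/-- The pairing `∑ⱼ kⱼ φⱼ` of an integer vector with a complex vector. -/
def pairing (k : Fin n → ℤ) : CVec n →L[ℂ] ℂ :=
  ∑ j, (k j : ℂ) • (EuclideanSpace.proj j : CVec n →L[ℂ] ℂ)

theorem pairing_apply (k : Fin n → ℤ) (φ : CVec n) : pairing k φ = ∑ j, (k j : ℂ) * φ j := by
  simp [pairing]

theorem pairing_single (k : Fin n → ℤ) (j : Fin n) :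
    pairing k (EuclideanSpace.single j 1) = k j := by
  rw [pairing_apply, Finset.sum_eq_single j]
  · simp
  · intro i _ hij; simp [hij]
  · simp

theorem pairing_add (k l : Fin n → ℤ) : pairing (k + l) = pairing k + pairing l := by
  ext φ
  simp [pairing_apply, add_mul, Finset.sum_add_distrib]

/-- The integer vector `k` as a vector of `ℂⁿ`. -/
def intVec (k : Fin n → ℤ) : CVec n := WithLp.toLp 2 fun j => (k j : ℂ)

theorem intVec_eq_sum (k : Fin n → ℤ) :
    intVec k = ∑ j, (k j : ℂ) • (EuclideanSpace.single j 1 : CVec n) := by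
  ext i
  simp [intVec, Finset.sum_apply, Pi.single_apply]

/-- The data of an analytic normal form construction: a ball of radius `r` for the actions, the
half width `s` of the strips of the angles and of the slow time, the number `N` of steps and
the number `K` of harmonics that are taken into account in every step. -/
structure Frame (n : ℕ) where
  /-- the centre of the ball of actions -/
  c : CVec n
  /-- the radius of the ball of actions -/
  r : ℝ
  /-- the half width of the strips -/
  s : ℝ
  /-- the number of steps -/
  N : ℕ
  /-- the number of harmonics per step -/
  K : ℕ
  hr : 0 < r
  hs : 0 < s
  hN : 0 < N
  hK : 0 < K

namespace Frame

variable (A : Frame n)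

/-- The domain of the variables `(I, φ, ξ)`. -/
def dom : TopologicalSpace.Opens (Phase n) :=
  ⟨ball A.c A.r ×ˢ angleStrip n A.s ×ˢ timeStrip A.s,
    isOpen_ball.prod ((isOpen_angleStrip n A.s).prod (isOpen_timeStrip A.s))⟩

theorem mem_dom {x : Phase n} :
    x ∈ A.dom ↔ x.1 ∈ ball A.c A.r ∧ x.2.1 ∈ angleStrip n A.s ∧ x.2.2 ∈ timeStrip A.s :=
  Iff.rfl

/-- The domain of `(I, ξ)` on which objects of order `p` are estimated: it shrinks linearly in `p`,
down to half the size for `p = 2 N`. -/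
def U (p : ℕ) : Set (CVec n × ℂ) :=
  ball A.c (A.r * (1 - p / (4 * A.N))) ×ˢ timeStrip (A.s * (1 - p / (4 * A.N)))

theorem hN' : (0 : ℝ) < A.N := by exact_mod_cast A.hN

theorem hK' : (0 : ℝ) < A.K := by exact_mod_cast A.hK

theorem isOpen_U (p : ℕ) : IsOpen (A.U p) := isOpen_ball.prod (isOpen_timeStrip _)

theorem U_mono {p q : ℕ} (h : p ≤ q) : A.U q ⊆ A.U p := by
  have h1 : (1 - q / (4 * A.N) : ℝ) ≤ 1 - p / (4 * A.N) := by gcongr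
  have hr := A.hr
  have hs := A.hs
  refine prod_mono (ball_subset_ball (mul_le_mul_of_nonneg_left h1 hr.le)) fun ξ hξ => ?_
  exact lt_of_lt_of_le (show |ξ.im| < _ from hξ) (mul_le_mul_of_nonneg_left h1 hs.le)

theorem mem_U_zero {x : Phase n} (hx : x ∈ A.dom) : (x.1, x.2.2) ∈ A.U 0 := by
  obtain ⟨h1, -, h2⟩ := A.mem_dom.1 hx
  exact ⟨by simpa using h1, by simpa [timeStrip] using h2⟩

/-- Cauchy's estimate for an action derivative. -/
theorem norm_fderiv_single_le {g : CVec n × ℂ → ℂ} (hg : DifferentiableOn ℂ g (A.U 0)) {p q : ℕ}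
    (hq : 0 < q) {b : ℝ} (hb : ∀ x ∈ A.U p, ‖g x‖ ≤ b) {x : CVec n × ℂ} (hx : x ∈ A.U (p + q))
    (j : Fin n) : ‖fderiv ℂ g x (EuclideanSpace.single j 1, 0)‖ ≤ b * (4 * A.N / (A.r * q)) := by
  have hr := A.hr
  have hN := A.hN'
  have hq' : (0 : ℝ) < q := by exact_mod_cast hq
  have h := norm_fderiv_apply_le (A.isOpen_U 0) hg (x := x) (w := (EuclideanSpace.single j 1, 0))
    (R := A.r * q / (4 * A.N)) (C := b) (by positivity) (by
      intro z hz
      have hmem : x + z • ((EuclideanSpace.single j 1 : CVec n), (0 : ℂ)) ∈ A.U p := by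
        obtain ⟨h1, h2⟩ := hx
        refine ⟨?_, ?_⟩
        · simp only [mem_ball, dist_eq_norm, Prod.fst_add, Prod.smul_fst] at h1 ⊢
          have hz' : ‖z • (EuclideanSpace.single j 1 : CVec n)‖ ≤ A.r * q / (4 * A.N) := by
            rw [norm_smul]; simpa using hz
          calc ‖x.1 + z • (EuclideanSpace.single j 1 : CVec n) - A.c‖
              = ‖(x.1 - A.c) + z • (EuclideanSpace.single j 1 : CVec n)‖ := by congr 1; abel
            _ ≤ _ := norm_add_le _ _
            _ < A.r * (1 - ↑(p + q) / (4 * A.N)) + A.r * q / (4 * A.N) :=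
              add_lt_add_of_lt_of_le h1 hz'
            _ = _ := by push_cast; ring
        · have := (A.U_mono (Nat.le_add_right p q) ⟨h1, h2⟩).2
          simpa using this
      exact ⟨A.U_mono (Nat.zero_le p) hmem, hb _ hmem⟩)
  refine h.trans (le_of_eq ?_)
  field_simp

/-- Cauchy's estimate for the derivative with respect to the slow time. -/
theorem norm_fderiv_time_le {g : CVec n × ℂ → ℂ} (hg : DifferentiableOn ℂ g (A.U 0)) {p : ℕ}
    {b : ℝ} (hb : ∀ x ∈ A.U p, ‖g x‖ ≤ b) {x : CVec n × ℂ} (hx : x ∈ A.U (p + 1)) :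
    ‖fderiv ℂ g x (0, 1)‖ ≤ 4 * A.N / A.s * b := by
  have hs := A.hs
  have hN := A.hN'
  have h := norm_fderiv_apply_le (A.isOpen_U 0) hg (x := x) (w := (0, 1))
    (R := A.s / (4 * A.N)) (C := b) (by positivity) (by
      intro z hz
      have hmem : x + z • ((0 : CVec n), (1 : ℂ)) ∈ A.U p := by
        obtain ⟨h1, h2⟩ := hx
        refine ⟨?_, ?_⟩
        · have := (A.U_mono (Nat.le_add_right p 1) ⟨h1, h2⟩).1
          simpa using this
        · simp only [timeStrip, mem_ofPred_eq, Prod.snd_add, Prod.smul_snd, smul_eq_mul, mul_one,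
            Complex.add_im] at h2 ⊢
          calc |x.2.im + z.im| ≤ |x.2.im| + |z.im| := abs_add_le _ _
            _ < A.s * (1 - ↑(p + 1) / (4 * A.N)) + A.s / (4 * A.N) :=
              add_lt_add_of_lt_of_le h2 ((Complex.abs_im_le_norm z).trans hz)
            _ = _ := by push_cast; ring
      exact ⟨A.U_mono (Nat.zero_le p) hmem, hb _ hmem⟩)
  refine h.trans (le_of_eq ?_)
  field_simp

/-- The function `g(I, ξ) e^{i k·φ}`. -/
def harmonicFun (g : CVec n × ℂ → ℂ) (k : Fin n → ℤ) (x : Phase n) : ℂ :=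
  g (x.1, x.2.2) * Complex.exp (Complex.I * pairing k x.2.1)

/-- The projection `(I, φ, ξ) ↦ (I, ξ)`. -/
def slow : Phase n →L[ℂ] CVec n × ℂ :=
  (ContinuousLinearMap.fst ℂ _ _).prod
    ((ContinuousLinearMap.snd ℂ _ _).comp (ContinuousLinearMap.snd ℂ _ _))

theorem hasFDerivAt_harmonicFun {g : CVec n × ℂ → ℂ} {k : Fin n → ℤ} {x : Phase n}
    (hg : DifferentiableAt ℂ g (x.1, x.2.2)) :
    HasFDerivAt (harmonicFun g k)
      (g (x.1, x.2.2) • Complex.exp (Complex.I * pairing k x.2.1) • Complex.I •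
          (pairing k).comp ((ContinuousLinearMap.fst ℂ _ _).comp (ContinuousLinearMap.snd ℂ _ _)) +
        Complex.exp (Complex.I * pairing k x.2.1) • (fderiv ℂ g (x.1, x.2.2)).comp slow) x := by
  have h1 : HasFDerivAt (fun x : Phase n => g (x.1, x.2.2))
      ((fderiv ℂ g (x.1, x.2.2)).comp slow) x :=
    HasFDerivAt.comp (f := slow) x hg.hasFDerivAt slow.hasFDerivAt
  have h2 : HasFDerivAt (fun x : Phase n => Complex.I * pairing k x.2.1) (Complex.I •
      (pairing k).comp ((ContinuousLinearMap.fst ℂ _ _).comp (ContinuousLinearMap.snd ℂ _ _))) x :=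
    (((pairing k).comp ((ContinuousLinearMap.fst ℂ _ _).comp
      (ContinuousLinearMap.snd ℂ _ _))).hasFDerivAt (x := x)).const_mul Complex.I
  exact h1.mul h2.cexp

theorem differentiableOn_harmonicFun {g : CVec n × ℂ → ℂ} (k : Fin n → ℤ)
    (hg : DifferentiableOn ℂ g (A.U 0)) : DifferentiableOn ℂ (harmonicFun g k) A.dom :=
  fun _ hx => (hasFDerivAt_harmonicFun
    (hg.differentiableAt ((A.isOpen_U 0).mem_nhds (A.mem_U_zero hx)))).differentiableAt
      |>.differentiableWithinAt

variable {A} in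
/-- The function `g(I, ξ) e^{i k·φ}` on the domain of the variables. -/
def atom (g : CVec n × ℂ → ℂ) (k : Fin n → ℤ) (hg : DifferentiableOn ℂ g (A.U 0)) : Hol A.dom :=
  Hol.of (harmonicFun g k) (A.differentiableOn_harmonicFun k hg)

variable {A}

theorem fn_atom {g : CVec n × ℂ → ℂ} {k : Fin n → ℤ} {hg : DifferentiableOn ℂ g (A.U 0)}
    {x : Phase n} (hx : x ∈ A.dom) : (atom g k hg).fn x =
      g (x.1, x.2.2) * Complex.exp (Complex.I * pairing k x.2.1) := Hol.fn_of hx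

theorem fderiv_atom {g : CVec n × ℂ → ℂ} {k : Fin n → ℤ} {hg : DifferentiableOn ℂ g (A.U 0)}
    {x : Phase n} (hx : x ∈ A.dom) (a b : CVec n) (t : ℂ) :
    fderiv ℂ (atom g k hg).fn x (a, b, t) =
      (fderiv ℂ g (x.1, x.2.2) (a, t) + Complex.I * pairing k b * g (x.1, x.2.2)) *
        Complex.exp (Complex.I * pairing k x.2.1) := by
  rw [atom, Hol.fderiv_fn_of hx, (hasFDerivAt_harmonicFun
    (hg.differentiableAt ((A.isOpen_U 0).mem_nhds (A.mem_U_zero hx)))).fderiv]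
  simp [slow]
  ring

end Frame

theorem fn_pb {Ω : TopologicalSpace.Opens (Phase n)} (F G : Hol Ω) {x : Phase n} (hx : x ∈ Ω) :
    (pb F G).fn x = ∑ j, (fderiv ℂ F.fn x (0, EuclideanSpace.single j 1, 0) *
      fderiv ℂ G.fn x (EuclideanSpace.single j 1, 0, 0) -
      fderiv ℂ F.fn x (EuclideanSpace.single j 1, 0, 0) *
      fderiv ℂ G.fn x (0, EuclideanSpace.single j 1, 0)) := by
  simp only [pb, poissonₗ_apply, poisson, Hol.fn_sum, Finset.sum_apply, Hol.fn_sub, Hol.fn_mul,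
    Pi.sub_apply, Pi.mul_apply, dAct, dAng, Hol.D_apply _ _ hx]

namespace Frame

variable {A : Frame n}

/-- The derivative of `g(I, ξ)` in the direction of the integer vector `k`. -/
def dirDeriv (g : CVec n × ℂ → ℂ) (k : Fin n → ℤ) (x : CVec n × ℂ) : ℂ :=
  fderiv ℂ g x (intVec k, 0)

theorem dirDeriv_eq_sum (g : CVec n × ℂ → ℂ) (k : Fin n → ℤ) (x : CVec n × ℂ) :
    dirDeriv g k x = ∑ j, (k j : ℂ) * fderiv ℂ g x (EuclideanSpace.single j 1, 0) := by
  have : (intVec k, (0 : ℂ)) =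
      ∑ j, (k j : ℂ) • ((EuclideanSpace.single j 1 : CVec n), (0 : ℂ)) := by
    ext1
    · simp [Prod.fst_sum, intVec_eq_sum]
    · simp [Prod.snd_sum]
  rw [dirDeriv, this, map_sum]
  simp only [map_smul, smul_eq_mul]

theorem norm_dirDeriv_le {g : CVec n × ℂ → ℂ} (hg : DifferentiableOn ℂ g (A.U 0)) {p q : ℕ}
    (hq : 0 < q) {b : ℝ} (hb : ∀ x ∈ A.U p, ‖g x‖ ≤ b) {x : CVec n × ℂ} (hx : x ∈ A.U (p + q))
    (k : Fin n → ℤ) : ‖dirDeriv g k x‖ ≤ l1 k * (b * (4 * A.N / (A.r * q))) := by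
  rw [dirDeriv_eq_sum, l1_cast, Finset.sum_mul]
  refine (norm_sum_le _ _).trans (Finset.sum_le_sum fun j _ => ?_)
  rw [norm_mul, Complex.norm_intCast]
  exact mul_le_mul_of_nonneg_left (A.norm_fderiv_single_le hg hq hb hx j) (abs_nonneg _)

theorem differentiableOn_dirDeriv {g : CVec n × ℂ → ℂ} (hg : DifferentiableOn ℂ g (A.U 0))
    (k : Fin n → ℤ) : DifferentiableOn ℂ (dirDeriv g k) (A.U 0) :=
  differentiableOn_fderiv_apply (A.isOpen_U 0) hg _

/-- The coefficient of the Poisson bracket of two harmonics. -/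
def bracketCoeff (g g' : CVec n × ℂ → ℂ) (k l : Fin n → ℤ) (x : CVec n × ℂ) : ℂ :=
  Complex.I * (g x * dirDeriv g' k x - g' x * dirDeriv g l x)

theorem differentiableOn_bracketCoeff {g g' : CVec n × ℂ → ℂ} (hg : DifferentiableOn ℂ g (A.U 0))
    (hg' : DifferentiableOn ℂ g' (A.U 0)) (k l : Fin n → ℤ) :
    DifferentiableOn ℂ (bracketCoeff g g' k l) (A.U 0) :=
  ((hg.mul (differentiableOn_dirDeriv hg' k)).sub
    (hg'.mul (differentiableOn_dirDeriv hg l))).const_mul _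

theorem pb_atom {g g' : CVec n × ℂ → ℂ} (hg : DifferentiableOn ℂ g (A.U 0))
    (hg' : DifferentiableOn ℂ g' (A.U 0)) (k l : Fin n → ℤ) :
    pb (atom g k hg) (atom g' l hg') =
      atom (bracketCoeff g g' k l) (k + l) (differentiableOn_bracketCoeff hg hg' k l) := by
  refine Hol.ext_fn fun x hx => ?_
  rw [fn_pb _ _ hx, fn_atom hx, pairing_add]
  simp only [fderiv_atom hx, bracketCoeff, dirDeriv_eq_sum, pairing_single, add_apply, mul_add,
    Complex.exp_add]
  simp only [map_zero, mul_zero, zero_mul, add_zero, Prod.mk_zero_zero, zero_add]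
  rw [mul_sub, Finset.mul_sum, Finset.mul_sum, Finset.mul_sum, Finset.mul_sum,
    ← Finset.sum_sub_distrib, Finset.sum_mul]
  exact Finset.sum_congr rfl fun j _ => by ring

theorem dTime_atom {g : CVec n × ℂ → ℂ} (hg : DifferentiableOn ℂ g (A.U 0)) (k : Fin n → ℤ) :
    dTime (atom g k hg) = atom (fun x => fderiv ℂ g x (0, 1)) k
      (differentiableOn_fderiv_apply (A.isOpen_U 0) hg _) := by
  refine Hol.ext_fn fun x hx => ?_
  rw [dTime, Hol.D_apply _ _ hx, fderiv_atom hx, fn_atom hx]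
  simp

theorem smul_atom {g : CVec n × ℂ → ℂ} (hg : DifferentiableOn ℂ g (A.U 0)) (k : Fin n → ℤ) (z : ℂ) :
    z • atom g k hg = atom (fun x => z * g x) k (hg.const_mul z) := by
  refine Hol.ext_fn fun x hx => ?_
  rw [Hol.fn_smul, fn_atom hx, Pi.smul_apply, fn_atom hx, smul_eq_mul, mul_assoc]

end Frame

end

end AperiodicNekhoroshev

namespace AperiodicNekhoroshev

noncomputable section

open Metric Set Filter Topology MeasureTheory

/-! ### Estimates for trigonometric polynomials -/

variable {n : ℕ}

namespace Frame

variable {A : Frame n}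

/-- `F` is a trigonometric polynomial of order `p` and size at most `C`: a finite sum of harmonics
`g(I, ξ) e^{i k·φ}` with `|k|₁ ≤ p K`, the sum of whose suprema over the domain `U p` is at most
`C`. Different terms may have the same `k`. -/
def IsTrig (A : Frame n) (p : ℕ) (C : ℝ) (F : Hol A.dom) : Prop :=
  ∃ (ι : Type) (_ : Fintype ι) (g : ι → CVec n × ℂ → ℂ) (k : ι → Fin n → ℤ) (b : ι → ℝ)
    (hg : ∀ i, DifferentiableOn ℂ (g i) (A.U 0)),
    (∀ i, l1 (k i) ≤ p * A.K) ∧ (∀ i, 0 ≤ b i) ∧ (∀ i, ∀ x ∈ A.U p, ‖g i x‖ ≤ b i) ∧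
    ∑ i, b i ≤ C ∧ F = ∑ i, atom (g i) (k i) (hg i)

variable {p q : ℕ} {C C' : ℝ} {F G : Hol A.dom}

theorem IsTrig.nonneg (hF : IsTrig A p C F) : 0 ≤ C := by
  obtain ⟨ι, _, g, k, b, hg, hk, hb, hgb, hC, rfl⟩ := hF
  exact (Finset.sum_nonneg fun i _ => hb i).trans hC

theorem isTrig_zero : IsTrig A p 0 0 :=
  ⟨Empty, inferInstance, Empty.elim, Empty.elim, Empty.elim, fun i => i.elim, fun i => i.elim,
    fun i => i.elim, fun i => i.elim, by simp, by simp⟩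

theorem isTrig_atom {g : CVec n × ℂ → ℂ} {k : Fin n → ℤ} (hg : DifferentiableOn ℂ g (A.U 0))
    (hk : l1 k ≤ p * A.K) (hC : 0 ≤ C) (hgC : ∀ x ∈ A.U p, ‖g x‖ ≤ C) :
    IsTrig A p C (atom g k hg) :=
  ⟨Unit, inferInstance, fun _ => g, fun _ => k, fun _ => C, fun _ => hg, fun _ => hk, fun _ => hC,
    fun _ => hgC, by simp, by simp⟩

theorem IsTrig.add (hF : IsTrig A p C F) (hG : IsTrig A p C' G) : IsTrig A p (C + C') (F + G) := by
  obtain ⟨ι, _, g, k, b, hg, hk, hb, hgb, hC, rfl⟩ := hF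
  obtain ⟨κ, _, g', k', b', hg', hk', hb', hgb', hC', rfl⟩ := hG
  refine ⟨ι ⊕ κ, inferInstance, Sum.elim g g', Sum.elim k k', Sum.elim b b',
    fun i => by cases i; exacts [hg _, hg' _], fun i => by cases i; exacts [hk _, hk' _],
    fun i => by cases i; exacts [hb _, hb' _], fun i => by cases i; exacts [hgb _, hgb' _], ?_, ?_⟩
  · simpa using add_le_add hC hC'
  · simp

theorem IsTrig.mono (hF : IsTrig A p C F) (hpq : p ≤ q) (hCC' : C ≤ C') : IsTrig A q C' F := by
  obtain ⟨ι, _, g, k, b, hg, hk, hb, hgb, hC, rfl⟩ := hF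
  exact ⟨ι, inferInstance, g, k, b, hg, fun i => (hk i).trans (Nat.mul_le_mul_right _ hpq), hb,
    fun i x hx => hgb i x (A.U_mono hpq hx), hC.trans hCC', rfl⟩

theorem IsTrig.smul (hF : IsTrig A p C F) (z : ℂ) : IsTrig A p (‖z‖ * C) (z • F) := by
  obtain ⟨ι, _, g, k, b, hg, hk, hb, hgb, hC, rfl⟩ := hF
  refine ⟨ι, inferInstance, fun i x => z * g i x, k, fun i => ‖z‖ * b i,
    fun i => (hg i).const_mul z, hk, fun i => mul_nonneg (norm_nonneg z) (hb i),
    fun i x hx => ?_, ?_, ?_⟩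
  · rw [norm_mul]
    exact mul_le_mul_of_nonneg_left (hgb i x hx) (norm_nonneg z)
  · rw [← Finset.mul_sum]
    exact mul_le_mul_of_nonneg_left hC (norm_nonneg z)
  · rw [Finset.smul_sum]
    exact Finset.sum_congr rfl fun i _ => smul_atom (hg i) (k i) z

theorem isTrig_sum {ι : Type*} {s : Finset ι} {F : ι → Hol A.dom} {C : ι → ℝ}
    (h : ∀ i ∈ s, IsTrig A p (C i) (F i)) : IsTrig A p (∑ i ∈ s, C i) (∑ i ∈ s, F i) := by
  classical
  induction s using Finset.induction_on with
  | empty => simpa using isTrig_zero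
  | insert a s ha ih =>
    rw [Finset.sum_insert ha, Finset.sum_insert ha]
    exact (h a (Finset.mem_insert_self a s)).add
      (ih fun i hi => h i (Finset.mem_insert_of_mem hi))

/-- The constant in the estimate of the bracket. -/
def Γ (A : Frame n) : ℝ := 8 * A.N * A.K / A.r

theorem Γ_pos : 0 < A.Γ := by
  have := A.hr; have := A.hN'; have := A.hK'
  unfold Γ; positivity

/-- The estimate of the Poisson bracket. The constant does not depend on the orders: the number of
harmonics is proportional to the order of the factor that is differentiated with respect to the
angles, and so is the loss of domain for the other one. -/
theorem IsTrig.pb (hp : 0 < p) (hq : 0 < q) (hF : IsTrig A p C F) (hG : IsTrig A q C' G) :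
    IsTrig A (p + q) (A.Γ * C * C') (pb F G) := by
  have hCC := hF.nonneg
  obtain ⟨ι, _, g, k, b, hg, hk, hb, hgb, hC, rfl⟩ := hF
  obtain ⟨κ, _, g', k', b', hg', hk', hb', hgb', hC', rfl⟩ := hG
  have hr := A.hr
  have hN := A.hN'
  have hK := A.hK'
  have hp' : (0 : ℝ) < p := by exact_mod_cast hp
  have hq' : (0 : ℝ) < q := by exact_mod_cast hq
  refine ⟨ι × κ, inferInstance, fun i => bracketCoeff (g i.1) (g' i.2) (k i.1) (k' i.2),
    fun i => k i.1 + k' i.2, fun i => A.Γ * b i.1 * b' i.2,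
    fun i => differentiableOn_bracketCoeff (hg i.1) (hg' i.2) _ _, fun i => ?_,
    fun i => mul_nonneg (mul_nonneg Γ_pos.le (hb _)) (hb' _), fun i x hx => ?_, ?_, ?_⟩
  · refine (l1_add_le _ _).trans ?_
    rw [add_mul]
    exact add_le_add (hk _) (hk' _)
  · have h1 : ‖g i.1 x‖ ≤ b i.1 := hgb _ _ (A.U_mono (Nat.le_add_right p q) hx)
    have h2 : ‖g' i.2 x‖ ≤ b' i.2 := hgb' _ _ (A.U_mono (Nat.le_add_left q p) hx)
    have h3 : ‖dirDeriv (g' i.2) (k i.1) x‖ ≤ p * A.K * (b' i.2 * (4 * A.N / (A.r * p))) := by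
      refine (norm_dirDeriv_le (hg' i.2) hp (hgb' i.2) (by rwa [add_comm]) _).trans ?_
      refine mul_le_mul_of_nonneg_right (by exact_mod_cast hk i.1)
        (mul_nonneg (hb' _) (by positivity))
    have h4 : ‖dirDeriv (g i.1) (k' i.2) x‖ ≤ q * A.K * (b i.1 * (4 * A.N / (A.r * q))) := by
      refine (norm_dirDeriv_le (hg i.1) hq (hgb i.1) hx _).trans ?_
      refine mul_le_mul_of_nonneg_right (by exact_mod_cast hk' i.2)
        (mul_nonneg (hb _) (by positivity))
    simp only [bracketCoeff]
    rw [norm_mul, Complex.norm_I, one_mul]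
    refine (norm_sub_le _ _).trans ?_
    rw [norm_mul, norm_mul]
    calc _ ≤ b i.1 * (p * A.K * (b' i.2 * (4 * A.N / (A.r * p)))) +
          b' i.2 * (q * A.K * (b i.1 * (4 * A.N / (A.r * q)))) :=
        add_le_add (mul_le_mul h1 h3 (norm_nonneg _) (hb _))
          (mul_le_mul h2 h4 (norm_nonneg _) (hb' _))
      _ = A.Γ * b i.1 * b' i.2 := by unfold Γ; field_simp; ring
  · rw [Fintype.sum_prod_type]
    simp only [← Finset.mul_sum, mul_assoc]
    rw [← Finset.sum_mul]
    refine mul_le_mul_of_nonneg_left ?_ Γ_pos.le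
    exact mul_le_mul hC hC' (Finset.sum_nonneg fun i _ => hb' i) hCC
  · rw [LinearMap.map_sum₂, Fintype.sum_prod_type]
    refine Finset.sum_congr rfl fun i _ => ?_
    rw [map_sum]
    exact Finset.sum_congr rfl fun j _ => pb_atom (hg i) (hg' j) (k i) (k' j)

theorem IsTrig.dTime (hF : IsTrig A p C F) :
    IsTrig A (p + 1) (4 * A.N / A.s * C) (dTime F) := by
  obtain ⟨ι, _, g, k, b, hg, hk, hb, hgb, hC, rfl⟩ := hF
  have hs := A.hs
  have hN := A.hN'
  refine ⟨ι, inferInstance, fun i x => fderiv ℂ (g i) x (0, 1), k, fun i => 4 * A.N / A.s * b i,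
    fun i => differentiableOn_fderiv_apply (A.isOpen_U 0) (hg i) _,
    fun i => (hk i).trans (Nat.mul_le_mul_right _ (Nat.le_succ p)),
    fun i => mul_nonneg (by positivity) (hb i), fun i x hx =>
    A.norm_fderiv_time_le (hg i) (hgb i) hx, ?_, ?_⟩
  · rw [← Finset.mul_sum]
    exact mul_le_mul_of_nonneg_left hC (by positivity)
  · rw [map_sum]
    exact Finset.sum_congr rfl fun i _ => dTime_atom (hg i) (k i)

theorem norm_exp_pairing {φ : CVec n} (hφ : ∀ j, (φ j).im = 0) (k : Fin n → ℤ) :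
    ‖Complex.exp (Complex.I * pairing k φ)‖ = 1 := by
  rw [Complex.norm_exp, pairing_apply]
  simp [hφ]

theorem IsTrig.norm_fn_le (hF : IsTrig A p C F) {x : Phase n} (hx : x ∈ A.dom)
    (hxU : (x.1, x.2.2) ∈ A.U p) (hφ : ∀ j, (x.2.1 j).im = 0) : ‖F.fn x‖ ≤ C := by
  obtain ⟨ι, _, g, k, b, hg, hk, hb, hgb, hC, rfl⟩ := hF
  rw [Hol.fn_sum, Finset.sum_apply]
  refine (norm_sum_le _ _).trans (le_trans (Finset.sum_le_sum fun i _ => ?_) hC)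
  rw [fn_atom hx, norm_mul, norm_exp_pairing hφ, mul_one]
  exact hgb i _ hxU

theorem fderiv_fn_sum {ι : Type*} [Fintype ι] (F : ι → Hol A.dom) {x : Phase n} (hx : x ∈ A.dom)
    (v : Phase n) : fderiv ℂ (∑ i, F i).fn x v = ∑ i, fderiv ℂ (F i).fn x v := by
  rw [Hol.fn_sum, fderiv_sum fun i _ => (F i).differentiableAt hx]
  simp

theorem IsTrig.norm_fderiv_act_le (hF : IsTrig A p C F) (hq : 0 < q) {x : Phase n}
    (hx : x ∈ A.dom) (hxU : (x.1, x.2.2) ∈ A.U (p + q)) (hφ : ∀ j, (x.2.1 j).im = 0) (j : Fin n) :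
    ‖fderiv ℂ F.fn x (EuclideanSpace.single j 1, 0, 0)‖ ≤ C * (4 * A.N / (A.r * q)) := by
  obtain ⟨ι, _, g, k, b, hg, hk, hb, hgb, hC, rfl⟩ := hF
  have hr := A.hr
  have hN := A.hN'
  rw [fderiv_fn_sum _ hx]
  have h0 : 0 ≤ 4 * A.N / (A.r * q) := by positivity
  refine (norm_sum_le _ _).trans (le_trans (Finset.sum_le_sum fun i _ => ?_)
    (le_trans (le_of_eq (Finset.sum_mul _ b _).symm) (mul_le_mul_of_nonneg_right hC h0)))
  rw [fderiv_atom hx, norm_mul, norm_exp_pairing hφ, mul_one, map_zero, mul_zero, zero_mul,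
    add_zero]
  exact A.norm_fderiv_single_le (hg i) hq (hgb i) hxU j

theorem natAbs_le_l1 (k : Fin n → ℤ) (j : Fin n) : (k j).natAbs ≤ l1 k :=
  Finset.single_le_sum (f := fun j => (k j).natAbs) (fun _ _ => Nat.zero_le _) (Finset.mem_univ j)

theorem IsTrig.norm_fderiv_ang_le (hF : IsTrig A p C F) {x : Phase n}
    (hx : x ∈ A.dom) (hxU : (x.1, x.2.2) ∈ A.U p) (hφ : ∀ j, (x.2.1 j).im = 0) (j : Fin n) :
    ‖fderiv ℂ F.fn x (0, EuclideanSpace.single j 1, 0)‖ ≤ p * A.K * C := by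
  obtain ⟨ι, _, g, k, b, hg, hk, hb, hgb, hC, rfl⟩ := hF
  rw [fderiv_fn_sum _ hx]
  refine (norm_sum_le _ _).trans (le_trans (Finset.sum_le_sum fun i _ => ?_)
    (le_trans (le_of_eq (Finset.mul_sum _ b _).symm) (mul_le_mul_of_nonneg_left hC
      (by positivity))))
  rw [fderiv_atom hx, norm_mul, norm_exp_pairing hφ, mul_one, Prod.mk_zero_zero, map_zero,
    zero_add, norm_mul, norm_mul, Complex.norm_I, one_mul, pairing_single, Complex.norm_intCast]
  refine mul_le_mul ?_ (hgb i _ hxU) (norm_nonneg _) (by positivity)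
  rw [← Int.cast_abs, Int.abs_eq_natAbs]
  exact_mod_cast (natAbs_le_l1 _ _).trans (hk i)

end Frame

end

end AperiodicNekhoroshev

namespace AperiodicNekhoroshev

noncomputable section

/-! ### A majorant argument for formal integrals -/

open Finset hiding mem_antidiagonal
open Finset.HasAntidiagonal (mem_antidiagonal)

/-- The weights `2⁻ˢ / s²`, which are almost stable under convolution. The weight of `s = 0` is
zero, by the convention on division by zero. -/
def wt (s : ℕ) : ℝ := (1 / 2) ^ s / (s : ℝ) ^ 2

theorem wt_zero : wt 0 = 0 := by simp [wt]

theorem wt_one : wt 1 = 1 / 2 := by simp [wt]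

theorem wt_nonneg (s : ℕ) : 0 ≤ wt s := by unfold wt; positivity

theorem sum_inv_sq_le (s : ℕ) : ∑ i ∈ range (s + 1), 1 / (i : ℝ) ^ 2 ≤ 2 := by
  have h : ∀ s : ℕ, ∑ i ∈ range (s + 2), 1 / (i : ℝ) ^ 2 ≤ 2 - 1 / (s + 1 : ℝ) := by
    intro s
    induction s with
    | zero => norm_num [Finset.sum_range_succ]
    | succ s ih =>
      rw [Finset.sum_range_succ]
      refine (add_le_add_left ih _).trans ?_
      push_cast
      have h1 : (0 : ℝ) < s + 1 := by positivity
      have h2 : (0 : ℝ) < s + 2 := by positivity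
      have e : 1 / (s + 1 : ℝ) - 1 / (s + 1 + 1) = 1 / ((s + 1) * (s + 2)) := by
        field_simp; ring
      have : 1 / (s + 2 : ℝ) ^ 2 ≤ 1 / ((s + 1) * (s + 2)) := by
        apply one_div_le_one_div_of_le (by positivity)
        nlinarith
      linarith
  rcases s with _ | s
  · simp
  · refine (h s).trans ?_
    have : (0 : ℝ) ≤ 1 / (s + 1) := by positivity
    linarith

theorem sum_wt_mul_wt_le (s : ℕ) : ∑ p ∈ antidiagonal s, wt p.1 * wt p.2 ≤ 8 * wt s := by
  have h1 : ∀ p ∈ antidiagonal s, wt p.1 * wt p.2 ≤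
      (1 / 2) ^ s * (2 / (s : ℝ) ^ 2) * (1 / (p.1 : ℝ) ^ 2 + 1 / (p.2 : ℝ) ^ 2) := by
    rintro ⟨i, j⟩ hp
    rw [mem_antidiagonal] at hp
    simp only at hp ⊢
    subst hp
    rcases Nat.eq_zero_or_pos i with rfl | hi
    · rw [wt_zero, zero_mul]; positivity
    rcases Nat.eq_zero_or_pos j with rfl | hj
    · rw [wt_zero, mul_zero]; positivity
    have hi' : (0 : ℝ) < i := by exact_mod_cast hi
    have hj' : (0 : ℝ) < j := by exact_mod_cast hj
    have e : wt i * wt j = (1 / 2) ^ (i + j) * (1 / ((i : ℝ) ^ 2 * (j : ℝ) ^ 2)) := by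
      unfold wt; rw [pow_add]; field_simp
    rw [e, mul_assoc]
    refine mul_le_mul_of_nonneg_left ?_ (by positivity)
    push_cast
    have e2 : 2 / ((i : ℝ) + j) ^ 2 * (1 / (i : ℝ) ^ 2 + 1 / (j : ℝ) ^ 2) =
        (2 * ((i : ℝ) ^ 2 + (j : ℝ) ^ 2)) / ((i : ℝ) + j) ^ 2 * (1 / ((i : ℝ) ^ 2 * (j : ℝ) ^ 2)) := by
      field_simp; ring
    rw [e2]
    refine le_mul_of_one_le_left (by positivity) ?_
    rw [le_div_iff₀ (by positivity)]
    nlinarith [sq_nonneg ((i : ℝ) - j)]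
  have h2 : ∑ p ∈ antidiagonal s, 1 / (p.1 : ℝ) ^ 2 ≤ 2 := by
    rw [Nat.sum_antidiagonal_eq_sum_range_succ_mk]
    exact sum_inv_sq_le s
  have h3 : ∑ p ∈ antidiagonal s, 1 / (p.2 : ℝ) ^ 2 ≤ 2 := by
    rw [← Nat.sum_antidiagonal_swap]
    exact h2
  refine (sum_le_sum h1).trans ?_
  rw [← mul_sum, sum_add_distrib]
  have h4 : (0 : ℝ) ≤ (1 / 2) ^ s * (2 / (s : ℝ) ^ 2) := by positivity
  calc _ ≤ (1 / 2) ^ s * (2 / (s : ℝ) ^ 2) * (2 + 2) :=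
        mul_le_mul_of_nonneg_left (add_le_add h2 h3) h4
    _ = 8 * wt s := by unfold wt; ring

theorem cube_le_eight_pow (s : ℕ) : (s + 1) ^ 3 ≤ 8 ^ s := by
  induction s with
  | zero => simp
  | succ s ih =>
    calc (s + 1 + 1) ^ 3 ≤ 8 * (s + 1) ^ 3 := by
          nlinarith [Nat.zero_le (s ^ 3), Nat.zero_le (s ^ 2)]
      _ ≤ 8 * 8 ^ s := by omega
      _ = 8 ^ (s + 1) := by ring

theorem mul_pow_sixteen_le {s : ℕ} (hs : 1 ≤ s) : s * (1 / 16 : ℝ) ^ (s - 1) ≤ 2 * wt s := by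
  obtain ⟨t, rfl⟩ : ∃ t, s = t + 1 := ⟨s - 1, by omega⟩
  have h : ((t + 1 : ℕ) : ℝ) ^ 3 ≤ 8 ^ t := by exact_mod_cast cube_le_eight_pow t
  have hpos : (0 : ℝ) < ((t + 1 : ℕ) : ℝ) := by positivity
  simp only [Nat.add_sub_cancel]
  unfold wt
  rw [mul_div_assoc', le_div_iff₀ (by positivity)]
  calc _ = ((t + 1 : ℕ) : ℝ) ^ 3 * (1 / 16 : ℝ) ^ t := by ring
    _ ≤ 8 ^ t * (1 / 16 : ℝ) ^ t := by gcongr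
    _ = (1 / 2) ^ t := by rw [← mul_pow]; norm_num
    _ = _ := by rw [pow_succ]; ring

theorem pow_sixteen_le {s : ℕ} (hs : 1 ≤ s) : (1 / 16 : ℝ) ^ (s - 1) ≤ 2 * wt s := by
  refine le_trans (le_mul_of_one_le_left (by positivity) ?_) (mul_pow_sixteen_le hs)
  exact_mod_cast hs

theorem wt_pred_le {s : ℕ} (hs : 2 ≤ s) : wt (s - 1) ≤ 8 * wt s := by
  obtain ⟨t, rfl⟩ : ∃ t, s = t + 2 := ⟨s - 2, by omega⟩
  simp only [wt, show t + 2 - 1 = t + 1 by omega]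
  rw [mul_div_assoc', div_le_div_iff₀ (by positivity) (by positivity), pow_succ _ (t + 1)]
  have h : (0 : ℝ) ≤ (1 / 2) ^ (t + 1) := by positivity
  push_cast
  nlinarith [mul_nonneg h (Nat.cast_nonneg (α := ℝ) t), mul_nonneg h (sq_nonneg (t : ℝ))]

theorem sum_antidiagonal_shift (f g : ℕ → ℝ) {l s : ℕ} (h : l ≤ s) :
    ∑ p ∈ antidiagonal s, (if p.1 < l then 0 else f (p.1 - l)) * g p.2 =
      ∑ p ∈ antidiagonal (s - l), f p.1 * g p.2 := by
  symm
  refine sum_of_injOn (fun p => (p.1 + l, p.2)) ?_ ?_ ?_ ?_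
  · rintro ⟨a, b⟩ _ ⟨c, d⟩ _ h
    simpa using h
  · rintro ⟨a, b⟩ hab
    simp only [Finset.mem_coe, mem_antidiagonal] at hab ⊢
    omega
  · rintro ⟨a, b⟩ hab hne
    rw [mem_antidiagonal] at hab
    by_cases hal : a < l
    · simp [hal]
    · refine absurd ⟨(a - l, b), ?_, ?_⟩ hne
      · simp only [Finset.mem_coe, mem_antidiagonal] at hab ⊢
        omega
      · simp only [Prod.mk.injEq, and_true]
        omega
  · rintro ⟨a, b⟩ _
    simp

/-- Well-founded recursion over `ℕ`, for a step that only sees the earlier values. -/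
theorem exists_strongRec {α : Type*} [Zero α] (step : ℕ → (ℕ → α) → α) :
    ∃ V : ℕ → α, ∀ s, V s = step s fun j => if j < s then V j else 0 := by
  let F : ∀ s : ℕ, (∀ j, j < s → α) → α := fun s ih =>
    step s fun j => if h : j < s then ih j h else 0
  refine ⟨wellFounded_lt.fix F, fun s => ?_⟩
  rw [wellFounded_lt.fix_eq]
  simp [F]

end

end AperiodicNekhoroshev

namespace AperiodicNekhoroshev

noncomputable section

open Finset hiding mem_antidiagonal
open Finset.HasAntidiagonal (mem_antidiagonal)

variable {L : Type*} [LieRing L] [LieAlgebra ℂ L]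

/-- A scale of estimates on a Lie algebra: `Bd p C x` says that `x` is of order `p` and of size at
most `C`, and the bracket adds the orders and multiplies the sizes, up to the factor `Γ`. -/
structure IsLieScale (Bd : ℕ → ℝ → L → Prop) (Γ : ℝ) : Prop where
  zero : ∀ p, Bd p 0 0
  add : ∀ {p C C' x y}, Bd p C x → Bd p C' y → Bd p (C + C') (x + y)
  smul : ∀ {p C x} (z : ℂ), Bd p C x → Bd p (‖z‖ * C) (z • x)
  mono : ∀ {p C C' x}, Bd p C x → C ≤ C' → Bd p C' x
  lie : ∀ {p q C C' x y}, 0 < p → 0 < q → Bd p C x → Bd q C' y → Bd (p + q) (Γ * C * C') ⁅x, y⁆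

namespace IsLieScale

variable {Bd : ℕ → ℝ → L → Prop} {Γ : ℝ}

theorem neg (hB : IsLieScale Bd Γ) {p : ℕ} {C : ℝ} {x : L} (h : Bd p C x) : Bd p C (-x) := by
  simpa using hB.smul (-1) h

theorem sum (hB : IsLieScale Bd Γ) {ι : Type*} {p : ℕ} {s : Finset ι} {C : ι → ℝ} {x : ι → L}
    (h : ∀ i ∈ s, Bd p (C i) (x i)) : Bd p (∑ i ∈ s, C i) (∑ i ∈ s, x i) := by
  classical
  induction s using Finset.induction_on with
  | empty => simpa using hB.zero p
  | insert a s ha ih =>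
    rw [Finset.sum_insert ha, Finset.sum_insert ha]
    exact hB.add (h a (Finset.mem_insert_self a s))
      (ih fun i hi => h i (Finset.mem_insert_of_mem hi))

/-- The estimate of a convolution bracket, for series without constant terms. -/
theorem convLie (hB : IsLieScale Bd Γ) {F G : ℕ → L} {f g : ℕ → ℝ} {s : ℕ}
    (h : ∀ p ∈ antidiagonal s, ⁅F p.1, G p.2⁆ = 0 ∧ 0 ≤ Γ * f p.1 * g p.2 ∨
      0 < p.1 ∧ 0 < p.2 ∧ Bd p.1 (f p.1) (F p.1) ∧ Bd p.2 (g p.2) (G p.2)) :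
    Bd s (∑ p ∈ antidiagonal s, Γ * f p.1 * g p.2) (convLie F G s) := by
  refine hB.sum fun p hp => ?_
  rcases h p hp with ⟨h1, h2⟩ | ⟨h1, h2, h3, h4⟩
  · rw [h1]
    exact hB.mono (hB.zero s) h2
  · have := hB.lie h1 h2 h3 h4
    rwa [mem_antidiagonal.1 hp] at this

end IsLieScale

omit [LieAlgebra ℂ L] in
/-- The last coefficient of `G` only enters a convolution bracket through the first one of `H`. -/
theorem convLie_eq_add (X H : ℕ → L) (s : ℕ) :
    convLie X H s = convLie (fun j => if j < s then X j else 0) H s + ⁅X s, H 0⁆ := by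
  have h : ∀ p ∈ antidiagonal s, ⁅X p.1, H p.2⁆ =
      ⁅(if p.1 < s then X p.1 else 0 : L), H p.2⁆ + if p = (s, 0) then ⁅X s, H 0⁆ else 0 := by
    rintro ⟨i, j⟩ hp
    rw [mem_antidiagonal] at hp
    simp only at hp
    by_cases hi : i < s
    · have : (i, j) ≠ (s, 0) := by
        intro h; simp only [Prod.mk.injEq] at h; omega
      simp [hi, this]
    · obtain rfl : i = s := by omega
      obtain rfl : j = 0 := by omega
      simp
  rw [convLie, sum_congr rfl h, sum_add_distrib, sum_ite_eq' _ _ (fun _ => ⁅X s, H 0⁆), if_pos]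
  · rfl
  · rw [mem_antidiagonal]; simp

/-- **Existence of formal integrals with good estimates.** `H 0` is the integrable part, and `H s`
for `s ≥ 1` are the perturbations; it is assumed that the homological equation `[X, H 0] = z + R`
can be solved with `z` commuting with `v`, at the price of a factor `1 / α`. The assumption for
`s = 1` takes into account that one part of `H 1` is already in normal form. If `Γ E / α` is small,
then there is a formal integral `Φ` of `H` that starts with `v` and decays geometrically; its
further terms are sums of brackets. -/
theorem exists_formal_integral {Bd : ℕ → ℝ → L → Prop} {Γ : ℝ} (hB : IsLieScale Bd Γ) (hΓ : 0 < Γ)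
    {N K : ℕ} {α e E : ℝ} (hα : 0 < α) (he : 0 ≤ e) (heE : e ≤ E) (hκ : Γ * E / α ≤ 1 / 256)
    {H : ℕ → L} {v : L} (hv : ⁅v, H 0⁆ = 0) (hH1 : Bd 1 E (H 1))
    (hH : ∀ s, 2 ≤ s → s ≤ N → Bd s (e * (1 / 16) ^ (s - 1)) (H s))
    (sol1 : ∃ X z, ⁅X, H 0⁆ = z + -H 1 ∧ Bd 1 (e / α) X ∧ Bd 1 E z ∧ ⁅v, z⁆ = 0 ∧
      Bd 1 (K * (e / α)) ⁅v, X⁆)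
    (sol : ∀ s C R, 2 ≤ s → s ≤ N → Bd s C R → ∃ X z, ⁅X, H 0⁆ = z + R ∧ Bd s (C / α) X ∧
      Bd s C z ∧ ⁅v, z⁆ = 0 ∧ Bd s (s * K * (C / α)) ⁅v, X⁆) :
    ∃ Φ : ℕ → L, Φ 0 = v ∧
      (∀ s, 1 ≤ s → Φ s ∈ Submodule.span ℂ (Set.range fun p : L × L => ⁅p.1, p.2⁆)) ∧
      (∀ s, 1 ≤ s → s ≤ N → Bd s (2 * K * (8 * e / α) * wt s) (Φ s)) ∧
      ∀ s ≤ N, convLie Φ H s = 0 := by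
  classical
  set a : ℝ := 8 * e / α with ha
  set κ : ℝ := Γ * a with hκ1
  have ha0 : 0 ≤ a := by positivity
  have hκ0 : 0 ≤ κ := by positivity
  have hE : 0 ≤ E := he.trans heE
  have hκE : E * κ = Γ * E / α * (8 * e) := by rw [hκ1, ha]; field_simp
  have hκE' : E * κ ≤ e / 32 := by
    rw [hκE]
    calc _ ≤ 1 / 256 * (8 * e) := mul_le_mul_of_nonneg_right hκ (by positivity)
      _ = e / 32 := by ring
  have hκs : κ ≤ 1 / 32 := by
    have : κ = Γ * e / α * 8 := by rw [hκ1, ha]; field_simp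
    have h2 : Γ * e / α ≤ Γ * E / α := by gcongr
    linarith
  let Zb : ℕ → ℝ := fun s => if s = 1 then E else 8 * e * wt s
  have hZb0 : ∀ s, 0 ≤ Zb s := fun s => by
    have := wt_nonneg s
    simp only [Zb]; split_ifs <;> positivity
  -- the solution operator of the homological equation
  let Good : ℕ → L → L × L → Prop := fun s R p => ⁅p.1, H 0⁆ = p.2 + R ∧ Bd s (a * wt s) p.1 ∧
    Bd s (Zb s) p.2 ∧ ⁅v, p.2⁆ = 0 ∧ Bd s (s * K * (a * wt s)) ⁅v, p.1⁆
  have hsol : ∀ s R, 1 ≤ s → s ≤ N → (s = 1 → R = -H 1) → (2 ≤ s → Bd s (8 * e * wt s) R) →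
      ∃ p, Good s R p := by
    intro s R hs1 hsN h1 h2
    rcases Nat.eq_or_lt_of_le hs1 with rfl | hs2
    · obtain ⟨X, z, e1, e2, e3, e4, e5⟩ := sol1
      have hle : e / α ≤ a * wt 1 := by
        rw [wt_one, ha, div_mul_eq_mul_div]
        exact div_le_div_of_nonneg_right (by linarith) hα.le
      refine ⟨(X, z), by rw [h1 rfl]; exact e1, hB.mono e2 hle, by simpa [Zb] using e3, e4,
        hB.mono e5 ?_⟩
      rw [Nat.cast_one, one_mul]
      exact mul_le_mul_of_nonneg_left hle (Nat.cast_nonneg K)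
    · obtain ⟨X, z, e1, e2, e3, e4, e5⟩ := sol s _ R hs2 hsN (h2 hs2)
      have hle : 8 * e * wt s / α = a * wt s := by rw [ha]; ring
      rw [hle] at e2 e5
      exact ⟨(X, z), e1, e2, by simpa [Zb, show s ≠ 1 by omega] using e3, e4, e5⟩
  let S : ℕ → L → L × L := fun s R => if h : ∃ p, Good s R p then h.choose else 0
  have hS : ∀ s R, (∃ p, Good s R p) → Good s R (S s R) := fun s R h => by
    simp only [S, dif_pos h]; exact h.choose_spec
  -- the recursion for the generator and the transforms of the normal form
  let low : ℕ → (ℕ → L × (ℕ → L)) → ℕ → L := fun s V l => if 1 ≤ l ∧ l < s then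
    ((s : ℂ) - l)⁻¹ • convLie (fun i => (V i).2 l) (fun i => (V i).1) s else 0
  let rhs : ℕ → (ℕ → L × (ℕ → L)) → L := fun s V =>
    ∑ l ∈ range s, low s V l - (s : ℂ) • H s - convLie (fun i => (V i).1) H s
  obtain ⟨V, hV⟩ := exists_strongRec (α := L × (ℕ → L)) fun s V =>
    if s = 0 then 0 else
      ((S s (rhs s V)).1, fun l => if l = s then (S s (rhs s V)).2 else low s V l)
  let X : ℕ → L := fun s => (V s).1
  let w : ℕ → ℕ → L := fun l s => (V s).2 l
  have hV0 : V 0 = 0 := by rw [hV]; simp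
  have hX0 : X 0 = 0 := by simp [X, hV0]
  have hwl0 : ∀ l, w l 0 = 0 := fun l => by simp [w, hV0]
  have hw : ∀ l s, s < l → w l s = 0 := by
    intro l s hsl
    simp only [w]
    rw [hV]
    split_ifs with h
    · rfl
    · simp only [if_neg hsl.ne', low]
      rw [if_neg (by omega)]
  have hw0 : ∀ s, w 0 s = 0 := by
    intro s
    rcases Nat.eq_zero_or_pos s with rfl | hs
    · exact hwl0 0
    simp only [w]
    rw [hV, if_neg hs.ne']
    simp only [if_neg hs.ne, low]
    rw [if_neg (by omega)]
  have htrunc : ∀ l s, 1 ≤ l → convLie (fun i => ((if i < s then V i else 0 : L × (ℕ → L))).2 l)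
      (fun i => ((if i < s then V i else 0 : L × (ℕ → L))).1) s = convLie (w l) X s := by
    intro l s hl
    refine sum_congr rfl fun p hp => ?_
    beta_reduce
    rw [mem_antidiagonal] at hp
    rcases Nat.eq_zero_or_pos p.1 with h1 | h1
    · have : w l p.1 = 0 := hw l _ (by omega)
      rw [this, zero_lie]
      simp only [w] at this
      split_ifs <;> simp [this]
    rcases Nat.eq_zero_or_pos p.2 with h2 | h2
    · have : X p.2 = 0 := by rw [h2, hX0]
      rw [this, lie_zero]
      simp only [X] at this
      split_ifs <;> simp [this]
    rw [if_pos (by omega), if_pos (by omega)]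
  have hlow : ∀ l s, l < s → low s (fun j => if j < s then V j else 0) l = w l s := by
    intro l s hls
    simp only [w]
    rw [hV s, if_neg (by omega)]
    simp only [if_neg hls.ne]
  have hwX' : ∀ l s, 1 ≤ l → l < s → w l s = ((s : ℂ) - l)⁻¹ • convLie (w l) X s := by
    intro l s hl hls
    rw [← hlow l s hls]
    simp only [low]
    rw [if_pos ⟨hl, hls⟩, htrunc l s hl]
  let R : ℕ → L := fun s => ∑ l ∈ range s, w l s - (s : ℂ) • H s -
    convLie (fun j => if j < s then X j else 0) H s
  have hrhs : ∀ s, rhs s (fun j => if j < s then V j else 0) = R s := by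
    intro s
    simp only [rhs, R]
    rw [sum_congr rfl fun l hl => hlow l s (mem_range.1 hl)]
    congr 2
    funext j
    split_ifs <;> rfl
  have hXS : ∀ s, 1 ≤ s → (X s, w s s) = S s (R s) := by
    intro s hs
    rw [← hrhs s]
    simp only [X, w]
    rw [hV s, if_neg (by omega)]
    simp
  -- the estimates
  have key : ∀ s, 1 ≤ s → s ≤ N → Good s (R s) (X s, w s s) ∧
      ∀ l, 1 ≤ l → l < s → Bd s (Zb l * (2 * κ * wt (s - l))) (w l s) := by
    intro s
    induction s using Nat.strong_induction_on with
    | _ s ih =>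
    intro hs1 hsN
    have hwb : ∀ l, 1 ≤ l → l < s → Bd s (Zb l * (2 * κ * wt (s - l))) (w l s) := by
      intro l hl hls
      rw [hwX' l s hl hls]
      have h1 := hB.convLie (F := w l) (G := X) (s := s)
        (f := fun i => if i < l then 0 else
          Zb l * ((if i - l = 0 then 1 else 0) + 2 * κ * wt (i - l)))
        (g := fun j => a * wt j) (by
          rintro ⟨i, j⟩ hp
          rw [mem_antidiagonal] at hp
          simp only at hp ⊢
          have hn : 0 ≤ (if i < l then 0 else
              Zb l * ((if i - l = 0 then 1 else 0) + 2 * κ * wt (i - l))) := by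
            have := hZb0 l; have := wt_nonneg (i - l)
            split_ifs <;> positivity
          have hwj := wt_nonneg j
          rcases Nat.eq_zero_or_pos j with rfl | hj
          · left
            exact ⟨by rw [hX0, lie_zero], by positivity⟩
          rcases lt_trichotomy i l with hil | rfl | hil
          · left
            exact ⟨by rw [hw l i hil, zero_lie], by positivity⟩
          · right
            refine ⟨by omega, hj, ?_, (ih j (by omega) hj (by omega)).1.2.1⟩
            simpa [wt_zero] using (ih i (by omega) (by omega) (by omega)).1.2.2.1
          · right
            refine ⟨by omega, hj, ?_, (ih j (by omega) hj (by omega)).1.2.1⟩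
            simpa [show ¬ i < l by omega, show i - l ≠ 0 by omega] using
              (ih i (by omega) (by omega) (by omega)).2 l hl hil)
      refine hB.mono (hB.smul _ h1) ?_
      have h2 : ∑ p ∈ antidiagonal s, Γ * (if p.1 < l then 0 else
            Zb l * ((if p.1 - l = 0 then 1 else 0) + 2 * κ * wt (p.1 - l))) * (a * wt p.2) ≤
          Zb l * (2 * κ * wt (s - l)) := by
        have e1 : ∀ p ∈ antidiagonal s, Γ * (if p.1 < l then 0 else
            Zb l * ((if p.1 - l = 0 then 1 else 0) + 2 * κ * wt (p.1 - l))) * (a * wt p.2) =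
            Zb l * κ * ((if p.1 < l then 0 else
              (if p.1 - l = 0 then 1 else 0) + 2 * κ * wt (p.1 - l)) * wt p.2) := by
          intro p _
          rw [hκ1]
          split_ifs <;> ring
        rw [sum_congr rfl e1, ← mul_sum,
          sum_antidiagonal_shift (fun i => (if i = 0 then 1 else 0) + 2 * κ * wt i) wt hls.le]
        simp only [add_mul, sum_add_distrib]
        have e2 : ∑ p ∈ antidiagonal (s - l), (if p.1 = 0 then (1 : ℝ) else 0) * wt p.2 =
            wt (s - l) := by
          rw [sum_eq_single (0, s - l)]
          · simp
          · rintro ⟨i, j⟩ hp hne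
            rw [mem_antidiagonal] at hp
            simp only at hp
            have : i ≠ 0 := by
              rintro rfl
              exact hne (by simp only [Prod.mk.injEq, true_and]; omega)
            simp [this]
          · simp
        rw [e2]
        simp only [mul_assoc (2 * κ), ← mul_sum]
        have e3 := sum_wt_mul_wt_le (s - l)
        have hw2 := wt_nonneg (s - l)
        calc _ ≤ Zb l * κ * (wt (s - l) + 2 * κ * (8 * wt (s - l))) := by
              have := hZb0 l
              gcongr
          _ = Zb l * κ * wt (s - l) * (1 + 16 * κ) := by ring
          _ ≤ Zb l * κ * wt (s - l) * 2 := by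
              have := hZb0 l
              gcongr
              linarith
          _ = _ := by ring
      refine le_trans ?_ h2
      refine mul_le_of_le_one_left (sum_nonneg fun p _ => ?_) ?_
      · have := hZb0 l; have := wt_nonneg (p.1 - l); have := wt_nonneg p.2
        split_ifs <;> positivity
      · rw [norm_inv]
        refine inv_le_one_of_one_le₀ ?_
        rw [← Nat.cast_sub hls.le, Complex.norm_natCast]
        exact_mod_cast (by omega : 1 ≤ s - l)
    refine ⟨?_, hwb⟩
    rw [hXS s hs1]
    refine hS s _ (hsol s _ hs1 hsN ?_ ?_)
    · rintro rfl
      have e1 : convLie (fun j => if j < 1 then X j else 0) H 1 = 0 := by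
        refine sum_eq_zero fun p _ => ?_
        beta_reduce
        split_ifs with h
        · rw [show p.1 = 0 by omega, hX0, zero_lie]
        · rw [zero_lie]
      simp only [R]
      rw [e1]
      simp [hw0]
    · intro hs2
      have hws := wt_nonneg s
      have b1 : Bd s (8 * e * wt s * (9 / 16)) (∑ l ∈ range s, w l s) := by
        refine hB.mono (hB.sum (C := fun l => 16 * e * κ * (wt l * wt (s - l)) +
          if l = 1 then 2 * (E * κ) * wt (s - 1) else 0) fun l hl => ?_) ?_
        · rw [mem_range] at hl
          have hwl := wt_nonneg l; have hwl2 := wt_nonneg (s - l); have hwl3 := wt_nonneg (s - 1)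
          rcases Nat.eq_zero_or_pos l with rfl | hl0
          · rw [hw0]
            exact hB.mono (hB.zero s) (by simp only [wt_zero]; simp)
          · refine hB.mono (hwb l hl0 hl) ?_
            simp only [Zb]
            split_ifs with h
            · subst h
              have : 0 ≤ 16 * e * κ * (wt 1 * wt (s - 1)) := by positivity
              nlinarith
            · nlinarith
        · rw [sum_add_distrib, ← mul_sum, sum_ite_eq', if_pos (mem_range.2 (by omega))]
          have e1 : ∑ l ∈ range s, wt l * wt (s - l) ≤ 8 * wt s := by
            refine le_trans ?_ (sum_wt_mul_wt_le s)
            rw [Nat.sum_antidiagonal_eq_sum_range_succ_mk]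
            exact sum_le_sum_of_subset_of_nonneg (range_subset_range.2 (Nat.le_succ s))
              fun i _ _ => mul_nonneg (wt_nonneg _) (wt_nonneg _)
          have e2 := wt_pred_le hs2
          have e3 := wt_nonneg (s - 1)
          calc _ ≤ 16 * e * κ * (8 * wt s) + 2 * (e / 32) * (8 * wt s) := by
                gcongr
            _ ≤ 16 * e * (1 / 32) * (8 * wt s) + 2 * (e / 32) * (8 * wt s) := by gcongr
            _ = _ := by ring
      have b2 : Bd s (8 * e * wt s * (1 / 4)) ((s : ℂ) • H s) := by
        refine hB.mono (hB.smul _ (hH s hs2 hsN)) ?_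
        rw [Complex.norm_natCast]
        have := mul_pow_sixteen_le hs1
        nlinarith
      have b3 : Bd s (8 * e * wt s * (1 / 16)) (convLie (fun j => if j < s then X j else 0) H s) := by
        refine hB.mono (hB.convLie (f := fun j => a * wt j) (g := fun i => 2 * E * wt i) ?_) ?_
        · rintro ⟨j, i⟩ hp
          rw [mem_antidiagonal] at hp
          simp only at hp ⊢
          have hwi := wt_nonneg i; have hwj := wt_nonneg j
          by_cases hj : 1 ≤ j ∧ j < s
          · right
            rw [if_pos hj.2]
            refine ⟨by omega, by omega, (ih j hj.2 hj.1 (by omega)).1.2.1, ?_⟩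
            rcases Nat.eq_or_lt_of_le (show 1 ≤ i by omega) with rfl | hi
            · exact hB.mono hH1 (by rw [wt_one]; linarith)
            · refine hB.mono (hH i hi (by omega)) ?_
              have := pow_sixteen_le (show 1 ≤ i by omega)
              calc _ ≤ E * (2 * wt i) := mul_le_mul heE this (by positivity) hE
                _ = _ := by ring
          · left
            refine ⟨?_, by positivity⟩
            split_ifs with h
            · rw [show j = 0 by omega, hX0, zero_lie]
            · rw [zero_lie]
        · have e1 := sum_wt_mul_wt_le s
          have e0 : 0 ≤ ∑ p ∈ antidiagonal s, wt p.1 * wt p.2 :=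
            sum_nonneg fun p _ => mul_nonneg (wt_nonneg _) (wt_nonneg _)
          calc _ = Γ * a * (2 * E) * ∑ p ∈ antidiagonal s, wt p.1 * wt p.2 := by
                rw [mul_sum]; exact sum_congr rfl fun p _ => by ring
            _ ≤ Γ * a * (2 * E) * (8 * wt s) := by gcongr
            _ = 16 * wt s * (E * κ) := by rw [hκ1]; ring
            _ ≤ 16 * wt s * (e / 32) := by gcongr
            _ = _ := by ring
      have b4 := hB.add (hB.add b1 (hB.neg b2)) (hB.neg b3)
      simp only [R]
      rw [sub_eq_add_neg, sub_eq_add_neg]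
      refine hB.mono b4 ?_
      have : 0 ≤ e * wt s := by positivity
      nlinarith
  -- the integral
  obtain ⟨Φ, hΦ⟩ := exists_strongRec (α := L) fun s Φ =>
    if s = 0 then v else (s : ℂ)⁻¹ • convLie Φ X s
  have hΦ0 : Φ 0 = v := by rw [hΦ]; simp
  have hΦs : ∀ s, 1 ≤ s → Φ s = (s : ℂ)⁻¹ • convLie Φ X s := by
    intro s hs
    rw [hΦ s, if_neg (by omega)]
    congr 1
    rw [convLie_eq_add Φ X s, hX0, lie_zero, add_zero]
  refine ⟨Φ, hΦ0, ?_, ?_, ?_⟩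
  · intro s hs
    rw [hΦs s hs]
    exact Submodule.smul_mem _ _ (Submodule.sum_mem _ fun p _ =>
      Submodule.subset_span ⟨(Φ p.1, X p.2), rfl⟩)
  · intro s
    induction s using Nat.strong_induction_on with
    | _ s ih =>
    intro hs1 hsN
    have hws := wt_nonneg s
    rw [hΦs s hs1]
    have e0 : convLie Φ X s = ⁅v, X s⁆ + convLie (fun i => if 0 < i then Φ i else 0) X s := by
      have h : ∀ p ∈ antidiagonal s, ⁅Φ p.1, X p.2⁆ = (if p = (0, s) then ⁅v, X s⁆ else 0) +
          ⁅(if 0 < p.1 then Φ p.1 else 0 : L), X p.2⁆ := by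
        rintro ⟨i, j⟩ hp
        rw [mem_antidiagonal] at hp
        simp only at hp
        rcases Nat.eq_zero_or_pos i with rfl | hi
        · obtain rfl : j = s := by omega
          simp [hΦ0]
        · simp [hi, hi.ne']
      rw [convLie, sum_congr rfl h, sum_add_distrib, sum_ite_eq' _ _ (fun _ => ⁅v, X s⁆), if_pos]
      · rfl
      · rw [mem_antidiagonal]; simp
    have b1 := (key s hs1 hsN).1.2.2.2.2
    have b2 := hB.convLie (F := fun i => if 0 < i then Φ i else 0) (G := X) (s := s)
      (f := fun i => 2 * K * a * wt i) (g := fun j => a * wt j) (by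
        rintro ⟨i, j⟩ hp
        rw [mem_antidiagonal] at hp
        simp only at hp ⊢
        have hwi := wt_nonneg i; have hwj := wt_nonneg j
        by_cases h : 0 < i ∧ 0 < j
        · right
          rw [if_pos h.1]
          exact ⟨h.1, h.2, ih i (by omega) h.1 (by omega),
            (key j (by omega) (by omega)).1.2.1⟩
        · left
          refine ⟨?_, by positivity⟩
          split_ifs with h1
          · rw [show j = 0 by omega, hX0, lie_zero]
          · rw [zero_lie])
    rw [e0]
    refine hB.mono (hB.smul _ (hB.add b1 b2)) ?_
    have hs0 : (0 : ℝ) < s := by exact_mod_cast hs1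
    rw [norm_inv, Complex.norm_natCast, inv_mul_le_iff₀ hs0]
    have e1 := sum_wt_mul_wt_le s
    have e0 : 0 ≤ ∑ p ∈ antidiagonal s, wt p.1 * wt p.2 :=
      sum_nonneg fun p _ => mul_nonneg (wt_nonneg _) (wt_nonneg _)
    have e2 : ∑ p ∈ antidiagonal s, Γ * (2 * K * a * wt p.1) * (a * wt p.2) ≤ K * (a * wt s) := by
      calc _ = κ * (2 * K * a) * ∑ p ∈ antidiagonal s, wt p.1 * wt p.2 := by
            rw [mul_sum, hκ1]; exact sum_congr rfl fun p _ => by ring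
        _ ≤ 1 / 32 * (2 * K * a) * (8 * wt s) := by gcongr
        _ ≤ _ := by
            have : 0 ≤ (K : ℝ) * a * wt s := by positivity
            nlinarith
    have e3 : K * (a * wt s) ≤ s * (K * (a * wt s)) :=
      le_mul_of_one_le_left (by positivity) (by exact_mod_cast hs1)
    simp only at b1 ⊢
    calc _ ≤ s * K * (a * wt s) + s * (K * (a * wt s)) := add_le_add le_rfl (e2.trans e3)
      _ = _ := by ring
  · refine convLie_eq_zero_of_generator (X := X) (w := w) hX0 hw ?_ ?_ ?_ (by rwa [hΦ0]) ?_
    · intro s hsN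
      rcases Nat.eq_zero_or_pos s with rfl | hs
      · rw [sum_eq_zero fun l _ => hwl0 l]
        simp [convLie, hX0]
      have e1 : ∑ l ∈ range (N + 1), w l s = ∑ l ∈ range s, w l s + w s s := by
        rw [← sum_range_succ]
        symm
        refine sum_subset (range_subset_range.2 (by omega)) fun l _ hl => hw l s ?_
        rw [mem_range] at hl
        omega
      rw [e1, convLie_eq_add, (key s hs hsN).1.1]
      simp only [R]
      abel
    · intro l s hsN
      rcases Nat.eq_zero_or_pos l with rfl | hl
      · rw [hw0, smul_zero, convLie]
        exact (sum_eq_zero fun p _ => by rw [hw0, zero_lie]).symm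
      rcases lt_trichotomy s l with hsl | rfl | hsl
      · rw [hw l s hsl, smul_zero, convLie]
        refine (sum_eq_zero fun p hp => ?_).symm
        rw [mem_antidiagonal] at hp
        rw [hw l p.1 (by omega), zero_lie]
      · rw [sub_self, zero_smul, convLie]
        refine (sum_eq_zero fun p hp => ?_).symm
        rw [mem_antidiagonal] at hp
        rcases Nat.eq_zero_or_pos p.2 with h | h
        · rw [h, hX0, lie_zero]
        · rw [hw s p.1 (by omega), zero_lie]
      · rw [hwX' l s hl hsl, smul_smul, mul_inv_cancel₀, one_smul]
        rw [sub_ne_zero]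
        exact_mod_cast hsl.ne'
    · intro s hsN
      rcases Nat.eq_zero_or_pos s with rfl | hs
      · simp [convLie, hX0]
      · rw [hΦs s hs, smul_smul, mul_inv_cancel₀, one_smul]
        exact_mod_cast hs.ne'
    · intro l hl
      rw [hΦ0]
      rcases Nat.eq_zero_or_pos l with rfl | h
      · rw [hwl0, lie_zero]
      · exact (key l h hl).1.2.2.2.1

end

end AperiodicNekhoroshev

namespace AperiodicNekhoroshev

noncomputable section

open Metric Set Filter Topology
open Finset.HasAntidiagonal (mem_antidiagonal)

/-! ### The analytic normal form -/

variable {n : ℕ}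

namespace Frame

variable (A : Frame n)

/-- The weight of the variable conjugate to the slow time in the size of an observable. -/
def c₀ : ℝ := 4 * A.N / (A.s * A.Γ)

theorem c₀_pos : 0 < A.c₀ := by
  have := A.hN'; have := A.hs; have := A.Γ_pos
  unfold c₀; positivity

theorem c₀_eq : A.c₀ = A.r / (2 * A.K * A.s) := by
  have := A.hN'; have := A.hs; have := A.hK'; have := A.hr
  unfold c₀ Γ
  field_simp
  ring

/-- The scale of estimates for observables `F + b η`, where `η` is conjugate to the slow time: the
size is the one of `F` plus a multiple of `|b|`. -/
def Bd (p : ℕ) (C : ℝ) (x : Obs A.dom) : Prop := A.IsTrig p (C - A.c₀ * ‖Obs.snd x‖) (Obs.fst x)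

theorem isLieScale_bd : IsLieScale A.Bd A.Γ where
  zero p := by simpa [Bd] using isTrig_zero
  add {p C C' x y} hx hy := by
    refine (hx.add hy).mono le_rfl ?_
    have : A.c₀ * ‖Obs.snd (x + y)‖ ≤ A.c₀ * (‖Obs.snd x‖ + ‖Obs.snd y‖) := by
      rw [map_add]
      exact mul_le_mul_of_nonneg_left (norm_add_le _ _) A.c₀_pos.le
    linarith
  smul {p C x} z hx := by
    refine (hx.smul z).mono le_rfl (le_of_eq ?_)
    rw [map_smul, norm_smul]
    ring
  mono {p C C' x} hx h := IsTrig.mono hx le_rfl (by linarith)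
  lie {p q C C' x y} hp hq hx hy := by
    have hN := A.hN'
    have hs := A.hs
    have hΓ := A.Γ_pos
    have hc := A.c₀_pos
    have hcΓ : 4 * A.N / A.s = A.Γ * A.c₀ := by unfold c₀; field_simp
    unfold Bd at *
    rw [Obs.fst_lie, Obs.snd_lie, norm_zero, mul_zero, sub_zero]
    have h1 := IsTrig.pb hp hq hx hy
    have h2 := (hx.dTime.mono (Nat.add_le_add_left hq p) le_rfl).smul (Obs.snd y)
    have h3 := (hy.dTime.mono (show q + 1 ≤ p + q by omega) le_rfl).smul (-Obs.snd x)
    have h4 := (h1.add h2).add h3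
    rw [neg_smul, ← sub_eq_add_neg] at h4
    refine h4.mono le_rfl ?_
    rw [norm_neg, hcΓ]
    have : 0 ≤ A.Γ * (A.c₀ * ‖Obs.snd x‖) * (A.c₀ * ‖Obs.snd y‖) := by positivity
    nlinarith

variable {A}

theorem differentiableOn_comp_fst {g : CVec n → ℂ} (hg : DifferentiableOn ℂ g (ball A.c A.r)) :
    DifferentiableOn ℂ (fun y : CVec n × ℂ => g y.1) (A.U 0) :=
  hg.comp differentiableOn_fst fun y hy => by simpa using hy.1

theorem atom_congr {g g' : CVec n × ℂ → ℂ} {k k' : Fin n → ℤ} {hg : DifferentiableOn ℂ g (A.U 0)}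
    {hg' : DifferentiableOn ℂ g' (A.U 0)} (h : ∀ x ∈ A.U 0, g x = g' x) (hk : k = k') :
    atom g k hg = atom g' k' hg' := by
  subst hk
  refine Hol.ext_fn fun x hx => ?_
  rw [fn_atom hx, fn_atom hx, h _ (A.mem_U_zero hx)]

theorem dirDeriv_zero (g : CVec n × ℂ → ℂ) (x : CVec n × ℂ) : dirDeriv g 0 x = 0 := by
  have : (intVec (0 : Fin n → ℤ)) = 0 := by ext; simp [intVec]
  rw [dirDeriv, this, Prod.mk_zero_zero, map_zero]

theorem dirDeriv_comp_fst {g : CVec n → ℂ} {x : CVec n × ℂ} (hg : DifferentiableAt ℂ g x.1)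
    (k : Fin n → ℤ) : dirDeriv (fun y => g y.1) k x = fderiv ℂ g x.1 (intVec k) := by
  have : HasFDerivAt (fun y : CVec n × ℂ => g y.1)
      ((fderiv ℂ g x.1).comp (ContinuousLinearMap.fst ℂ _ _)) x :=
    HasFDerivAt.comp x hg.hasFDerivAt hasFDerivAt_fst
  rw [dirDeriv, this.fderiv]
  rfl

/-- The linear form `∑ⱼ vⱼ Iⱼ`. -/
def linForm (v : Fin n → ℂ) : CVec n →L[ℂ] ℂ := ∑ j, v j • (EuclideanSpace.proj j : CVec n →L[ℂ] ℂ)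

theorem linForm_apply (v : Fin n → ℂ) (x : CVec n) : linForm v x = ∑ j, v j * x j := by
  simp [linForm]

theorem linForm_single (v : Fin n → ℂ) (j : Fin n) :
    linForm v (EuclideanSpace.single j 1) = v j := by
  rw [linForm_apply, Finset.sum_eq_single j]
  · simp
  · intro i _ hij; simp [hij]
  · simp

theorem norm_linForm_intVec_le {v : Fin n → ℂ} (hv : ∀ j, ‖v j‖ ≤ 1) (k : Fin n → ℤ) :
    ‖linForm v (intVec k)‖ ≤ l1 k := by
  rw [linForm_apply, l1_cast]
  refine (norm_sum_le _ _).trans (Finset.sum_le_sum fun j _ => ?_)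
  rw [norm_mul, intVec]
  simp only [Complex.norm_intCast]
  exact mul_le_of_le_one_left (abs_nonneg _) (hv j)

variable (A) in
/-- A function of the actions alone, as a function on the domain of all variables. -/
def actFun (g : CVec n → ℂ) (hg : DifferentiableOn ℂ g (ball A.c A.r)) : Hol A.dom :=
  atom (fun y => g y.1) 0 (differentiableOn_comp_fst hg)

section

variable {h : CVec n → ℂ} (hh : DifferentiableOn ℂ h (ball A.c A.r)) {p : ℕ} {C : ℝ}

theorem fn_actFun {x : Phase n} (hx : x ∈ A.dom) : (A.actFun h hh).fn x = h x.1 := by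
  rw [actFun, fn_atom hx]
  simp [pairing_apply]

theorem fderiv_actFun {x : Phase n} (hx : x ∈ A.dom) (a b : CVec n) (t : ℂ) :
    fderiv ℂ (A.actFun h hh).fn x (a, b, t) = fderiv ℂ h x.1 a := by
  have hd : DifferentiableAt ℂ h x.1 :=
    hh.differentiableAt (isOpen_ball.mem_nhds (A.mem_dom.1 hx).1)
  have : HasFDerivAt (fun y : CVec n × ℂ => h y.1)
      ((fderiv ℂ h x.1).comp (ContinuousLinearMap.fst ℂ _ _)) (x.1, x.2.2) :=
    HasFDerivAt.comp (x.1, x.2.2) hd.hasFDerivAt hasFDerivAt_fst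
  rw [actFun, fderiv_atom hx, this.fderiv]
  simp [pairing_apply]

theorem dTime_actFun : dTime (A.actFun h hh) = 0 := by
  refine Hol.ext_fn fun x hx => ?_
  rw [dTime, Hol.D_apply _ _ hx, fderiv_actFun hh hx, map_zero, Hol.fn_zero, Pi.zero_apply]

theorem pb_atom_actFun {g : CVec n × ℂ → ℂ} (hg : DifferentiableOn ℂ g (A.U 0)) (k : Fin n → ℤ) :
    ∃ hg', pb (atom g k hg) (A.actFun h hh) =
      atom (fun x => Complex.I * fderiv ℂ h x.1 (intVec k) * g x) k hg' := by
  have hg' : DifferentiableOn ℂ (fun x => Complex.I * fderiv ℂ h x.1 (intVec k) * g x) (A.U 0) :=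
    ((differentiableOn_comp_fst (differentiableOn_fderiv_apply isOpen_ball hh _)).const_mul _).mul hg
  refine ⟨hg', ?_⟩
  rw [actFun, pb_atom]
  refine atom_congr (fun x hx => ?_) (add_zero k)
  have hx1 : x.1 ∈ ball A.c A.r := by simpa using hx.1
  rw [bracketCoeff, dirDeriv_zero,
    dirDeriv_comp_fst (hh.differentiableAt (isOpen_ball.mem_nhds hx1))]
  ring

/-- The homological equation is solved harmonic by harmonic. Resonant harmonics, on which `v`
vanishes, go to the normal form. -/
theorem exists_homological {v : Fin n → ℂ} (hv : ∀ j, ‖v j‖ ≤ 1) {α : ℝ} (hα : 0 < α)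
    (hres : ∀ k : Fin n → ℤ, l1 k ≤ A.N * A.K → linForm v (intVec k) = 0 ∨
      ∀ I ∈ ball A.c A.r, α ≤ ‖fderiv ℂ h I (intVec k)‖)
    (hp : p ≤ A.N) {R : Hol A.dom} (hR : A.IsTrig p C R) :
    ∃ X z, pb X (A.actFun h hh) = z + R ∧ A.IsTrig p (C / α) X ∧ A.IsTrig p C z ∧
      pb (A.actFun (linForm v) (linForm v).differentiable.differentiableOn) z = 0 ∧
      A.IsTrig p (p * A.K * (C / α))
        (pb (A.actFun (linForm v) (linForm v).differentiable.differentiableOn) X) := by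
  obtain ⟨ι, _, g, k, b, hg, hk, hb, hgb, hC, rfl⟩ := hR
  set V := A.actFun (linForm v) (linForm v).differentiable.differentiableOn with hV
  have hVat : ∀ {g : CVec n × ℂ → ℂ} (hg : DifferentiableOn ℂ g (A.U 0)) (k : Fin n → ℤ),
      ∃ hg', pb V (atom g k hg) =
        atom (fun x => -(Complex.I * linForm v (intVec k) * g x)) k hg' := by
    intro g hg k
    have hg' : DifferentiableOn ℂ (fun x => -(Complex.I * linForm v (intVec k) * g x)) (A.U 0) :=
      (hg.const_mul _).neg
    refine ⟨hg', ?_⟩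
    obtain ⟨hg2, h2⟩ := pb_atom_actFun (linForm v).differentiable.differentiableOn hg k
    rw [pb_skew, hV, h2, ← neg_one_smul ℂ, smul_atom]
    refine atom_congr (fun x _ => ?_) rfl
    rw [ContinuousLinearMap.fderiv]
    ring
  have key : ∀ i, ∃ X z, pb X (A.actFun h hh) = z + atom (g i) (k i) (hg i) ∧
      A.IsTrig p (b i / α) X ∧ A.IsTrig p (b i) z ∧ pb V z = 0 ∧
      A.IsTrig p (p * A.K * (b i / α)) (pb V X) := by
    intro i
    have hb0 : 0 ≤ b i / α := div_nonneg (hb i) hα.le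
    rcases hres (k i) ((hk i).trans (Nat.mul_le_mul_right _ hp)) with h0 | h0
    · refine ⟨0, -atom (g i) (k i) (hg i), by simp, isTrig_zero.mono le_rfl hb0, ?_, ?_, ?_⟩
      · simpa using (isTrig_atom (hg i) (hk i) (hb i) (hgb i)).smul (-1)
      · obtain ⟨hg', h1⟩ := hVat (hg i) (k i)
        rw [map_neg, h1, neg_eq_zero]
        refine Hol.ext_fn fun x hx => ?_
        rw [fn_atom hx, h0, Hol.fn_zero]
        simp
      · rw [map_zero]
        exact isTrig_zero.mono le_rfl (by positivity)
    · have hne : ∀ x ∈ A.U 0, fderiv ℂ h x.1 (intVec (k i)) ≠ 0 := by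
        intro x hx h1
        have := h0 x.1 (by simpa using hx.1)
        rw [h1, norm_zero] at this
        linarith
      have hdiff : DifferentiableOn ℂ
          (fun x => g i x / (Complex.I * fderiv ℂ h x.1 (intVec (k i)))) (A.U 0) := by
        simp only [div_eq_mul_inv]
        exact (hg i).mul (((differentiableOn_comp_fst
          (differentiableOn_fderiv_apply isOpen_ball hh _)).const_mul _).fun_inv
          fun x hx => mul_ne_zero Complex.I_ne_zero (hne x hx))
      have hbd : ∀ x ∈ A.U p, ‖g i x / (Complex.I * fderiv ℂ h x.1 (intVec (k i)))‖ ≤ b i / α := by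
        intro x hx
        have hx0 := A.U_mono (Nat.zero_le p) hx
        rw [norm_div, norm_mul, Complex.norm_I, one_mul]
        exact div_le_div₀ (hb i) (hgb i x hx) hα (h0 x.1 (by simpa using hx0.1))
      refine ⟨atom _ (k i) hdiff, 0, ?_, isTrig_atom hdiff (hk i) hb0 hbd,
        isTrig_zero.mono le_rfl (hb i), map_zero _, ?_⟩
      · obtain ⟨hg', h1⟩ := pb_atom_actFun hh hdiff (k i)
        rw [h1, zero_add]
        refine atom_congr (fun x hx => ?_) rfl
        have := hne x hx
        have := Complex.I_ne_zero
        field_simp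
      · obtain ⟨hg', h1⟩ := hVat hdiff (k i)
        rw [h1]
        refine isTrig_atom hg' (hk i) (by positivity) fun x hx => ?_
        rw [norm_neg, norm_mul, norm_mul, Complex.norm_I, one_mul]
        refine mul_le_mul ?_ (hbd x hx) (norm_nonneg _) (by positivity)
        refine (norm_linForm_intVec_le hv _).trans ?_
        exact_mod_cast hk i
  choose X z h1 h2 h3 h4 h5 using key
  refine ⟨∑ i, X i, ∑ i, z i, ?_, ?_, ?_, ?_, ?_⟩
  · rw [LinearMap.map_sum₂, ← Finset.sum_add_distrib]
    exact Finset.sum_congr rfl fun i _ => h1 i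
  · refine (isTrig_sum fun i _ => h2 i).mono le_rfl ?_
    rw [← Finset.sum_div]
    exact div_le_div_of_nonneg_right hC hα.le
  · exact (isTrig_sum fun i _ => h3 i).mono le_rfl hC
  · rw [map_sum]
    exact Finset.sum_eq_zero fun i _ => h4 i
  · rw [map_sum]
    refine (isTrig_sum fun i _ => h5 i).mono le_rfl ?_
    rw [← Finset.mul_sum, ← Finset.sum_div]
    exact mul_le_mul_of_nonneg_left (div_le_div_of_nonneg_right hC hα.le) (by positivity)

end

end Frame

end

end AperiodicNekhoroshev

namespace AperiodicNekhoroshev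

noncomputable section

open Finset hiding mem_antidiagonal
open Finset.HasAntidiagonal (mem_antidiagonal)

theorem sum_half_pow_le (N : ℕ) : ∑ s ∈ Icc 1 N, (1 / 2 : ℝ) ^ s ≤ 1 := by
  have : ∀ N : ℕ, ∑ s ∈ Icc 1 N, (1 / 2 : ℝ) ^ s = 1 - (1 / 2) ^ N := by
    intro N
    induction N with
    | zero => simp
    | succ N ih => rw [sum_Icc_succ_top (by omega), ih]; ring
  rw [this]
  have : (0 : ℝ) ≤ (1 / 2) ^ N := by positivity
  linarith

theorem sum_mul_wt_le (N : ℕ) : ∑ s ∈ Icc 1 N, (s : ℝ) * wt s ≤ 1 := by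
  refine (sum_le_sum fun s hs => ?_).trans (sum_half_pow_le N)
  have h1 : (1 : ℝ) ≤ s := by exact_mod_cast (mem_Icc.1 hs).1
  rw [wt, sq, mul_div_assoc', div_le_iff₀ (by positivity)]
  have : (0 : ℝ) ≤ (1 / 2) ^ s := by positivity
  have : (0 : ℝ) ≤ s * (1 / 2) ^ s := by positivity
  nlinarith

theorem sum_wt_le (N : ℕ) : ∑ s ∈ Icc 1 N, wt s ≤ 1 := by
  refine (sum_le_sum fun s hs => ?_).trans (sum_mul_wt_le N)
  have h1 : (1 : ℝ) ≤ s := by exact_mod_cast (mem_Icc.1 hs).1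
  have := wt_nonneg s
  nlinarith

theorem sum_wt_mul_wt_tail_le (N : ℕ) :
    ∑ p ∈ (range (N + 1) ×ˢ range (N + 1)) with N < p.1 + p.2, wt p.1 * wt p.2 ≤
      2 * (1 / 2) ^ N := by
  calc _ ≤ ∑ p ∈ (range (N + 1) ×ˢ range (N + 1)) with N < p.1 + p.2,
        (1 / 2 : ℝ) ^ (N + 1) * (1 / (p.1 : ℝ) ^ 2 * (1 / (p.2 : ℝ) ^ 2)) := by
        refine sum_le_sum fun p hp => ?_
        have h : N < p.1 + p.2 := (mem_filter.1 hp).2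
        have h1 : (1 / 2 : ℝ) ^ (p.1 + p.2) ≤ (1 / 2) ^ (N + 1) :=
          pow_le_pow_of_le_one (by norm_num) (by norm_num) h
        calc wt p.1 * wt p.2 = (1 / 2 : ℝ) ^ (p.1 + p.2) *
              (1 / (p.1 : ℝ) ^ 2 * (1 / (p.2 : ℝ) ^ 2)) := by
              rw [wt, wt, pow_add]; ring
          _ ≤ _ := by gcongr
    _ ≤ ∑ p ∈ range (N + 1) ×ˢ range (N + 1),
        (1 / 2 : ℝ) ^ (N + 1) * (1 / (p.1 : ℝ) ^ 2 * (1 / (p.2 : ℝ) ^ 2)) :=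
        sum_le_sum_of_subset_of_nonneg (filter_subset _ _) fun p _ _ => by positivity
    _ = (1 / 2 : ℝ) ^ (N + 1) * ((∑ i ∈ range (N + 1), 1 / (i : ℝ) ^ 2) *
        ∑ i ∈ range (N + 1), 1 / (i : ℝ) ^ 2) := by
        rw [← mul_sum, sum_mul_sum, sum_product]
    _ ≤ (1 / 2 : ℝ) ^ (N + 1) * (2 * 2) := by
        have := sum_inv_sq_le N
        gcongr
    _ = _ := by ring

/-- The bracket of the partial sums of `Φ` and `H` when all convolution brackets up to the order
`N` vanish. -/
theorem sum_lie_sum_of_convLie_eq_zero {L : Type*} [LieRing L] {Φ H : ℕ → L} {N : ℕ}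
    (h : ∀ s ≤ N, convLie Φ H s = 0) :
    ⁅∑ s ∈ range (N + 1), Φ s, ∑ l ∈ range (N + 1), H l⁆ =
      ∑ p ∈ (range (N + 1) ×ˢ range (N + 1)) with N < p.1 + p.2, ⁅Φ p.1, H p.2⁆ := by
  rw [sum_lie]
  simp only [lie_sum]
  rw [← sum_product (f := fun p : ℕ × ℕ => ⁅Φ p.1, H p.2⁆), ← sum_filter_add_sum_filter_not _
    (fun p => N < p.1 + p.2), add_eq_left]
  rw [← sum_fiberwise_of_maps_to (g := fun p : ℕ × ℕ => p.1 + p.2) (t := range (N + 1))]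
  · refine sum_eq_zero fun s hs => ?_
    rw [← h s (by rw [mem_range] at hs; omega), convLie]
    refine sum_congr ?_ fun _ _ => rfl
    ext p
    simp only [mem_filter, mem_product, mem_range, mem_antidiagonal] at hs ⊢
    omega
  · intro p hp
    simp only [mem_filter, mem_range] at hp ⊢
    omega

variable {n : ℕ}

/-- The complex Hamiltonian vector field of `h(I) + f(I, φ, ξ)`, together with `ξ' = μ`. -/
def hamField (h : CVec n → ℂ) (f : Phase n → ℂ) (μ : ℂ) (x : Phase n) : Phase n :=
  (WithLp.toLp 2 fun j => -fderiv ℂ f x (0, EuclideanSpace.single j 1, 0),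
    WithLp.toLp 2 fun j => fderiv ℂ h x.1 (EuclideanSpace.single j 1) +
      fderiv ℂ f x (EuclideanSpace.single j 1, 0, 0), μ)

theorem apply_hamField (h : CVec n → ℂ) (f : Phase n → ℂ) (μ : ℂ) (x : Phase n)
    (T : Phase n →L[ℂ] ℂ) : T (hamField h f μ x) =
      ∑ j, (T (0, EuclideanSpace.single j 1, 0) * (fderiv ℂ h x.1 (EuclideanSpace.single j 1) +
          fderiv ℂ f x (EuclideanSpace.single j 1, 0, 0)) -
        T (EuclideanSpace.single j 1, 0, 0) * fderiv ℂ f x (0, EuclideanSpace.single j 1, 0)) +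
      μ * T (0, 0, 1) := by
  have e : ∀ w : CVec n, w = ∑ j, w j • (EuclideanSpace.single j 1 : CVec n) := by
    intro w
    ext i
    simp [Finset.sum_apply, Pi.single_apply]
  have h1 : ∀ w : CVec n, T (w, 0, 0) = ∑ j, w j * T (EuclideanSpace.single j 1, 0, 0) := by
    intro w
    have := map_sum (T.comp (ContinuousLinearMap.inl ℂ (CVec n) (CVec n × ℂ)))
      (fun j => w j • (EuclideanSpace.single j 1 : CVec n)) univ
    rw [← e w] at this
    simp only [Prod.mk_zero_zero]
    simpa using this
  have h2 : ∀ w : CVec n, T (0, w, 0) = ∑ j, w j * T (0, EuclideanSpace.single j 1, 0) := by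
    intro w
    have := map_sum (T.comp ((ContinuousLinearMap.inr ℂ (CVec n) (CVec n × ℂ)).comp
      (ContinuousLinearMap.inl ℂ (CVec n) ℂ)))
      (fun j => w j • (EuclideanSpace.single j 1 : CVec n)) univ
    rw [← e w] at this
    simpa using this
  have h3 : ∀ (a b : CVec n) (t : ℂ), T (a, b, t) = T (a, 0, 0) + T (0, b, 0) + t * T (0, 0, 1) := by
    intro a b t
    rw [← smul_eq_mul, ← map_smul, ← map_add, ← map_add]
    simp
  rw [hamField, h3, h1, h2, ← sum_add_distrib]
  congr 1
  refine sum_congr rfl fun j _ => ?_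
  ring

end

end AperiodicNekhoroshev

namespace AperiodicNekhoroshev

noncomputable section

open Metric Set Filter Topology

variable {n : ℕ}

theorem range_succ_eq_insert_Icc (N : ℕ) : Finset.range (N + 1) = insert 0 (Finset.Icc 1 N) := by
  ext s
  simp only [Finset.mem_range, Finset.mem_insert, Finset.mem_Icc]
  omega

theorem sum_range_succ_eq_add_Icc {α : Type*} [AddCommMonoid α] (F : ℕ → α) (N : ℕ) :
    ∑ s ∈ Finset.range (N + 1), F s = F 0 + ∑ s ∈ Finset.Icc 1 N, F s := by
  rw [range_succ_eq_insert_Icc, Finset.sum_insert (by simp)]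

theorem Obs.snd_eq_zero_of_mem_span {Ω : TopologicalSpace.Opens (Phase n)} {x : Obs Ω}
    (hx : x ∈ Submodule.span ℂ (Set.range fun p : Obs Ω × Obs Ω => ⁅p.1, p.2⁆)) :
    Obs.snd x = 0 := by
  have : Submodule.span ℂ (Set.range fun p : Obs Ω × Obs Ω => ⁅p.1, p.2⁆) ≤
      LinearMap.ker (Obs.snd (Ω := Ω)) := by
    rw [Submodule.span_le]
    rintro _ ⟨p, rfl⟩
    exact Obs.snd_lie _ _
  exact this hx

namespace Frame

variable {A : Frame n}

/-- The sequence of a perturbation by `∑ₛ Fₛ + μ η` of the integrable Hamiltonian `h`. -/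
def hamSeq (h0 : Hol A.dom) (F : ℕ → Hol A.dom) (μ : ℂ) (s : ℕ) : Obs A.dom :=
  Obs.mk (if s = 0 then h0 else F s) (if s = 1 then μ else 0)

theorem sum_hamSeq (h0 : Hol A.dom) (F : ℕ → Hol A.dom) (μ : ℂ) :
    ∑ s ∈ Finset.range (A.N + 1), hamSeq h0 F μ s =
      Obs.mk (h0 + ∑ s ∈ Finset.Icc 1 A.N, F s) μ := by
  refine Obs.ext ?_ ?_
  · rw [map_sum, sum_range_succ_eq_add_Icc]
    simp only [hamSeq, Obs.fst_mk, if_true]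
    congr 1
    refine Finset.sum_congr rfl fun s hs => ?_
    rw [if_neg (by have := (Finset.mem_Icc.1 hs).1; omega)]
  · rw [map_sum]
    simp only [hamSeq, Obs.snd_mk]
    rw [Finset.sum_ite_eq', if_pos]
    have := A.hN
    rw [Finset.mem_range]; omega

/-- The formal integrals of the perturbed Hamiltonian, with estimates of their terms and of the
bracket of the truncated series. -/
theorem exists_truncated_integral {h : CVec n → ℂ} (hh : DifferentiableOn ℂ h (ball A.c A.r))
    {v : Fin n → ℂ} (hv : ∀ j, ‖v j‖ ≤ 1) {α e μ : ℝ} (hα : 0 < α) (he : 0 ≤ e) (hμ : 0 ≤ μ)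
    (hres : ∀ k : Fin n → ℤ, l1 k ≤ A.N * A.K → linForm v (intVec k) = 0 ∨
      ∀ I ∈ ball A.c A.r, α ≤ ‖fderiv ℂ h I (intVec k)‖)
    (hκ : A.Γ * (e + A.c₀ * μ) / α ≤ 1 / 256) {F : ℕ → Hol A.dom}
    (hF : ∀ s, 1 ≤ s → s ≤ A.N → A.IsTrig s (e * (1 / 16) ^ (s - 1)) (F s)) :
    ∃ Q : ℕ → Hol A.dom, (∀ s, 1 ≤ s → s ≤ A.N →
        A.IsTrig s (2 * A.K * (8 * e / α) * wt s) (Q s)) ∧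
      ∀ P, P = A.actFun (linForm v) (linForm v).differentiable.differentiableOn +
          ∑ s ∈ Finset.Icc 1 A.N, Q s →
        A.IsTrig (2 * A.N) (A.K * e * (1 / 2) ^ A.N)
          (pb P (A.actFun h hh + ∑ s ∈ Finset.Icc 1 A.N, F s) + (μ : ℂ) • dTime P) := by
  set V := A.actFun (linForm v) (linForm v).differentiable.differentiableOn with hV
  set h0 := A.actFun h hh with hh0
  have hN := A.hN
  have hc := A.c₀_pos
  have hΓ := A.Γ_pos
  set E : ℝ := e + A.c₀ * μ with hE
  have heE : e ≤ E := by have : 0 ≤ A.c₀ * μ := by positivity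
                         linarith
  have hVt : dTime V = 0 := dTime_actFun _
  have hh0t : dTime h0 = 0 := dTime_actFun _
  let H : ℕ → Obs A.dom := hamSeq h0 F μ
  have hH0 : H 0 = Obs.mk h0 0 := by simp [H, hamSeq]
  have hH1 : H 1 = Obs.mk (F 1) μ := by simp [H, hamSeq]
  have hHs : ∀ s, 2 ≤ s → H s = Obs.mk (F s) 0 := by
    intro s hs
    simp [H, hamSeq, show s ≠ 0 by omega, show s ≠ 1 by omega]
  have hb1 : A.Bd 1 E (H 1) := by
    rw [hH1, Bd, Obs.fst_mk, Obs.snd_mk, Complex.norm_real, Real.norm_of_nonneg hμ]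
    refine (hF 1 le_rfl hN).mono le_rfl ?_
    rw [hE]; simp
  have hbs : ∀ s, 2 ≤ s → s ≤ A.N → A.Bd s (e * (1 / 16) ^ (s - 1)) (H s) := by
    intro s hs hsN
    rw [hHs s hs, Bd, Obs.fst_mk, Obs.snd_mk, norm_zero, mul_zero, sub_zero]
    exact hF s (by omega) hsN
  -- the homological equation for observables
  have hom : ∀ (s : ℕ) (C : ℝ) (R : Obs A.dom), s ≤ A.N → A.Bd s C R →
      ∃ X z, ⁅X, H 0⁆ = z + R ∧ A.Bd s ((C - A.c₀ * ‖Obs.snd R‖) / α) X ∧ A.Bd s C z ∧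
        ⁅Obs.mk V 0, z⁆ = 0 ∧
        A.Bd s (s * A.K * ((C - A.c₀ * ‖Obs.snd R‖) / α)) ⁅Obs.mk V 0, X⁆ := by
    intro s C R hs hR
    obtain ⟨X, z, h1, h2, h3, h4, h5⟩ := exists_homological hh hv hα hres hs hR
    refine ⟨Obs.mk X 0, Obs.mk z (-Obs.snd R), ?_, ?_, ?_, ?_, ?_⟩
    · refine Obs.ext ?_ ?_
      · rw [hH0, Obs.fst_lie, map_add]
        simpa using h1
      · rw [Obs.snd_lie, map_add]
        simp
    · simpa [Bd] using h2
    · simpa [Bd] using h3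
    · refine Obs.ext ?_ (Obs.snd_lie _ _)
      rw [Obs.fst_lie, map_zero]
      simp only [Obs.fst_mk, Obs.snd_mk, hVt, smul_zero, zero_smul, add_zero, sub_zero]
      exact h4
    · rw [Bd, Obs.fst_lie, Obs.snd_lie]
      simp only [Obs.fst_mk, Obs.snd_mk, zero_smul, add_zero, sub_zero, norm_zero, mul_zero]
      exact h5
  have hbR : ∀ {s C} {R : Obs A.dom}, A.Bd s C R → (C - A.c₀ * ‖Obs.snd R‖) / α ≤ C / α := by
    intro s C R _
    refine div_le_div_of_nonneg_right ?_ hα.le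
    have : 0 ≤ A.c₀ * ‖Obs.snd R‖ := by positivity
    linarith
  obtain ⟨Φ, hΦ0, hΦm, hΦb, hΦH⟩ := exists_formal_integral (N := A.N) (K := A.K) (v := Obs.mk V 0)
    (H := H) A.isLieScale_bd hΓ hα he heE hκ (by
      refine Obs.ext ?_ (Obs.snd_lie _ _)
      rw [hH0, Obs.fst_lie, map_zero]
      simp only [Obs.fst_mk, Obs.snd_mk, zero_smul, add_zero, sub_zero]
      obtain ⟨hg, h1⟩ := pb_atom_actFun (linForm v).differentiable.differentiableOn
        (differentiableOn_comp_fst hh) 0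
      rw [pb_skew, hh0, hV]
      unfold actFun at h1 ⊢
      rw [h1, neg_eq_zero]
      refine Hol.ext_fn fun x hx => ?_
      rw [fn_atom hx, Hol.fn_zero]
      have : (intVec (0 : Fin n → ℤ)) = 0 := by ext; simp [intVec]
      simp [this]) hb1 hbs (by
      obtain ⟨X, z, h1, h2, h3, h4, h5⟩ := hom 1 E (-H 1) hN (A.isLieScale_bd.neg hb1)
      have hC : E - A.c₀ * ‖Obs.snd (-H 1)‖ = e := by
        rw [map_neg, norm_neg, hH1, Obs.snd_mk, Complex.norm_real, Real.norm_of_nonneg hμ, hE]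
        ring
      rw [hC] at h2 h5
      exact ⟨X, z, h1, h2, h3, h4, by simpa using h5⟩) (by
      intro s C R _ hs hR
      obtain ⟨X, z, h1, h2, h3, h4, h5⟩ := hom s C R hs hR
      exact ⟨X, z, h1, A.isLieScale_bd.mono h2 (hbR hR), h3, h4,
        A.isLieScale_bd.mono h5 (mul_le_mul_of_nonneg_left (hbR hR) (by positivity))⟩)
  have hΦ0' : ∀ s, 1 ≤ s → Obs.snd (Φ s) = 0 := fun s hs => Obs.snd_eq_zero_of_mem_span (hΦm s hs)
  refine ⟨fun s => Obs.fst (Φ s), fun s hs hsN => ?_, fun P hP => ?_⟩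
  · have := hΦb s hs hsN
    rw [Bd, hΦ0' s hs, norm_zero, mul_zero, sub_zero] at this
    exact this
  have hsum : ∑ s ∈ Finset.range (A.N + 1), Φ s = Obs.mk P 0 := by
    rw [sum_range_succ_eq_add_Icc, hΦ0]
    refine Obs.ext ?_ ?_
    · rw [map_add, map_sum, Obs.fst_mk, Obs.fst_mk, hP]
    · rw [map_add, map_sum, Obs.snd_mk, Obs.snd_mk, zero_add]
      exact Finset.sum_eq_zero fun s hs => hΦ0' s (Finset.mem_Icc.1 hs).1
  have hlie : pb P (h0 + ∑ s ∈ Finset.Icc 1 A.N, F s) + (μ : ℂ) • dTime P =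
      Obs.fst ⁅∑ s ∈ Finset.range (A.N + 1), Φ s, ∑ l ∈ Finset.range (A.N + 1), H l⁆ := by
    rw [hsum, sum_hamSeq, Obs.fst_lie]
    simp
  rw [hlie, sum_lie_sum_of_convLie_eq_zero hΦH]
  have hbd : A.Bd (2 * A.N)
      (∑ p ∈ (Finset.range (A.N + 1) ×ˢ Finset.range (A.N + 1)) with A.N < p.1 + p.2,
        A.Γ * (2 * A.K * (8 * e / α) * wt p.1) * (2 * E * wt p.2))
      (∑ p ∈ (Finset.range (A.N + 1) ×ˢ Finset.range (A.N + 1)) with A.N < p.1 + p.2,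
        ⁅Φ p.1, H p.2⁆) := by
    refine A.isLieScale_bd.sum fun p hp => ?_
    simp only [Finset.mem_filter, Finset.mem_product, Finset.mem_range] at hp
    have hp1 : 1 ≤ p.1 := by omega
    have hp2 : 1 ≤ p.2 := by omega
    have hH2 : A.Bd p.2 (2 * E * wt p.2) (H p.2) := by
      rcases Nat.eq_or_lt_of_le hp2 with h | h
      · rw [← h]
        exact A.isLieScale_bd.mono hb1 (by rw [wt_one]; linarith)
      · refine A.isLieScale_bd.mono (hbs p.2 h (by omega)) ?_
        have := pow_sixteen_le hp2
        calc _ ≤ E * (2 * wt p.2) := mul_le_mul heE this (by positivity) (he.trans heE)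
          _ = _ := by ring
    have h3 := A.isLieScale_bd.lie hp1 hp2 (hΦb p.1 hp1 (by omega)) hH2
    exact IsTrig.mono h3 (by omega) le_rfl
  have h4 : A.IsTrig (2 * A.N) _ _ := hbd
  refine h4.mono le_rfl ?_
  have h5 : 0 ≤ A.c₀ * ‖Obs.snd (∑ p ∈ (Finset.range (A.N + 1) ×ˢ Finset.range (A.N + 1)) with
      A.N < p.1 + p.2, ⁅Φ p.1, H p.2⁆)‖ := by positivity
  refine (sub_le_self _ h5).trans ?_
  have hE0 : 0 ≤ E := he.trans heE
  have hK := A.hK'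
  calc _ = (A.Γ * E / α) * (32 * A.K * e) *
        ∑ p ∈ (Finset.range (A.N + 1) ×ˢ Finset.range (A.N + 1)) with A.N < p.1 + p.2,
          wt p.1 * wt p.2 := by
        rw [Finset.mul_sum]
        exact Finset.sum_congr rfl fun p _ => by ring
    _ ≤ (A.Γ * E / α) * (32 * A.K * e) * (2 * (1 / 2) ^ A.N) :=
        mul_le_mul_of_nonneg_left (sum_wt_mul_wt_tail_le _) (by positivity)
    _ ≤ 1 / 256 * (32 * A.K * e) * (2 * (1 / 2) ^ A.N) := by gcongr
    _ ≤ _ := by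
        have : 0 ≤ A.K * e * (1 / 2 : ℝ) ^ A.N := by positivity
        nlinarith

end Frame

end

end AperiodicNekhoroshev

namespace AperiodicNekhoroshev

noncomputable section

open Metric Set Filter Topology

variable {n : ℕ}

namespace Frame

variable {A : Frame n}

/-- **The almost integrals.** If `v` vanishes on the resonant harmonics, then the Hamiltonian
`h + f` has a function `P` close to `∑ⱼ vⱼ Iⱼ` whose derivative along the orbits is exponentially
small in the number of steps. -/
theorem exists_almost_integral {h : CVec n → ℂ} (hh : DifferentiableOn ℂ h (ball A.c A.r))
    {f : Phase n → ℂ} (hf : DifferentiableOn ℂ f A.dom)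
    {v : Fin n → ℂ} (hv : ∀ j, ‖v j‖ ≤ 1) {α e μ σ : ℝ} (hα : 0 < α) (he : 0 ≤ e) (hμ : 0 ≤ μ)
    (hσ : 0 < σ) (hσs : σ ≤ A.s)
    (hres : ∀ k : Fin n → ℤ, l1 k ≤ A.N * A.K → linForm v (intVec k) = 0 ∨
      ∀ I ∈ ball A.c A.r, α ≤ ‖fderiv ℂ h I (intVec k)‖)
    (hκ : A.Γ * (e + A.c₀ * μ) / α ≤ 1 / 256) {F : ℕ → Hol A.dom}
    (hF : ∀ s, 1 ≤ s → s ≤ A.N → A.IsTrig s (e * (1 / 16) ^ (s - 1)) (F s))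
    (htail : ∀ x ∈ A.dom, x.2.1 ∈ angleStrip n σ →
      ‖f x - ∑ s ∈ Finset.Icc 1 A.N, (F s).fn x‖ ≤ e * (1 / 2) ^ A.N) :
    ∃ P : Hol A.dom, ∀ x ∈ A.dom, x.1 ∈ ball A.c (A.r / 2) → x.2.2.im = 0 →
      (∀ j, (x.2.1 j).im = 0) → ‖P.fn x - linForm v x.1‖ ≤ 16 * A.K * e / α ∧
      ‖fderiv ℂ P.fn x (hamField h f μ x)‖ ≤
        e * (1 / 2) ^ A.N * (A.K + n * (A.K + 4 / σ)) := by
  obtain ⟨Q, hQ, hrem⟩ := exists_truncated_integral hh hv hα he hμ hres hκ hF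
  set V := A.actFun (linForm v) (linForm v).differentiable.differentiableOn with hV
  set P := V + ∑ s ∈ Finset.Icc 1 A.N, Q s with hP
  have hN := A.hN'
  have hK := A.hK'
  have hr := A.hr
  have hs := A.hs
  have hK1 : (1 : ℝ) ≤ A.K := by exact_mod_cast A.hK
  have hN1 : (1 : ℝ) ≤ A.N := by exact_mod_cast A.hN
  set a : ℝ := 8 * e / α with ha
  have ha0 : 0 ≤ a := by positivity
  have hsmall : A.K * a / A.r ≤ 1 / 256 := by
    have h1 : A.Γ * e / α ≤ 1 / 256 := by
      refine le_trans ?_ hκ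
      have hc := A.c₀_pos
      have hΓ := A.Γ_pos
      have : 0 ≤ A.c₀ * μ := by positivity
      gcongr
      linarith
    refine le_trans ?_ h1
    have : A.Γ * e / α = A.K * a / A.r * A.N := by
      rw [ha]; unfold Γ; field_simp
    rw [this]
    exact le_mul_of_one_le_right (by positivity) hN1
  refine ⟨P, fun x hx hxr hxt hxφ => ?_⟩
  have hU : (x.1, x.2.2) ∈ A.U (2 * A.N) := by
    have e1 : (1 - (2 * A.N : ℕ) / (4 * A.N) : ℝ) = 1 / 2 := by
      push_cast; field_simp; norm_num
    refine ⟨?_, ?_⟩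
    · simp only [e1]
      rw [mul_one_div]
      exact hxr
    · simp only [e1]
      change |x.2.2.im| < _
      rw [hxt, abs_zero]
      positivity
  have hQsum : ∀ {C : ℕ → ℝ} {G : ℕ → ℂ}, (∀ s ∈ Finset.Icc 1 A.N, ‖G s‖ ≤ C s) →
      ‖∑ s ∈ Finset.Icc 1 A.N, G s‖ ≤ ∑ s ∈ Finset.Icc 1 A.N, C s := fun h =>
    (norm_sum_le _ _).trans (Finset.sum_le_sum h)
  have hfP : ∀ w, fderiv ℂ P.fn x w = fderiv ℂ V.fn x w +
      ∑ s ∈ Finset.Icc 1 A.N, fderiv ℂ (Q s).fn x w := by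
    intro w
    rw [hP, Hol.fn_add, Hol.fn_sum, fderiv_add (V.differentiableAt hx)
      (DifferentiableAt.sum fun s _ => (Q s).differentiableAt hx),
      fderiv_sum fun s _ => (Q s).differentiableAt hx]
    simp
  refine ⟨?_, ?_⟩
  · have e1 : P.fn x - linForm v x.1 = ∑ s ∈ Finset.Icc 1 A.N, (Q s).fn x := by
      rw [hP, Hol.fn_add, Hol.fn_sum, Pi.add_apply, hV, fn_actFun _ hx, Finset.sum_apply]
      ring
    rw [e1]
    refine (hQsum fun s hs => (hQ s (Finset.mem_Icc.1 hs).1 (Finset.mem_Icc.1 hs).2).norm_fn_le hx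
      (A.U_mono (by have := (Finset.mem_Icc.1 hs).2; omega) hU) hxφ).trans ?_
    rw [← Finset.mul_sum]
    calc _ ≤ 2 * A.K * a * 1 := mul_le_mul_of_nonneg_left (sum_wt_le _) (by positivity)
      _ = _ := by rw [ha]; ring
  -- the splitting of the derivative into the trigonometric part and the tail
  set h0 := A.actFun h hh with hh0
  set G := h0 + ∑ s ∈ Finset.Icc 1 A.N, F s with hG
  set D : Phase n → ℂ := fun y => f y - ∑ s ∈ Finset.Icc 1 A.N, (F s).fn y with hD
  have hsumF : DifferentiableOn ℂ (fun y => ∑ s ∈ Finset.Icc 1 A.N, (F s).fn y) A.dom :=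
    DifferentiableOn.fun_sum fun s _ => (F s).differentiableOn
  have hDd : DifferentiableOn ℂ D A.dom := hf.sub hsumF
  have hfx : DifferentiableAt ℂ f x := hf.differentiableAt (A.dom.isOpen.mem_nhds hx)
  have hFx := hsumF.differentiableAt (A.dom.isOpen.mem_nhds hx)
  have hDx : ∀ w, fderiv ℂ D x w = fderiv ℂ f x w -
      ∑ s ∈ Finset.Icc 1 A.N, fderiv ℂ (F s).fn x w := by
    intro w
    rw [hD, fderiv_fun_sub hfx hFx, fderiv_fun_sum fun s _ => (F s).differentiableAt hx]
    simp
  have hGx : ∀ w : Phase n, fderiv ℂ G.fn x w = fderiv ℂ h x.1 w.1 +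
      ∑ s ∈ Finset.Icc 1 A.N, fderiv ℂ (F s).fn x w := by
    rintro ⟨w1, w2, w3⟩
    rw [hG, Hol.fn_add, Hol.fn_sum, fderiv_add (h0.differentiableAt hx)
      (DifferentiableAt.sum fun s _ => (F s).differentiableAt hx),
      fderiv_sum fun s _ => (F s).differentiableAt hx, ← fderiv_actFun hh hx w1 w2 w3]
    simp [hh0]
  have hsplit : fderiv ℂ P.fn x (hamField h f μ x) =
      (pb P G + (μ : ℂ) • dTime P).fn x +
      ∑ j, (fderiv ℂ P.fn x (0, EuclideanSpace.single j 1, 0) *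
          fderiv ℂ D x (EuclideanSpace.single j 1, 0, 0) -
        fderiv ℂ P.fn x (EuclideanSpace.single j 1, 0, 0) *
          fderiv ℂ D x (0, EuclideanSpace.single j 1, 0)) := by
    rw [apply_hamField, Hol.fn_add (pb P G), Pi.add_apply, fn_pb _ _ hx, Hol.fn_smul,
      Pi.smul_apply, dTime,
      Hol.D_apply _ _ hx, smul_eq_mul, add_right_comm, ← Finset.sum_add_distrib]
    congr 1
    refine Finset.sum_congr rfl fun j _ => ?_
    simp only [hGx, hDx, map_zero]
    ring
  have hrem1 : ‖(pb P G + (μ : ℂ) • dTime P).fn x‖ ≤ A.K * e * (1 / 2) ^ A.N :=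
    (hrem P rfl).norm_fn_le hx hU hxφ
  set τ : ℝ := e * (1 / 2) ^ A.N with hτ
  have hτ0 : 0 ≤ τ := by positivity
  have hV1 : ∀ j, fderiv ℂ V.fn x (0, EuclideanSpace.single j 1, 0) = 0 := by
    intro j
    rw [hV, fderiv_actFun _ hx, map_zero]
  have hV2 : ∀ j, fderiv ℂ V.fn x (EuclideanSpace.single j 1, 0, 0) = v j := by
    intro j
    rw [hV, fderiv_actFun _ hx, ContinuousLinearMap.fderiv, linForm_single]
  have hPang : ∀ j, ‖fderiv ℂ P.fn x (0, EuclideanSpace.single j 1, 0)‖ ≤ A.K * (2 * A.K * a) := by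
    intro j
    rw [hfP, hV1, zero_add]
    refine (hQsum fun s hs => (hQ s (Finset.mem_Icc.1 hs).1
      (Finset.mem_Icc.1 hs).2).norm_fderiv_ang_le hx
      (A.U_mono (by have := (Finset.mem_Icc.1 hs).2; omega) hU) hxφ j).trans ?_
    calc _ = A.K * (2 * A.K * a) * ∑ s ∈ Finset.Icc 1 A.N, (s : ℝ) * wt s := by
          rw [Finset.mul_sum]
          exact Finset.sum_congr rfl fun s _ => by ring
      _ ≤ A.K * (2 * A.K * a) * 1 :=
          mul_le_mul_of_nonneg_left (sum_mul_wt_le _) (by positivity)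
      _ = _ := mul_one _
  have hPact : ∀ j, ‖fderiv ℂ P.fn x (EuclideanSpace.single j 1, 0, 0)‖ ≤ 2 := by
    intro j
    rw [hfP, hV2]
    have h1 : ‖∑ s ∈ Finset.Icc 1 A.N, fderiv ℂ (Q s).fn x (EuclideanSpace.single j 1, 0, 0)‖ ≤
        8 * (A.K * a / A.r) := by
      refine (hQsum fun s hs => (hQ s (Finset.mem_Icc.1 hs).1
        (Finset.mem_Icc.1 hs).2).norm_fderiv_act_le (q := A.N) A.hN hx
        (A.U_mono (by have := (Finset.mem_Icc.1 hs).2; omega) hU) hxφ j).trans ?_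
      calc _ = 8 * (A.K * a / A.r) * ∑ s ∈ Finset.Icc 1 A.N, wt s := by
            rw [Finset.mul_sum]
            refine Finset.sum_congr rfl fun s _ => ?_
            field_simp
            ring
        _ ≤ 8 * (A.K * a / A.r) * 1 :=
            mul_le_mul_of_nonneg_left (sum_wt_le _) (by positivity)
        _ = _ := mul_one _
    have := norm_add_le (v j)
      (∑ s ∈ Finset.Icc 1 A.N, fderiv ℂ (Q s).fn x (EuclideanSpace.single j 1, 0, 0))
    have := hv j
    linarith
  -- Cauchy's estimates for the tail
  have hDact : ∀ j, ‖fderiv ℂ D x (EuclideanSpace.single j 1, 0, 0)‖ ≤ τ / (A.r / 2) := by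
    intro j
    refine norm_fderiv_apply_le A.dom.isOpen hDd (by positivity) fun z hz => ?_
    have hmem : x + z • ((EuclideanSpace.single j 1, 0, 0) : Phase n) ∈ A.dom := by
      obtain ⟨-, h2, h3⟩ := A.mem_dom.1 hx
      refine A.mem_dom.2 ⟨?_, by simpa using h2, by simpa using h3⟩
      simp only [mem_ball, dist_eq_norm, Prod.fst_add, Prod.smul_fst] at hxr ⊢
      have hz' : ‖z • (EuclideanSpace.single j 1 : CVec n)‖ ≤ A.r / 2 := by
        rw [norm_smul]; simpa using hz
      calc ‖x.1 + z • (EuclideanSpace.single j 1 : CVec n) - A.c‖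
          = ‖(x.1 - A.c) + z • (EuclideanSpace.single j 1 : CVec n)‖ := by congr 1; abel
        _ ≤ _ := norm_add_le _ _
        _ < A.r / 2 + A.r / 2 := add_lt_add_of_lt_of_le hxr hz'
        _ = A.r := by ring
    refine ⟨hmem, htail _ hmem fun i => ?_⟩
    simp [hxφ, hσ]
  have hDang : ∀ j, ‖fderiv ℂ D x (0, EuclideanSpace.single j 1, 0)‖ ≤ τ / (σ / 2) := by
    intro j
    refine norm_fderiv_apply_le A.dom.isOpen hDd (by positivity) fun z hz => ?_
    have hang : ∀ i, |((x + z • ((0, EuclideanSpace.single j 1, 0) : Phase n)).2.1 i).im| < σ := by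
      intro i
      simp only [Prod.snd_add, Prod.smul_snd, Prod.fst_add, Prod.smul_fst, PiLp.add_apply,
        PiLp.smul_apply, smul_eq_mul, Complex.add_im, hxφ, zero_add]
      refine lt_of_le_of_lt ((Complex.abs_im_le_norm _).trans ?_) (half_lt_self hσ)
      rw [norm_mul]
      refine (mul_le_of_le_one_right (norm_nonneg z) ?_).trans hz
      rw [PiLp.single_apply]
      split_ifs <;> simp
    have hmem : x + z • ((0, EuclideanSpace.single j 1, 0) : Phase n) ∈ A.dom := by
      obtain ⟨h1, -, h3⟩ := A.mem_dom.1 hx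
      exact A.mem_dom.2 ⟨by simpa using h1, fun i => (hang i).trans_le hσs, by simpa using h3⟩
    exact ⟨hmem, htail _ hmem hang⟩
  rw [hsplit]
  refine (norm_add_le _ _).trans ?_
  have hterm : ∀ j : Fin n, ‖fderiv ℂ P.fn x (0, EuclideanSpace.single j 1, 0) *
        fderiv ℂ D x (EuclideanSpace.single j 1, 0, 0) -
      fderiv ℂ P.fn x (EuclideanSpace.single j 1, 0, 0) *
        fderiv ℂ D x (0, EuclideanSpace.single j 1, 0)‖ ≤ τ * (A.K + 4 / σ) := by
    intro j
    refine (norm_sub_le _ _).trans ?_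
    rw [norm_mul, norm_mul]
    calc _ ≤ A.K * (2 * A.K * a) * (τ / (A.r / 2)) + 2 * (τ / (σ / 2)) :=
          add_le_add (mul_le_mul (hPang j) (hDact j) (norm_nonneg _) (by positivity))
            (mul_le_mul (hPact j) (hDang j) (norm_nonneg _) (by positivity))
      _ = τ * (4 * A.K * (A.K * a / A.r) + 4 / σ) := by field_simp; ring
      _ ≤ τ * (4 * A.K * (1 / 256) + 4 / σ) := by gcongr
      _ ≤ _ := by gcongr; linarith
  calc _ ≤ A.K * e * (1 / 2) ^ A.N + ∑ _j : Fin n, τ * (A.K + 4 / σ) :=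
        add_le_add hrem1 ((norm_sum_le _ _).trans (Finset.sum_le_sum fun j _ => hterm j))
    _ = _ := by
        rw [Finset.sum_const, Finset.card_univ, Fintype.card_fin, nsmul_eq_mul, hτ]
        ring

end Frame

end

end AperiodicNekhoroshev

namespace AperiodicNekhoroshev

noncomputable section

open Metric Set Filter Topology MeasureTheory

/-! ### Fourier series of holomorphic functions -/

variable {n : ℕ}

/-- The invariant probability measure of the torus. -/
def torusMeasure (n : ℕ) : Measure (UnitAddTorus (Fin n)) :=
  Measure.pi fun _ => (AddCircle.haarAddCircle : Measure (AddCircle (1 : ℝ)))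

instance : IsProbabilityMeasure (torusMeasure n) := by unfold torusMeasure; infer_instance

instance : Measure.IsAddHaarMeasure (torusMeasure n) := by unfold torusMeasure; infer_instance

/-- The representative in `[0, 1)ⁿ` of a point of the torus. -/
def torusRep (x : UnitAddTorus (Fin n)) : Fin n → ℝ := fun j => AddCircle.equivIco 1 0 (x j)

/-- The projection onto the torus. -/
def toTorus (t : Fin n → ℝ) : UnitAddTorus (Fin n) := fun j => (t j : AddCircle (1 : ℝ))

theorem measurable_torusRep : Measurable (torusRep (n := n)) :=
  measurable_pi_lambda _ fun j => measurable_subtype_coe.comp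
    ((AddCircle.measurableEquivIco 1 0).measurable.comp (measurable_pi_apply j))

theorem toTorus_torusRep (x : UnitAddTorus (Fin n)) : toTorus (torusRep x) = x := by
  funext j
  exact AddCircle.coe_equivIco

theorem toTorus_add (s t : Fin n → ℝ) : toTorus (s + t) = toTorus s + toTorus t := rfl

theorem isOpenQuotientMap_toTorus : IsOpenQuotientMap (toTorus (n := n)) :=
  IsOpenQuotientMap.piMap fun _ : Fin n =>
    (QuotientAddGroup.isOpenQuotientMap_mk (N := AddSubgroup.zmultiples (1 : ℝ)))

theorem exists_int_torusRep_toTorus (t : Fin n → ℝ) :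
    ∃ m : Fin n → ℤ, ∀ j, torusRep (toTorus t) j = t j + m j := by
  have h : ∀ j, ∃ m : ℤ, (m : ℝ) = torusRep (toTorus t) j - t j := by
    intro j
    have h1 := congrFun (toTorus_torusRep (toTorus t)) j
    have h2 : ((torusRep (toTorus t) j - t j : ℝ) : AddCircle (1 : ℝ)) = 0 := by
      rw [AddCircle.coe_sub, sub_eq_zero]
      exact h1
    obtain ⟨m, hm⟩ := (AddCircle.coe_eq_zero_iff _).1 h2
    exact ⟨m, by rw [← hm]; simp⟩
  choose m hm using h
  exact ⟨m, fun j => by rw [hm]; ring⟩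

/-- The translation of the angles by `2π t`. -/
def angShift (t : Fin n → ℝ) : Phase n :=
  (0, WithLp.toLp 2 fun j => ((2 * Real.pi * t j : ℝ) : ℂ), 0)

theorem angShift_add (s t : Fin n → ℝ) : angShift (s + t) = angShift s + angShift t := by
  refine Prod.ext (by simp [angShift]) (Prod.ext ?_ (by simp [angShift]))
  ext j
  simp [angShift]
  ring

theorem continuous_angShift : Continuous (angShift (n := n)) := by
  unfold angShift
  refine continuous_const.prodMk (Continuous.prodMk ?_ continuous_const)
  refine (PiLp.continuous_toLp 2 _).comp (continuous_pi fun j => ?_)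
  exact Complex.continuous_ofReal.comp (continuous_const.mul (continuous_apply j))

theorem mFourier_toTorus (k : Fin n → ℤ) (t : Fin n → ℝ) :
    UnitAddTorus.mFourier k (toTorus t) = Complex.exp (Complex.I * pairing k (angShift t).2.1) := by
  change ∏ j, fourier (k j) ((t j : ℝ) : AddCircle (1 : ℝ)) = _
  simp only [fourier_coe_apply]
  rw [← Complex.exp_sum, pairing_apply, Finset.mul_sum]
  congr 1
  refine Finset.sum_congr rfl fun j _ => ?_
  simp [angShift]
  ring

theorem mFourier_add_arg (k : Fin n → ℤ) (x y : UnitAddTorus (Fin n)) :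
    UnitAddTorus.mFourier k (x + y) = UnitAddTorus.mFourier k x * UnitAddTorus.mFourier k y := by
  change ∏ j, fourier (k j) (x j + y j) = (∏ j, fourier (k j) (x j)) * ∏ j, fourier (k j) (y j)
  simp only [fourier_apply, smul_add, AddCircle.toCircle_add, Circle.coe_mul,
    Finset.prod_mul_distrib]

theorem norm_mFourier_apply (k : Fin n → ℤ) (x : UnitAddTorus (Fin n)) :
    ‖UnitAddTorus.mFourier k x‖ = 1 := by
  rw [← toTorus_torusRep x, mFourier_toTorus]
  exact Frame.norm_exp_pairing (fun j => by simp only [angShift, Complex.ofReal_im]) k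

theorem differentiableOn_integral_translate {E X : Type*} [NormedAddCommGroup E] [NormedSpace ℂ E]
    [FiniteDimensional ℂ E] [MeasurableSpace E] [BorelSpace E] [SecondCountableTopology E]
    [MeasurableSpace X] {μ : Measure X}
    [IsFiniteMeasure μ] {Ω : Set E} (hΩ : IsOpen Ω) {f : E → ℂ} (hf : DifferentiableOn ℂ f Ω)
    {C : ℝ} (hC : ∀ x ∈ Ω, ‖f x‖ ≤ C) {τ : X → E} (hτ : Measurable τ)
    (hτΩ : ∀ z ∈ Ω, ∀ x, z + τ x ∈ Ω) {m : X → ℂ} (hm : Measurable m) (hm1 : ∀ x, ‖m x‖ ≤ 1) :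
    DifferentiableOn ℂ (fun z => ∫ x, m x * f (z + τ x) ∂μ) Ω := by
  intro z₀ hz₀
  have hmeas : ∀ z ∈ Ω, Measurable fun x => m x * f (z + τ x) := by
    intro z hz
    refine hm.mul ?_
    exact (continuousOn_iff_continuous_domRestrict.1 hf.continuousOn).measurable.comp
      ((measurable_const.add hτ).subtype_mk (h := hτΩ z hz))
  obtain ⟨ε, hε, hball⟩ := Metric.isOpen_iff.1 hΩ z₀ hz₀
  have hsub : ball z₀ (ε / 2) ⊆ Ω := (ball_subset_ball (by linarith)).trans hball
  have hC0 : 0 ≤ C := (norm_nonneg _).trans (hC z₀ hz₀)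
  have hbd : ∀ x, ∀ z ∈ ball z₀ (ε / 2), ‖m x • fderiv ℂ f (z + τ x)‖ ≤ C / (ε / 2) := by
    intro x z hz
    rw [norm_smul]
    refine (mul_le_of_le_one_left (norm_nonneg _) (hm1 x)).trans ?_
    refine ContinuousLinearMap.opNorm_le_bound _ (by positivity) fun w => ?_
    rcases eq_or_ne w 0 with rfl | hw
    · simp
    have hw0 : 0 < ‖w‖ := norm_pos_iff.2 hw
    refine (norm_fderiv_apply_le hΩ hf (x := z + τ x) (w := w) (R := ε / 2 / ‖w‖) (C := C)
      (by positivity) fun c hc => ?_).trans (le_of_eq (by field_simp))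
    have hmem : z + τ x + c • w ∈ Ω := by
      rw [add_right_comm]
      refine hτΩ _ (hball ?_) x
      rw [mem_ball, dist_eq_norm] at hz ⊢
      have h2 : ‖c • w‖ ≤ ε / 2 := by
        rw [norm_smul]
        rwa [le_div_iff₀ hw0] at hc
      calc ‖z + c • w - z₀‖ = ‖(z - z₀) + c • w‖ := by congr 1; abel
        _ ≤ _ := norm_add_le _ _
        _ < ε / 2 + ε / 2 := add_lt_add_of_lt_of_le hz h2
        _ = ε := by ring
    exact ⟨hmem, hC _ hmem⟩
  have key := hasFDerivAt_integral_of_dominated_of_fderiv_le (𝕜 := ℂ) (μ := μ)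
    (F := fun z x => m x * f (z + τ x)) (F' := fun z x => m x • fderiv ℂ f (z + τ x)) (x₀ := z₀)
    (s := ball z₀ (ε / 2)) (bound := fun _ => C / (ε / 2)) (ball_mem_nhds _ (by positivity))
    (by
      filter_upwards [hΩ.mem_nhds hz₀] with z hz
      exact (hmeas z hz).aestronglyMeasurable)
    (by
      refine Integrable.of_bound (hmeas z₀ hz₀).aestronglyMeasurable C (ae_of_all _ fun x => ?_)
      rw [norm_mul]
      exact (mul_le_of_le_one_left (norm_nonneg _) (hm1 x)).trans (hC _ (hτΩ z₀ hz₀ x)))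
    (by
      have : Measurable fun x => fderiv ℂ f (z₀ + τ x) :=
        (measurable_fderiv ℂ f).comp (measurable_const.add hτ)
      exact (hm.smul this).aestronglyMeasurable)
    (ae_of_all _ hbd) (integrable_const _)
    (ae_of_all _ fun x z hz => by
      have h1 : HasFDerivAt f (fderiv ℂ f (z + τ x)) (z + τ x) :=
        (hf.differentiableAt (hΩ.mem_nhds (hτΩ z (hsub hz) x))).hasFDerivAt
      have h2 : HasFDerivAt (fun z => f (z + τ x)) (fderiv ℂ f (z + τ x)) z :=
        (hasFDerivAt_comp_add_right (τ x)).2 h1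
      exact h2.const_mul (m x))
  exact key.differentiableAt.differentiableWithinAt

end

end AperiodicNekhoroshev

namespace AperiodicNekhoroshev

noncomputable section

open Metric Set Filter Topology MeasureTheory

variable {n : ℕ}

theorem add_angShift_mem {A : Frame n} {z : Phase n} (hz : z ∈ A.dom) (t : Fin n → ℝ) :
    z + angShift t ∈ A.dom := by
  obtain ⟨h1, h2, h3⟩ := A.mem_dom.1 hz
  refine A.mem_dom.2 ⟨by simpa [angShift] using h1, fun j => ?_, by simpa [angShift] using h3⟩
  have : ((z + angShift t).2.1 j).im = (z.2.1 j).im := by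
    simp only [angShift, Prod.snd_add, Prod.fst_add, PiLp.add_apply, Complex.add_im,
      Complex.ofReal_im, add_zero]
  rw [this]
  exact h2 j

/-- Periodicity with period `2π` in each of the angles. -/
def AngPeriodic (A : Frame n) (f : Phase n → ℂ) : Prop :=
  ∀ z ∈ A.dom, ∀ j, f (z + (0, EuclideanSpace.single j (2 * Real.pi : ℂ), 0)) = f z

/-- The `k`-th Fourier coefficient of `f` with respect to the angles, the origin of the angles
being shifted to the angles of `z`. -/
def fourierInt (f : Phase n → ℂ) (k : Fin n → ℤ) (z : Phase n) : ℂ :=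
  ∫ x, UnitAddTorus.mFourier (-k) x * f (z + angShift (torusRep x)) ∂torusMeasure n

section

variable {A : Frame n} {f : Phase n → ℂ} (hf : DifferentiableOn ℂ f A.dom) {C : ℝ}
  (hC : ∀ x ∈ A.dom, ‖f x‖ ≤ C) (hper : AngPeriodic A f)

include hper

theorem AngPeriodic.int {z : Phase n} (hz : z ∈ A.dom) (m : Fin n → ℤ) :
    f (z + angShift fun j => (m j : ℝ)) = f z := by
  let S : AddSubgroup (Fin n → ℤ) :=
    { carrier := {m | ∀ z ∈ A.dom, f (z + angShift fun j => (m j : ℝ)) = f z}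
      zero_mem' := by
        intro z _
        have : angShift (fun j : Fin n => (((0 : Fin n → ℤ) j : ℤ) : ℝ)) = 0 := by
          refine Prod.ext rfl (Prod.ext ?_ rfl)
          ext j
          simp [angShift]
        rw [this, add_zero]
      add_mem' := by
        intro a b ha hb z hz
        have : (fun j => (((a + b) j : ℤ) : ℝ)) = (fun j => (a j : ℝ)) + fun j => (b j : ℝ) := by
          funext j; simp
        rw [this, angShift_add, ← add_assoc, hb _ (add_angShift_mem hz _), ha z hz]
      neg_mem' := by
        intro a ha z hz
        have h1 := ha _ (add_angShift_mem hz fun j => (((-a) j : ℤ) : ℝ))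
        rw [add_assoc, ← angShift_add] at h1
        have : ((fun j => (((-a) j : ℤ) : ℝ)) + fun j => (a j : ℝ)) = fun j : Fin n => (0 : ℝ) := by
          funext j; simp
        rw [this] at h1
        have h0 : angShift (fun _ : Fin n => (0 : ℝ)) = 0 := by
          refine Prod.ext rfl (Prod.ext ?_ rfl)
          ext j
          simp [angShift]
        rw [h0, add_zero] at h1
        exact h1.symm }
  have hsingle : ∀ j, (Pi.single j 1 : Fin n → ℤ) ∈ S := by
    intro j z hz
    rw [← hper z hz j]
    congr 2
    refine Prod.ext rfl (Prod.ext ?_ rfl)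
    ext i
    by_cases h : i = j
    · subst h; simp [angShift]
    · simp [angShift, h]
  have hm : m ∈ S := by
    have : m = ∑ j, m j • (Pi.single j 1 : Fin n → ℤ) := by
      funext i
      simp [Finset.sum_apply, Pi.single_apply]
    rw [this]
    exact S.sum_mem fun j _ => S.zsmul_mem (hsingle j) _
  exact hm z hz

theorem AngPeriodic.toTorus {z : Phase n} (hz : z ∈ A.dom) (t : Fin n → ℝ) :
    f (z + angShift (torusRep (toTorus t))) = f (z + angShift t) := by
  obtain ⟨m, hm⟩ := exists_int_torusRep_toTorus t
  have : torusRep (AperiodicNekhoroshev.toTorus t) = t + fun j => (m j : ℝ) := funext hm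
  rw [this, angShift_add, ← add_assoc, hper.int (add_angShift_mem hz t)]

include hf

theorem continuous_lift {z : Phase n} (hz : z ∈ A.dom) :
    Continuous fun x : UnitAddTorus (Fin n) => f (z + angShift (torusRep x)) := by
  rw [isOpenQuotientMap_toTorus.isQuotientMap.continuous_iff]
  have : (fun x : UnitAddTorus (Fin n) => f (z + angShift (torusRep x))) ∘ toTorus =
      fun t => f (z + angShift t) := funext fun t => hper.toTorus hz t
  rw [this]
  exact hf.continuousOn.comp_continuous (continuous_const.add continuous_angShift)
    fun t => add_angShift_mem hz t

omit hf

theorem fourierInt_add_angShift (k : Fin n → ℤ) {z : Phase n} (hz : z ∈ A.dom) (t : Fin n → ℝ) :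
    fourierInt f k (z + angShift t) =
      Complex.exp (Complex.I * pairing k (angShift t).2.1) * fourierInt f k z := by
  have h1 : ∀ x, UnitAddTorus.mFourier (-k) x * f (z + angShift t + angShift (torusRep x)) =
      UnitAddTorus.mFourier k (toTorus t) *
        (UnitAddTorus.mFourier (-k) (x + toTorus t) *
          f (z + angShift (torusRep (x + toTorus t)))) := by
    intro x
    have e1 : x + toTorus t = toTorus (torusRep x + t) := by
      rw [toTorus_add, toTorus_torusRep]
    have e2 : f (z + angShift (torusRep (x + toTorus t))) =
        f (z + angShift t + angShift (torusRep x)) := by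
      rw [e1, hper.toTorus hz, angShift_add]
      congr 1
      abel
    have e3 : UnitAddTorus.mFourier k (toTorus t) * UnitAddTorus.mFourier (-k) (toTorus t) = 1 := by
      rw [← ContinuousMap.mul_apply, mul_comm]
      have := UnitAddTorus.mFourier_add (n := k) (m := -k) (x := toTorus t)
      rw [neg_add_cancel, UnitAddTorus.mFourier_zero] at this
      rw [ContinuousMap.mul_apply, ← this]
      rfl
    rw [e2, mFourier_add_arg]
    linear_combination (-(UnitAddTorus.mFourier (-k) x *
      f (z + angShift t + angShift (torusRep x)))) * e3
  rw [fourierInt]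
  simp only [h1]
  rw [integral_const_mul, ← mFourier_toTorus, fourierInt]
  congr 1
  exact integral_add_right_eq_self
    (fun x => UnitAddTorus.mFourier (-k) x * f (z + angShift (torusRep x))) (toTorus t)

omit hper

include hC

theorem norm_fourierInt_le (k : Fin n → ℤ) {z : Phase n} (hz : z ∈ A.dom) :
    ‖fourierInt f k z‖ ≤ C := by
  have := norm_integral_le_of_norm_le_const (μ := torusMeasure n)
    (f := fun x => UnitAddTorus.mFourier (-k) x * f (z + angShift (torusRep x))) (C := C)
    (ae_of_all _ fun x => by
      rw [norm_mul, norm_mFourier_apply, one_mul]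
      exact hC _ (add_angShift_mem hz _))
  simpa [fourierInt] using this

include hf

theorem differentiableOn_fourierInt (k : Fin n → ℤ) : DifferentiableOn ℂ (fourierInt f k) A.dom :=
  differentiableOn_integral_translate A.dom.isOpen hf hC
    (continuous_angShift.measurable.comp measurable_torusRep)
    (fun _ hz _ => add_angShift_mem hz _) (UnitAddTorus.mFourier (-k)).continuous.measurable
    fun x => (norm_mFourier_apply (-k) x).le

include hper

/-- The dependence of the shifted Fourier coefficients on the complex shift: the function
`fourierInt f k · e^{-i k·φ}` has vanishing derivatives in the real directions. -/
theorem fourierInt_eq (k : Fin n → ℤ) {z : Phase n} (hz : z ∈ A.dom) :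
    fourierInt f k z = fourierInt f k (z.1, 0, z.2.2) *
      Complex.exp (Complex.I * pairing k z.2.1) := by
  obtain ⟨hz1, hz2, hz3⟩ := A.mem_dom.1 hz
  set J : CVec n → ℂ := fun w => fourierInt f k (z.1, w, z.2.2) *
    Complex.exp (-(Complex.I * pairing k w)) with hJ
  have hmem : ∀ w ∈ angleStrip n A.s, (z.1, w, z.2.2) ∈ A.dom := fun w hw =>
    A.mem_dom.2 ⟨hz1, hw, hz3⟩
  have hJd : DifferentiableOn ℂ J (angleStrip n A.s) := by
    refine DifferentiableOn.mul ?_ ?_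
    · refine DifferentiableOn.comp (g := fourierInt f k) (f := fun w : CVec n => (z.1, w, z.2.2))
        (differentiableOn_fourierInt hf hC k) (Differentiable.differentiableOn ?_) hmem
      exact (differentiable_const _).prodMk (differentiable_id.prodMk (differentiable_const _))
    · exact (((pairing k).differentiable.const_mul _).neg.cexp).differentiableOn
  have hJs : ∀ w ∈ angleStrip n A.s, ∀ t : Fin n → ℝ, J (w + (angShift t).2.1) = J w := by
    intro w hw t
    have h1 := fourierInt_add_angShift hper k (hmem w hw) t
    have h2 : ((z.1, w, z.2.2) : Phase n) + angShift t = (z.1, w + (angShift t).2.1, z.2.2) := by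
      refine Prod.ext ?_ (Prod.ext rfl ?_) <;> simp [angShift]
    rw [h2] at h1
    simp only [hJ]
    rw [h1, map_add, mul_add, neg_add, Complex.exp_add]
    have h3 : Complex.exp (Complex.I * pairing k (angShift t).2.1) *
        Complex.exp (-(Complex.I * pairing k (angShift t).2.1)) = 1 := by
      rw [← Complex.exp_add, add_neg_cancel, Complex.exp_zero]
    linear_combination (fourierInt f k (z.1, w, z.2.2) *
      Complex.exp (-(Complex.I * pairing k w))) * h3
  have hopen := isOpen_angleStrip n A.s
  have hfd : EqOn (fderiv ℂ J) 0 (angleStrip n A.s) := by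
    intro w hw
    have hd : HasFDerivAt J (fderiv ℂ J w) w :=
      (hJd.differentiableAt (hopen.mem_nhds hw)).hasFDerivAt
    have hbasis : ∀ j, fderiv ℂ J w (EuclideanSpace.single j 1) = 0 := by
      intro j
      set u : CVec n := (angShift (Pi.single j (1 : ℝ))).2.1 with hu
      have hu' : u = (2 * Real.pi : ℂ) • EuclideanSpace.single j 1 := by
        ext i
        by_cases h : i = j
        · subst h; simp [hu, angShift]
        · simp [hu, angShift, h]
      have hline : HasDerivAt (fun c : ℝ => w + (c : ℂ) • u) u 0 := by
        have := ((Complex.ofRealCLM.hasDerivAt (x := (0 : ℝ))).smul_const u).const_add w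
        simpa using this
      have hd0 : HasFDerivAt J (fderiv ℂ J w) (w + ((0 : ℝ) : ℂ) • u) := by simpa using hd
      have h1 : HasDerivAt (fun c : ℝ => J (w + (c : ℂ) • u)) (fderiv ℂ J w u) 0 := by
        have hd1 : HasFDerivAt J ((fderiv ℂ J w).restrictScalars ℝ) (w + ((0 : ℝ) : ℂ) • u) :=
          hd0.restrictScalars ℝ
        exact hd1.comp_hasDerivAt (0 : ℝ) hline
      have h2 : (fun c : ℝ => J (w + (c : ℂ) • u)) = fun _ => J w := by
        funext c
        rw [← hJs w hw (Pi.single j c)]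
        congr 2
        ext i
        by_cases h : i = j
        · subst h; simp [hu, angShift, mul_comm]
        · simp [hu, angShift, h]
      rw [h2] at h1
      have h3 := h1.unique (hasDerivAt_const (0 : ℝ) (J w))
      rw [hu', map_smul, smul_eq_mul] at h3
      have hpi : (2 * Real.pi : ℂ) ≠ 0 := by exact_mod_cast Real.two_pi_pos.ne'
      exact (mul_eq_zero.1 h3).resolve_left hpi
    ext v
    have hv : v = ∑ j, v j • (EuclideanSpace.single j 1 : CVec n) := by
      ext i
      simp [Finset.sum_apply, Pi.single_apply]
    rw [hv, map_sum]
    simp only [map_smul, hbasis, smul_zero, Finset.sum_const_zero]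
    rfl
  have hconv : Convex ℝ (angleStrip n A.s) := by
    have : angleStrip n A.s = ⋂ j, (fun w : CVec n => (w j).im) ⁻¹' Ioo (-A.s) A.s := by
      ext w; simp [angleStrip, abs_lt]
    rw [this]
    refine convex_iInter fun j => (convex_Ioo _ _).is_linear_preimage ?_
    exact ⟨fun x y => by simp, fun c x => by simp⟩
  have h0 : (0 : CVec n) ∈ angleStrip n A.s := fun j => by simpa using A.hs
  have := hopen.is_const_of_fderiv_eq_zero hconv.isPreconnected hJd hfd hz2 h0
  simp only [hJ, map_zero, mul_zero, neg_zero, Complex.exp_zero, mul_one] at this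
  rw [← this, mul_assoc, ← Complex.exp_add, neg_add_cancel, Complex.exp_zero, mul_one]

omit hper

/-- The exponential decay of the Fourier coefficients. -/
theorem norm_fourierInt_zero_le (hper : AngPeriodic A f) (k : Fin n → ℤ) {I : CVec n} {ξ : ℂ}
    (hI : I ∈ ball A.c A.r) (hξ : ξ ∈ timeStrip A.s) {s : ℝ} (hs0 : 0 ≤ s) (hs : s < A.s) :
    ‖fourierInt f k (I, 0, ξ)‖ ≤ C * Real.exp (-(s * l1 k)) := by
  set w : CVec n := WithLp.toLp 2 fun j => -(Complex.I * ((s * (SignType.sign (k j) : ℤ) : ℝ) : ℂ))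
    with hw
  have hwm : ((I, w, ξ) : Phase n) ∈ A.dom := by
    refine A.mem_dom.2 ⟨hI, fun j => ?_, hξ⟩
    have : (w j).im = -(s * (SignType.sign (k j) : ℤ)) := by
      simp only [hw, Complex.neg_im, Complex.mul_im, Complex.I_re, Complex.I_im,
        Complex.ofReal_re, Complex.ofReal_im]
      ring
    simp only [this, abs_neg, abs_mul, abs_of_nonneg hs0]
    refine lt_of_le_of_lt (mul_le_of_le_one_right hs0 ?_) hs
    rcases lt_trichotomy (k j) 0 with h | h | h
    · simp [sign_neg h]
    · simp [h]
    · simp [sign_pos h]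
  have h1 := fourierInt_eq hf hC hper k hwm
  have h2 := norm_fourierInt_le hC k hwm
  have h3 : ‖Complex.exp (Complex.I * pairing k w)‖ = Real.exp (s * l1 k) := by
    rw [Complex.norm_exp, pairing_apply, l1_cast]
    congr 1
    rw [Finset.mul_sum, Finset.mul_sum, Complex.re_sum]
    refine Finset.sum_congr rfl fun j _ => ?_
    have : Complex.I * ((k j : ℂ) * w j) =
        ((s * ((k j : ℝ) * ((SignType.sign (k j) : ℤ) : ℝ)) : ℝ) : ℂ) := by
      simp only [hw]
      generalize (SignType.sign (k j) : ℤ) = q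
      push_cast
      linear_combination (-(k j : ℂ) * s * q) * Complex.I_mul_I
    rw [this, Complex.ofReal_re]
    congr 1
    have h := self_mul_sign (k j)
    rw [← Int.cast_abs, ← h]
    push_cast
    rfl
  rw [h1, norm_mul, h3] at h2
  rw [Real.exp_neg, ← div_eq_mul_inv, le_div_iff₀ (Real.exp_pos _)]
  exact h2

/-- The Fourier series on the complex domain. -/
theorem hasSum_fourierInt (hper : AngPeriodic A f) {z : Phase n} (hz : z ∈ A.dom)
    (hsum : Summable fun k => ‖fourierInt f k (z.1, 0, z.2.2) *
      Complex.exp (Complex.I * pairing k z.2.1)‖) :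
    HasSum (fun k => fourierInt f k (z.1, 0, z.2.2) *
      Complex.exp (Complex.I * pairing k z.2.1)) (f z) := by
  let g : C(UnitAddTorus (Fin n), ℂ) := ⟨_, continuous_lift hf hper hz⟩
  have hcoef : ∀ k, UnitAddTorus.mFourierCoeff g k = fourierInt f k (z.1, 0, z.2.2) *
      Complex.exp (Complex.I * pairing k z.2.1) := by
    intro k
    rw [← fourierInt_eq hf hC hper k hz]
    rfl
  have h1 : Summable (UnitAddTorus.mFourierCoeff g) := by
    rw [funext hcoef]
    exact hsum.of_norm
  have h2 := UnitAddTorus.hasSum_mFourier_series_apply_of_summable h1 (toTorus 0)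
  have h3 : angShift (0 : Fin n → ℝ) = 0 := by
    refine Prod.ext rfl (Prod.ext ?_ rfl)
    ext j
    simp [angShift]
  have h4 : g (toTorus 0) = f z := by
    change f (z + angShift (torusRep (toTorus 0))) = f z
    rw [hper.toTorus hz, h3, add_zero]
  rw [h4] at h2
  refine h2.congr_fun fun k => ?_
  rw [hcoef, mFourier_toTorus, h3]
  simp

end

end

end AperiodicNekhoroshev

namespace AperiodicNekhoroshev

noncomputable section

open Metric Set Filter Topology

variable {n : ℕ}

theorem summable_exp_l1 {c : ℝ} (hc : 0 < c) :
    Summable fun k : Fin n → ℤ => Real.exp (-(c * l1 k)) := by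
  have h1 : Summable fun m : ℤ => Real.exp (-(c * |(m : ℝ)|)) := by
    have h0 : Summable fun m : ℕ => Real.exp (-(c * m)) := by
      have : ∀ m : ℕ, Real.exp (-(c * m)) = Real.exp (-c) ^ m := fun m => by
        rw [← Real.exp_nat_mul]; congr 1; ring
      simp only [this]
      exact summable_geometric_of_lt_one (Real.exp_pos _).le (Real.exp_lt_one_iff.2 (by linarith))
    refine Summable.of_nat_of_neg ?_ ?_
    · simpa using h0
    · simpa using h0
  refine summable_of_sum_le (c := (∑' m : ℤ, Real.exp (-(c * |(m : ℝ)|))) ^ n)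
    (fun _ => (Real.exp_pos _).le) fun u => ?_
  have h2 : u ⊆ Fintype.piFinset fun j => u.image fun k => k j := by
    intro k hk
    rw [Fintype.mem_piFinset]
    exact fun j => Finset.mem_image_of_mem _ hk
  have h3 : ∀ k : Fin n → ℤ, Real.exp (-(c * l1 k)) = ∏ j, Real.exp (-(c * |(k j : ℝ)|)) := by
    intro k
    rw [← Real.exp_sum, l1_cast, Finset.mul_sum, Finset.sum_neg_distrib]
  calc _ ≤ ∑ k ∈ Fintype.piFinset fun j => u.image fun k : Fin n → ℤ => k j,
        ∏ j, Real.exp (-(c * |(k j : ℝ)|)) := by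
        simp only [h3]
        exact Finset.sum_le_sum_of_subset_of_nonneg h2 fun k _ _ =>
          Finset.prod_nonneg fun j _ => (Real.exp_pos _).le
    _ = ∏ j : Fin n, ∑ m ∈ u.image fun k : Fin n → ℤ => k j, Real.exp (-(c * |(m : ℝ)|)) :=
        (Finset.prod_univ_sum (fun j => u.image fun k : Fin n → ℤ => k j)
          fun _ (m : ℤ) => Real.exp (-(c * |(m : ℝ)|))).symm
    _ ≤ ∏ _j : Fin n, ∑' m : ℤ, Real.exp (-(c * |(m : ℝ)|)) :=
        Finset.prod_le_prod (fun j _ => Finset.sum_nonneg fun m _ => (Real.exp_pos _).le)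
          fun j _ => h1.sum_le_tsum _ fun m _ => (Real.exp_pos _).le
    _ = _ := by simp

/-- The sum of `e^{-σ |k|₁ / 2}` over all integer vectors. -/
def expSum (n : ℕ) (σ : ℝ) : ℝ := ∑' k : Fin n → ℤ, Real.exp (-(σ / 2 * l1 k))

theorem expSum_nonneg (n : ℕ) (σ : ℝ) : 0 ≤ expSum n σ :=
  tsum_nonneg fun _ => (Real.exp_pos _).le

/-- The integer vectors with `|k|₁ ≤ s K` (none for `s = 0`). -/
def box (n K s : ℕ) : Finset (Fin n → ℤ) :=
  if s = 0 then ∅ else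
    (Fintype.piFinset fun _ : Fin n => Finset.Icc (-((s * K : ℕ) : ℤ)) ((s * K : ℕ) : ℤ)).filter
      fun k => l1 k ≤ s * K

theorem mem_box {K s : ℕ} {k : Fin n → ℤ} : k ∈ box n K s ↔ s ≠ 0 ∧ l1 k ≤ s * K := by
  rw [box]
  split_ifs with h
  · simp [h]
  · simp only [Finset.mem_filter, Fintype.mem_piFinset, Finset.mem_Icc, ne_eq, h,
      not_false_eq_true, true_and, and_iff_right_iff_imp]
    intro hk j
    have := (Frame.natAbs_le_l1 k j).trans hk
    omega

theorem box_mono {K s : ℕ} : box n K s ⊆ box n K (s + 1) := fun k hk => by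
  rw [mem_box] at hk ⊢
  exact ⟨by omega, hk.2.trans (Nat.mul_le_mul_right _ (Nat.le_succ s))⟩

/-- The integer vectors of the shell `(s - 1) K < |k|₁ ≤ s K` (including `0` for `s = 1`). -/
def shell (n K s : ℕ) : Finset (Fin n → ℤ) := box n K s \ box n K (s - 1)

theorem le_l1_of_mem_shell {K s : ℕ} {k : Fin n → ℤ} (hk : k ∈ shell n K s) :
    (s - 1) * K ≤ l1 k := by
  rw [shell, Finset.mem_sdiff, mem_box, mem_box] at hk
  by_contra h
  rcases Nat.eq_zero_or_pos (s - 1) with h0 | h0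
  · simp [h0] at h
  · exact hk.2 ⟨h0.ne', by omega⟩

theorem sum_shell {α : Type*} [AddCommMonoid α] (a : (Fin n → ℤ) → α) (K N : ℕ) :
    ∑ s ∈ Finset.Icc 1 N, ∑ k ∈ shell n K s, a k = ∑ k ∈ box n K N, a k := by
  induction N with
  | zero => simp [box]
  | succ N ih =>
    rw [Finset.sum_Icc_succ_top (by omega), ih, shell, Nat.add_sub_cancel, add_comm,
      Finset.sum_sdiff box_mono]

theorem norm_exp_pairing_le {φ : CVec n} {s : ℝ} (hφ : φ ∈ angleStrip n s) (k : Fin n → ℤ) :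
    ‖Complex.exp (Complex.I * pairing k φ)‖ ≤ Real.exp (s * l1 k) := by
  rw [Complex.norm_exp, pairing_apply, l1_cast]
  refine Real.exp_le_exp.2 ?_
  rw [Finset.mul_sum, Finset.mul_sum, Complex.re_sum]
  refine Finset.sum_le_sum fun j _ => ?_
  have h1 : (Complex.I * ((k j : ℂ) * φ j)).re = -((k j : ℝ) * (φ j).im) := by
    simp [Complex.mul_re, Complex.mul_im]
  rw [h1]
  refine (neg_le_abs _).trans ?_
  rw [abs_mul, mul_comm]
  exact mul_le_mul_of_nonneg_right (hφ j).le (abs_nonneg _)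

/-- Approximation by trigonometric polynomials: the harmonics of the `s`-th shell are of size
`(1 / 16)^(s - 1)`, and what is left after `N` shells is exponentially small. -/
theorem exists_trig_approx (A : Frame n) {f : Phase n → ℂ} (hf : DifferentiableOn ℂ f A.dom)
    {C : ℝ} (hC : ∀ x ∈ A.dom, ‖f x‖ ≤ C) (hper : AngPeriodic A f) {σ : ℝ} (hσ : 0 < σ)
    (hA : A.s = 2 * σ) (hC0 : 0 ≤ C) (hK : Real.exp (-(σ / 2 * A.K)) ≤ 1 / 16) :
    ∃ F : ℕ → Hol A.dom,
      (∀ s, 1 ≤ s → s ≤ A.N → A.IsTrig s (C * expSum n σ * (1 / 16) ^ (s - 1)) (F s)) ∧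
      ∀ x ∈ A.dom, x.2.1 ∈ angleStrip n (σ / 2) →
        ‖f x - ∑ s ∈ Finset.Icc 1 A.N, (F s).fn x‖ ≤ C * expSum n σ * (1 / 2) ^ A.N := by
  have hpow : ∀ (s l : ℕ), s * A.K ≤ l → Real.exp (-(σ / 2 * l)) ≤ (1 / 16) ^ s := by
    intro s l h
    calc Real.exp (-(σ / 2 * l)) ≤ Real.exp (-(σ / 2 * A.K)) ^ s := by
          rw [← Real.exp_nat_mul]
          refine Real.exp_le_exp.2 ?_
          have : (s : ℝ) * A.K ≤ l := by exact_mod_cast h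
          nlinarith
      _ ≤ _ := pow_le_pow_left₀ (Real.exp_pos _).le hK _
  have hsum := summable_exp_l1 (n := n) (c := σ / 2) (by positivity)
  have hg : ∀ k, DifferentiableOn ℂ (fun y : CVec n × ℂ => fourierInt f k (y.1, 0, y.2))
      (A.U 0) := by
    intro k
    refine DifferentiableOn.comp (g := fourierInt f k) (f := fun y : CVec n × ℂ => (y.1, 0, y.2))
      (differentiableOn_fourierInt hf hC k) (Differentiable.differentiableOn ?_) ?_
    · exact differentiable_fst.prodMk ((differentiable_const _).prodMk differentiable_snd)
    · intro y hy
      refine A.mem_dom.2 ⟨by simpa using hy.1, fun j => by simpa using A.hs, ?_⟩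
      have := hy.2
      simpa [timeStrip] using this
  have hdecay : ∀ k, ∀ y ∈ A.U 0, ‖fourierInt f k (y.1, 0, y.2)‖ ≤
      C * Real.exp (-(3 * σ / 2 * l1 k)) := by
    intro k y hy
    have h1 := hy.1
    have h2 := hy.2
    simp only [Nat.cast_zero, zero_div, sub_zero, mul_one] at h1 h2
    exact norm_fourierInt_zero_le hf hC hper k h1 h2 (by positivity) (by rw [hA]; linarith)
  refine ⟨fun s => ∑ k ∈ shell n A.K s, Frame.atom _ k (hg k), fun s hs hsN => ?_,
    fun x hx hxφ => ?_⟩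
  · refine (Frame.isTrig_sum (C := fun k => C * (1 / 16) ^ (s - 1) * Real.exp (-(σ / 2 * l1 k)))
      fun k hk => ?_).mono le_rfl ?_
    · refine Frame.isTrig_atom (hg k) (mem_box.1 (Finset.mem_sdiff.1 hk).1).2 (by positivity)
        fun y hy => (hdecay k y (A.U_mono (Nat.zero_le s) hy)).trans ?_
      have h1 := hpow _ _ (le_l1_of_mem_shell hk)
      rw [mul_assoc]
      refine mul_le_mul_of_nonneg_left ?_ hC0
      calc _ ≤ Real.exp (-(σ / 2 * l1 k)) * Real.exp (-(σ / 2 * l1 k)) := by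
            rw [← Real.exp_add]
            refine Real.exp_le_exp.2 ?_
            have : 0 ≤ σ * (l1 k : ℝ) := by positivity
            linarith
        _ ≤ _ := mul_le_mul_of_nonneg_right h1 (Real.exp_pos _).le
    · rw [← Finset.mul_sum]
      calc _ ≤ C * (1 / 16) ^ (s - 1) * expSum n σ := by
            refine mul_le_mul_of_nonneg_left ?_ (by positivity)
            exact hsum.sum_le_tsum _ fun k _ => (Real.exp_pos _).le
        _ = _ := by ring
  -- the tail
  set t : (Fin n → ℤ) → ℂ := fun k => fourierInt f k (x.1, 0, x.2.2) *
    Complex.exp (Complex.I * pairing k x.2.1) with ht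
  have htb : ∀ k, ‖t k‖ ≤ C * (Real.exp (-(σ / 2 * l1 k)) * Real.exp (-(σ / 2 * l1 k))) := by
    intro k
    rw [ht, norm_mul]
    calc _ ≤ C * Real.exp (-(3 * σ / 2 * l1 k)) * Real.exp (σ / 2 * l1 k) :=
          mul_le_mul (hdecay k _ (A.mem_U_zero hx)) (norm_exp_pairing_le hxφ k) (norm_nonneg _)
            (by positivity)
      _ = _ := by
          rw [mul_assoc, ← Real.exp_add, ← Real.exp_add]
          congr 2
          ring
  have hts : Summable fun k => ‖t k‖ := by
    refine Summable.of_nonneg_of_le (fun _ => norm_nonneg _) (fun k => (htb k).trans ?_)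
      (hsum.mul_left C)
    refine mul_le_mul_of_nonneg_left (mul_le_of_le_one_left (Real.exp_pos _).le ?_) hC0
    exact Real.exp_le_one_iff.2 (neg_nonpos.2 (by positivity))
  have h1 := hasSum_fourierInt hf hC hper hx hts
  have h2 : ∑ s ∈ Finset.Icc 1 A.N,
      (∑ k ∈ shell n A.K s, Frame.atom _ k (hg k) : Hol A.dom).fn x = ∑ k ∈ box n A.K A.N, t k := by
    rw [← sum_shell]
    refine Finset.sum_congr rfl fun s _ => ?_
    rw [Hol.fn_sum, Finset.sum_apply]
    exact Finset.sum_congr rfl fun k _ => Frame.fn_atom hx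
  have h3 : HasSum (fun k => t k - if k ∈ box n A.K A.N then t k else 0)
      (f x - ∑ k ∈ box n A.K A.N, t k) := by
    refine h1.sub ?_
    have := hasSum_sum_of_ne_finset_zero (f := fun k => if k ∈ box n A.K A.N then t k else 0)
      (s := box n A.K A.N) (L := SummationFilter.unconditional _) fun k hk => if_neg hk
    rwa [Finset.sum_congr rfl fun k hk => if_pos hk] at this
  rw [h2]
  have h4 : HasSum (fun k : Fin n → ℤ => C * (1 / 2) ^ A.N * Real.exp (-(σ / 2 * l1 k)))
      (C * (1 / 2) ^ A.N * expSum n σ) := hsum.hasSum.mul_left _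
  refine (h3.norm_le_of_bounded h4 fun k => ?_).trans (le_of_eq (by ring))
  split_ifs with h
  · rw [sub_self, norm_zero]
    positivity
  · rw [sub_zero]
    refine (htb k).trans ?_
    rw [mul_assoc]
    refine mul_le_mul_of_nonneg_left (mul_le_mul_of_nonneg_right ?_ (Real.exp_pos _).le) hC0
    have h5 : A.N * A.K ≤ l1 k := by
      rw [mem_box] at h
      have := A.hN
      by_contra h6
      exact h ⟨by omega, by omega⟩
    exact (hpow _ _ h5).trans (pow_le_pow_left₀ (by norm_num) (by norm_num) _)

end

end AperiodicNekhoroshev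

namespace AperiodicNekhoroshev

noncomputable section

open Set Filter Topology

/-! ### The geometry of resonances -/

/-- The Gram determinant of a family and one more vector `x`, in terms of the component of `x`
orthogonal to the span of the family. -/
theorem exists_det_gram_sum_eq {F : Type*} [NormedAddCommGroup F] [InnerProductSpace ℝ F]
    {ι : Type} [Fintype ι] [DecidableEq ι] (v : ι → F) (h : (Matrix.gram ℝ v).det ≠ 0) (x : F) :
    ∃ p ∈ Submodule.span ℝ (range v), (∀ y ∈ Submodule.span ℝ (range v), inner ℝ y (x - p) = 0) ∧
      (Matrix.gram ℝ (Sum.elim v fun _ : Unit => x)).det =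
        (Matrix.gram ℝ v).det * ‖x - p‖ ^ 2 := by
  set A := Matrix.gram ℝ v with hA
  set b : ι → ℝ := fun i => inner ℝ (v i) x with hb
  set c : ι → ℝ := A⁻¹.mulVec b with hc
  have hunit : IsUnit A.det := isUnit_iff_ne_zero.2 h
  have hAc : A.mulVec c = b := by
    rw [hc, Matrix.mulVec_mulVec, Matrix.mul_nonsing_inv _ hunit, Matrix.one_mulVec]
  set p : F := ∑ i, c i • v i with hp
  have hpm : p ∈ Submodule.span ℝ (range v) := Submodule.sum_mem _ fun i _ =>
    Submodule.smul_mem _ _ (Submodule.subset_span ⟨i, rfl⟩)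
  have horth : ∀ i, inner ℝ (v i) (x - p) = 0 := by
    intro i
    have : inner ℝ (v i) p = A.mulVec c i := by
      rw [hp, inner_sum, Matrix.mulVec, dotProduct]
      refine Finset.sum_congr rfl fun j _ => ?_
      rw [inner_smul_right, hA, Matrix.gram_apply, mul_comm]
    rw [inner_sub_right, this, hAc, sub_self]
  have hall : ∀ y ∈ Submodule.span ℝ (range v), inner ℝ y (x - p) = 0 := by
    intro y hy
    induction hy using Submodule.span_induction with
    | mem y hy => obtain ⟨i, rfl⟩ := hy; exact horth i
    | zero => exact inner_zero_left _
    | add y z _ _ h1 h2 => rw [inner_add_left, h1, h2, add_zero]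
    | smul a y _ h1 => rw [inner_smul_left, h1, mul_zero]
  refine ⟨p, hpm, hall, ?_⟩
  have hblock : Matrix.gram ℝ (Sum.elim v fun _ : Unit => x) =
      Matrix.fromBlocks A (Matrix.of fun i (_ : Unit) => b i) (Matrix.of fun (_ : Unit) i => b i)
        (Matrix.of fun (_ _ : Unit) => inner ℝ x x) := by
    ext i j
    rcases i with i | i <;> rcases j with j | j
    · rfl
    · rfl
    · simp [Matrix.gram_apply, hb, real_inner_comm]
    · rfl
  let _ := Matrix.invertibleOfIsUnitDet A hunit
  rw [hblock, Matrix.det_fromBlocks₁₁, Matrix.det_unique (n := Unit)]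
  congr 1
  have h1 : ‖x - p‖ ^ 2 = inner ℝ x x - ∑ i, b i * c i := by
    rw [← real_inner_self_eq_norm_sq, inner_sub_left, hall p hpm, sub_zero, inner_sub_right]
    congr 1
    rw [hp, inner_sum]
    refine Finset.sum_congr rfl fun i _ => ?_
    rw [inner_smul_right, hb, real_inner_comm, mul_comm]
  rw [h1, Matrix.sub_apply]
  congr 1
  rw [Matrix.mul_assoc, Matrix.mul_apply]
  refine Finset.sum_congr rfl fun i _ => ?_
  rw [Matrix.mul_apply, hc, Matrix.mulVec, dotProduct, Matrix.invOf_eq_nonsing_inv]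
  rfl

variable {n : ℕ}

/-- The integer vector `k` as a vector of `ℝⁿ`. -/
def intVecR (k : Fin n → ℤ) : RVec n := WithLp.toLp 2 fun j => (k j : ℝ)

theorem norm_intVecR_le (k : Fin n → ℤ) : ‖intVecR k‖ ≤ l1 k := by
  have h : intVecR k = ∑ j, (k j : ℝ) • (EuclideanSpace.single j 1 : RVec n) := by
    ext i
    simp [intVecR, Finset.sum_apply, Pi.single_apply]
  rw [h, l1_cast]
  refine (norm_sum_le _ _).trans (Finset.sum_le_sum fun j _ => ?_)
  rw [norm_smul]
  simp

theorem inner_intVecR (k l : Fin n → ℤ) :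
    inner ℝ (intVecR k) (intVecR l) = ((∑ j, k j * l j : ℤ) : ℝ) := by
  simp [intVecR, PiLp.inner_apply, mul_comm]

/-- The Gram determinant of integer vectors is at least `1` if it does not vanish. -/
theorem one_le_det_gram_intVecR {ι : Type} [Fintype ι] [DecidableEq ι] (k : ι → Fin n → ℤ)
    (h : (Matrix.gram ℝ fun i => intVecR (k i)).det ≠ 0) :
    1 ≤ (Matrix.gram ℝ fun i => intVecR (k i)).det := by
  have h0 : 0 ≤ (Matrix.gram ℝ fun i => intVecR (k i)).det :=
    (Matrix.posSemidef_gram ℝ _).det_nonneg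
  have h1 : Matrix.gram ℝ (fun i => intVecR (k i)) =
      (Matrix.of fun i j => ∑ l, k i l * k j l : Matrix ι ι ℤ).map (Int.cast : ℤ → ℝ) := by
    ext i j
    rw [Matrix.gram_apply, inner_intVecR]
    rfl
  rw [h1, ← Int.cast_det] at h h0 ⊢
  have h2 : (0 : ℤ) ≤ (Matrix.of fun i j => ∑ l, k i l * k j l : Matrix ι ι ℤ).det := by
    exact_mod_cast h0
  have h3 : (Matrix.of fun i j => ∑ l, k i l * k j l : Matrix ι ι ℤ).det ≠ 0 := by
    exact_mod_cast h
  exact_mod_cast (show (1 : ℤ) ≤ _ by omega)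

/-- `E` is spanned by `j` independent integer vectors with `|k|₁ ≤ K`. -/
def IsIntSpan (K j : ℕ) (E : Submodule ℝ (RVec n)) : Prop :=
  ∃ (ι : Type) (_ : Fintype ι) (_ : DecidableEq ι) (k : ι → Fin n → ℤ), Fintype.card ι = j ∧
    (∀ i, l1 (k i) ≤ K) ∧ (Matrix.gram ℝ fun i => intVecR (k i)).det ≠ 0 ∧
    (Matrix.gram ℝ fun i => intVecR (k i)).det ≤ (K : ℝ) ^ (2 * j) ∧
    Submodule.span ℝ (range fun i => intVecR (k i)) = E

theorem isIntSpan_bot (K : ℕ) : IsIntSpan K 0 (⊥ : Submodule ℝ (RVec n)) :=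
  ⟨Empty, inferInstance, inferInstance, Empty.elim, rfl, fun i => i.elim, by simp, by simp,
    by simp⟩

theorem IsIntSpan.finrank_eq {K j : ℕ} {E : Submodule ℝ (RVec n)} (h : IsIntSpan K j E) :
    Module.finrank ℝ E = j := by
  obtain ⟨ι, _, _, k, hj, -, h1, -, rfl⟩ := h
  rw [finrank_span_eq_card (Matrix.linearIndependent_of_det_gram_ne_zero h1), hj]

/-- A further integer vector `k`: its component orthogonal to `E` is bounded from below, and `E`
together with `k` is again spanned by integer vectors. -/
theorem IsIntSpan.extend {K j : ℕ} {E : Submodule ℝ (RVec n)} (h : IsIntSpan K j E)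
    {k : Fin n → ℤ} (hk : l1 k ≤ K) (hkE : intVecR k ∉ E) :
    ∃ p ∈ E, (∀ y ∈ E, inner ℝ y (intVecR k - p) = 0) ∧ 1 ≤ (K : ℝ) ^ j * ‖intVecR k - p‖ ∧
      IsIntSpan K (j + 1) (E ⊔ Submodule.span ℝ {intVecR k}) := by
  obtain ⟨ι, _, _, l, hj, hl, h1, h2, rfl⟩ := h
  obtain ⟨p, hp, horth, hdet⟩ := exists_det_gram_sum_eq (fun i => intVecR (l i)) h1 (intVecR k)
  have hne : intVecR k - p ≠ 0 := fun h0 => hkE (by rwa [sub_eq_zero.1 h0])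
  have hG : (fun i => intVecR (Sum.elim l (fun _ : Unit => k) i)) =
      Sum.elim (fun i => intVecR (l i)) fun _ : Unit => intVecR k := by
    funext i; cases i <;> rfl
  have h3 : (Matrix.gram ℝ fun i => intVecR (Sum.elim l (fun _ : Unit => k) i)).det ≠ 0 := by
    rw [hG, hdet]
    exact mul_ne_zero h1 (pow_ne_zero 2 (norm_ne_zero_iff.2 hne))
  have h4 := one_le_det_gram_intVecR _ h3
  have h5 := one_le_det_gram_intVecR _ h1
  have hle : ‖intVecR k - p‖ ≤ K := by
    have e1 : ‖intVecR k‖ ^ 2 = ‖intVecR k - p‖ ^ 2 + ‖p‖ ^ 2 := by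
      have := norm_add_sq_eq_norm_sq_add_norm_sq_real (x := p) (y := intVecR k - p) (horth p hp)
      rw [add_sub_cancel] at this
      nlinarith
    have e2 : ‖intVecR k‖ ≤ K := (norm_intVecR_le k).trans (by exact_mod_cast hk)
    nlinarith [norm_nonneg (intVecR k - p), norm_nonneg p, norm_nonneg (intVecR k)]
  refine ⟨p, hp, horth, ?_, ι ⊕ Unit, inferInstance, inferInstance, Sum.elim l fun _ => k, ?_, ?_,
    h3, ?_, ?_⟩
  · rw [hG, hdet] at h4
    have e1 : (1 : ℝ) ≤ ((K : ℝ) ^ j * ‖intVecR k - p‖) ^ 2 := by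
      refine h4.trans ?_
      rw [mul_pow, ← pow_mul, mul_comm j 2]
      exact mul_le_mul_of_nonneg_right h2 (by positivity)
    exact (one_le_sq_iff₀ (by positivity)).1 e1
  · simp [hj]
  · rintro (i | i)
    · exact hl i
    · exact hk
  · rw [hG, hdet]
    calc _ ≤ (K : ℝ) ^ (2 * j) * K ^ 2 := by gcongr
      _ = _ := by ring
  · rw [hG, Sum.elim_range, Submodule.span_union]
    congr 2
    ext y
    simp

/-- **Resonant blocks.** Given linear forms `L t` (the frequencies along an orbit), there are a time
`t₀` and a subspace `E` such that `L t₀` is nonresonant outside `E`, and `L t` is resonant with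
respect to `E` at every time `t` at which it is also, more weakly, nonresonant outside `E`. The
dimension `j` of `E` is such that there are resonances of dimension `j` at all times, but not of
dimension `j + 1`. -/
theorem exists_resonant_block {T : Type*} [Nonempty T] (L : T → RVec n →ₗ[ℝ] ℝ) {K : ℕ} {δ : ℕ → ℝ}
    (hδ : ∀ j, 4 * (K : ℝ) ^ (j + 1) * δ j ≤ δ (j + 1)) (hδn : ∀ j, 0 ≤ δ j) :
    ∃ j ≤ n, ∃ (t₀ : T) (E : Submodule ℝ (RVec n)),
      (∀ k : Fin n → ℤ, l1 k ≤ K → intVecR k ∉ E →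
        δ (j + 1) / (2 * (K : ℝ) ^ j) ≤ |L t₀ (intVecR k)|) ∧
      ∀ t, (∀ k : Fin n → ℤ, l1 k ≤ K → intVecR k ∉ E → K * δ j < |L t (intVecR k)|) →
        ∀ v ∈ E, |L t v| ≤ δ j * ‖v‖ := by
  classical
  let Res : ℕ → T → Prop := fun j t => ∃ E, IsIntSpan K j E ∧ ∀ v ∈ E, |L t v| ≤ δ j * ‖v‖
  have hex : ∃ j, ¬ ∀ t, Res j t := by
    refine ⟨n + 1, fun h => ?_⟩
    obtain ⟨E, hE, -⟩ := h (Classical.arbitrary T)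
    have := Submodule.finrank_le E
    rw [hE.finrank_eq, finrank_euclideanSpace_fin] at this
    omega
  have h0 : ∀ t, Res 0 t := fun t => ⟨⊥, isIntSpan_bot K, fun v hv => by
    rw [(Submodule.mem_bot ℝ).1 hv]; simp⟩
  obtain ⟨j, hj⟩ : ∃ j, Nat.find hex = j + 1 := Nat.exists_eq_succ_of_ne_zero fun h => by
    have := Nat.find_spec hex
    rw [h] at this
    exact this h0
  have hjall : ∀ t, Res j t := by
    have := Nat.find_min hex (m := j) (by omega)
    rwa [not_not] at this
  have hjn : ¬ ∀ t, Res (j + 1) t := by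
    have := Nat.find_spec hex
    rwa [hj] at this
  push Not at hjn
  obtain ⟨t₀, ht₀⟩ := hjn
  obtain ⟨E, hE, hEδ⟩ := hjall t₀
  refine ⟨j, ?_, t₀, E, fun k hk hkE => ?_, fun t ht => ?_⟩
  · have := Submodule.finrank_le E
    rwa [hE.finrank_eq, finrank_euclideanSpace_fin] at this
  · obtain ⟨p, hp, horth, hdist, hE'⟩ := hE.extend hk hkE
    have hK0 : 0 < (K : ℝ) ^ j := by
      by_contra h
      have : (K : ℝ) ^ j = 0 := le_antisymm (not_lt.1 h) (by positivity)
      rw [this, zero_mul] at hdist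
      linarith
    by_contra hlt
    rw [not_le] at hlt
    refine ht₀ ⟨_, hE', fun v hv => ?_⟩
    obtain ⟨a, ha, y, hy, rfl⟩ := Submodule.mem_sup.1 hv
    obtain ⟨c, rfl⟩ := Submodule.mem_span_singleton.1 hy
    have hdec : a + c • intVecR k = (a + c • p) + c • (intVecR k - p) := by
      rw [smul_sub]; abel
    have hEa : a + c • p ∈ E := E.add_mem ha (E.smul_mem c hp)
    have hpyth : ‖a + c • intVecR k‖ ^ 2 = ‖a + c • p‖ ^ 2 + (|c| * ‖intVecR k - p‖) ^ 2 := by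
      have := norm_add_sq_eq_norm_sq_add_norm_sq_real (x := a + c • p)
        (y := c • (intVecR k - p)) (by rw [inner_smul_right, horth _ hEa, mul_zero])
      rw [← hdec, norm_smul, Real.norm_eq_abs] at this
      nlinarith
    set V := ‖a + c • intVecR k‖ with hV
    have hV0 : 0 ≤ V := norm_nonneg _
    have n1 : ‖a + c • p‖ ≤ V := by
      nlinarith [norm_nonneg (a + c • p), sq_nonneg (|c| * ‖intVecR k - p‖)]
    have n2 : |c| * ‖intVecR k - p‖ ≤ V := by
      have : 0 ≤ |c| * ‖intVecR k - p‖ := by positivity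
      nlinarith [sq_nonneg ‖a + c • p‖]
    have n3 : |c| ≤ (K : ℝ) ^ j * V := by
      calc |c| = |c| * 1 := (mul_one _).symm
        _ ≤ |c| * ((K : ℝ) ^ j * ‖intVecR k - p‖) := by gcongr
        _ = (K : ℝ) ^ j * (|c| * ‖intVecR k - p‖) := by ring
        _ ≤ _ := by gcongr
    have hkK : ‖intVecR k‖ ≤ K := (norm_intVecR_le k).trans (by exact_mod_cast hk)
    have n4 : ‖p‖ ≤ K := by
      have := norm_add_sq_eq_norm_sq_add_norm_sq_real (x := p) (y := intVecR k - p) (horth p hp)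
      rw [add_sub_cancel] at this
      nlinarith [norm_nonneg p, norm_nonneg (intVecR k), norm_nonneg (intVecR k - p)]
    have l1' : |L t₀ (intVecR k - p)| ≤ δ (j + 1) / (2 * (K : ℝ) ^ j) + K * δ j := by
      rw [map_sub]
      refine (abs_sub _ _).trans (add_le_add hlt.le ((hEδ p hp).trans ?_))
      rw [mul_comm]
      exact mul_le_mul_of_nonneg_right n4 (hδn j)
    calc |L t₀ (a + c • intVecR k)| = |L t₀ (a + c • p) + c * L t₀ (intVecR k - p)| := by
          rw [hdec, map_add, map_smul, smul_eq_mul]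
      _ ≤ |L t₀ (a + c • p)| + |c| * |L t₀ (intVecR k - p)| := by
          rw [← abs_mul]
          exact abs_add_le _ _
      _ ≤ δ j * V + (K : ℝ) ^ j * V * (δ (j + 1) / (2 * (K : ℝ) ^ j) + K * δ j) := by
          refine add_le_add ((hEδ _ hEa).trans (mul_le_mul_of_nonneg_left n1 (hδn j))) ?_
          exact mul_le_mul n3 l1' (abs_nonneg _) (by positivity)
      _ = V * (δ j + δ (j + 1) / 2 + (K : ℝ) ^ (j + 1) * δ j) := by
          field_simp
          ring
      _ ≤ V * δ (j + 1) := by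
          refine mul_le_mul_of_nonneg_left ?_ hV0
          have h1 := hδ j
          have h2 : δ j ≤ (K : ℝ) ^ (j + 1) * δ j := by
            refine le_mul_of_one_le_left (hδn j) (one_le_pow₀ ?_)
            have : K ≠ 0 := by
              rintro rfl
              have hk0 : intVecR k = 0 := by
                have := hkK
                rw [Nat.cast_zero] at this
                exact norm_le_zero_iff.1 this
              exact hkE (hk0 ▸ E.zero_mem)
            exact_mod_cast Nat.one_le_iff_ne_zero.2 this
          linarith
      _ = δ (j + 1) * V := mul_comm _ _
  · obtain ⟨E', hE', hE'δ⟩ := hjall t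
    have hle : E' ≤ E := by
      obtain ⟨ι, _, _, l, -, hl, -, -, hspan⟩ := hE'
      rw [← hspan, Submodule.span_le]
      rintro _ ⟨i, rfl⟩
      by_contra hi
      have h1 := ht (l i) (hl i) hi
      have h2 := hE'δ (intVecR (l i)) (by rw [← hspan]; exact Submodule.subset_span ⟨i, rfl⟩)
      have h3 : ‖intVecR (l i)‖ ≤ K := (norm_intVecR_le _).trans (by exact_mod_cast hl i)
      have := mul_le_mul_of_nonneg_left h3 (hδn j)
      linarith
    have heq : E' = E := Submodule.eq_of_le_of_finrank_eq hle
      (by rw [hE'.finrank_eq, hE.finrank_eq])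
    rwa [← heq]

end

end AperiodicNekhoroshev

namespace AperiodicNekhoroshev

noncomputable section

open Metric Set Filter Topology

/-! ### Frequencies along real points -/

variable {n : ℕ}

/-- The inclusion of `ℝⁿ` in `ℂⁿ` as a linear isometry. -/
def toCL : RVec n →ₗᵢ[ℝ] CVec n where
  toFun := toC
  map_add' x y := by ext j; simp [toC]
  map_smul' c x := by ext j; simp [toC]
  norm_map' x := by simp [toC, EuclideanSpace.norm_eq]

theorem toCL_apply (x : RVec n) : toCL x = toC x := rfl

theorem norm_toC_sub (x y : RVec n) : ‖toC x - toC y‖ = ‖x - y‖ := by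
  rw [← toCL_apply, ← toCL_apply, ← map_sub, toCL.norm_map]

theorem toC_intVecR (k : Fin n → ℤ) : toC (intVecR k) = intVec k := by
  ext j; simp [toC, intVecR, intVec]

theorem toC_single (j : Fin n) : toC (EuclideanSpace.single j 1 : RVec n) =
    EuclideanSpace.single j 1 := by
  ext i
  by_cases h : i = j
  · subst h; simp [toC]
  · simp [toC, h]

theorem isOpen_complexNhd (G : Set (RVec n)) (ρ : ℝ) : IsOpen (complexNhd G ρ) :=
  isOpen_biUnion fun _ _ => isOpen_ball

theorem ball_subset_complexNhd {G : Set (RVec n)} {ρ a r : ℝ} {x₀ x : RVec n} (hx₀ : x₀ ∈ G)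
    (hx : ‖x - x₀‖ ≤ a) (har : a + r ≤ ρ) : ball (toC x) r ⊆ complexNhd G ρ := by
  intro z hz
  refine mem_iUnion₂.2 ⟨x₀, hx₀, ?_⟩
  rw [mem_ball, dist_eq_norm] at hz ⊢
  calc ‖z - toC x₀‖ = ‖(z - toC x) + (toC x - toC x₀)‖ := by congr 1; abel
    _ ≤ _ := norm_add_le _ _
    _ < r + a := add_lt_add_of_lt_of_le hz (by rwa [norm_toC_sub])
    _ ≤ ρ := by linarith

section RealPoints

variable {F : CVec n → ℂ} {x : RVec n}

theorem hasFDerivAt_comp_toC (hF : DifferentiableAt ℂ F (toC x)) :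
    HasFDerivAt (fun y : RVec n => F (toC y))
      (((fderiv ℂ F (toC x)).restrictScalars ℝ).comp toCL.toContinuousLinearMap) x :=
  (hF.hasFDerivAt.restrictScalars ℝ).comp x toCL.toContinuousLinearMap.hasFDerivAt

/-- The derivatives of a function that is real at real points are real there. -/
theorem im_fderiv_toC (hF : DifferentiableAt ℂ F (toC x))
    (hre : ∀ᶠ y : RVec n in 𝓝 x, (F (toC y)).im = 0) (v : RVec n) :
    (fderiv ℂ F (toC x) (toC v)).im = 0 := by
  have h1 := Complex.imCLM.hasFDerivAt.comp x (hasFDerivAt_comp_toC hF)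
  have h2 : (Complex.imCLM ∘ fun y : RVec n => F (toC y)) =ᶠ[𝓝 x] fun _ => 0 := hre
  have h3 := (h2.hasFDerivAt_iff.1 h1).unique (hasFDerivAt_const (0 : ℝ) x)
  exact congrArg (fun T : RVec n →L[ℝ] ℝ => T v) h3

theorem toC_gradient (hF : DifferentiableAt ℂ F (toC x))
    (hre : ∀ᶠ y : RVec n in 𝓝 x, (F (toC y)).im = 0) :
    toC (gradient (fun y : RVec n => (F (toC y)).re) x) =
      WithLp.toLp 2 fun j => fderiv ℂ F (toC x) (EuclideanSpace.single j 1) := by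
  have h1 : HasFDerivAt (fun y : RVec n => (F (toC y)).re) _ x :=
    Complex.reCLM.hasFDerivAt.comp x (hasFDerivAt_comp_toC hF)
  ext j
  have h2 : gradient (fun y : RVec n => (F (toC y)).re) x j =
      inner ℝ (gradient (fun y : RVec n => (F (toC y)).re) x) (EuclideanSpace.single j 1) := by
    rw [EuclideanSpace.inner_single_right]
    simp
  have h3 := im_fderiv_toC hF hre (EuclideanSpace.single j 1)
  rw [toC_single] at h3
  change ((gradient (fun y : RVec n => (F (toC y)).re) x j : ℝ) : ℂ) = _
  rw [h2, gradient, InnerProductSpace.toDual_symm_apply, h1.fderiv]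
  refine Complex.ext ?_ ?_
  · rw [Complex.ofReal_re]
    change (fderiv ℂ F (toC x) (toC (EuclideanSpace.single j 1))).re = _
    rw [toC_single]
  · rw [Complex.ofReal_im]
    exact h3.symm

end RealPoints

section Hessian

variable {G : Set (RVec n)} {ρ M m : ℝ} {h : CVec n → ℂ}

theorem ConvexityHyp.norm_fderiv_fderiv_le (hc : ConvexityHyp G ρ M m h) {I : CVec n}
    (hI : I ∈ complexNhd G ρ) (v : RVec n) (w : CVec n) :
    ‖fderiv ℂ (fderiv ℂ h) I (toC v) w‖ ≤ M * ‖v‖ * ‖w‖ := by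
  have hw : w = ∑ j, w j • (EuclideanSpace.single j 1 : CVec n) := by
    ext i
    simp [Finset.sum_apply, Pi.single_apply]
  have h1 : fderiv ℂ (fderiv ℂ h) I (toC v) w =
      inner ℂ (WithLp.toLp 2 fun j => (starRingEnd ℂ) (w j)) (hessianMulVec h I v) := by
    conv_lhs => rw [hw]
    rw [map_sum, PiLp.inner_apply]
    refine Finset.sum_congr rfl fun j _ => ?_
    rw [map_smul, smul_eq_mul]
    simp [hessianMulVec, mul_comm]
  have h2 : ‖(WithLp.toLp 2 fun j => (starRingEnd ℂ) (w j) : CVec n)‖ = ‖w‖ := by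
    simp [EuclideanSpace.norm_eq]
  rw [h1]
  refine (norm_inner_le_norm _ _).trans ?_
  rw [h2, mul_comm]
  exact mul_le_mul_of_nonneg_right (hc.upper I hI v) (norm_nonneg w)

theorem ConvexityHyp.le_norm_fderiv_fderiv (hc : ConvexityHyp G ρ M m h) {I : CVec n}
    (hI : I ∈ complexNhd G ρ) (v : RVec n) :
    m * ‖v‖ ^ 2 ≤ ‖fderiv ℂ (fderiv ℂ h) I (toC v) (toC v)‖ := by
  have hw : toC v = ∑ j, (v j : ℂ) • (EuclideanSpace.single j 1 : CVec n) := by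
    ext i
    simp [toC, Finset.sum_apply, Pi.single_apply]
  refine (hc.lower I hI v).trans (le_of_eq (congrArg _ ?_))
  conv_rhs => rw [hw, map_sum, ← hw]
  refine Finset.sum_congr rfl fun j _ => ?_
  rw [map_smul, smul_eq_mul, mul_comm]
  rfl

variable (hh : DifferentiableOn ℂ h (complexNhd G ρ)) (hc : ConvexityHyp G ρ M m h)

include hh hc

/-- The frequencies are Lipschitz continuous. -/
theorem norm_fderiv_toC_sub_le {U : Set (CVec n)} (hU : U ⊆ complexNhd G ρ) (hUc : Convex ℝ U)
    (v : RVec n) {I I' : CVec n} (hI : I ∈ U) (hI' : I' ∈ U) :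
    ‖fderiv ℂ h I (toC v) - fderiv ℂ h I' (toC v)‖ ≤ M * ‖v‖ * ‖I - I'‖ := by
  have hopen := isOpen_complexNhd G ρ
  refine hUc.norm_image_sub_le_of_norm_hasFDerivWithin_le (𝕜 := ℂ)
    (f := fun z => fderiv ℂ h z (toC v)) (f' := fun z => fderiv ℂ (fderiv ℂ h) z (toC v))
    (fun z hz => ?_) (fun z hz => ?_) hI' hI
  · have h1 : DifferentiableAt ℂ (fderiv ℂ h) z :=
      (differentiableOn_fderiv hopen hh).differentiableAt (hopen.mem_nhds (hU hz))
    have h2 := h1.hasFDerivAt.clm_apply (hasFDerivAt_const (toC v) z)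
    refine (h2.congr_fderiv ?_).hasFDerivWithinAt
    ext w
    have := fderiv_fderiv_comm hopen hh (hU hz) w (toC v)
    rw [fderiv_clm_apply h1 (differentiableAt_const _),
      fderiv_clm_apply h1 (differentiableAt_const _)] at this
    simpa using this.symm
  · refine ContinuousLinearMap.opNorm_le_bound' _ ?_ fun w _ =>
      hc.norm_fderiv_fderiv_le (hU hz) v w
    exact (norm_nonneg _).trans (hc.upper z (hU hz) v)

/-- The frequency map is monotone or antitone along every segment. -/
theorem le_abs_re_fderiv_toC_sub
    (hre : ∀ x : RVec n, toC x ∈ complexNhd G ρ → (h (toC x)).im = 0) {x y : RVec n}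
    (hxy : ∀ s ∈ Icc (0 : ℝ) 1, toC (y + s • (x - y)) ∈ complexNhd G ρ) :
    m * ‖x - y‖ ^ 2 ≤ |(fderiv ℂ h (toC x) (toC (x - y))).re -
      (fderiv ℂ h (toC y) (toC (x - y))).re| := by
  have hopen := isOpen_complexNhd G ρ
  set d := x - y with hd
  have hcont : Continuous fun s : ℝ => toC (y + s • d) := by
    have : Continuous fun s : ℝ => toCL (y + s • d) :=
      toCL.continuous.comp (continuous_const.add (continuous_id.smul continuous_const))
    exact this
  have hline : ∀ s : ℝ, HasDerivAt (fun s : ℝ => toC (y + s • d)) (toC d) s := by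
    intro s
    have h1 : HasDerivAt (fun s : ℝ => y + s • d) d s := by
      simpa using ((hasDerivAt_id s).smul_const d).const_add y
    exact toCL.toContinuousLinearMap.hasFDerivAt.comp_hasDerivAt s h1
  have hderiv : ∀ s : ℝ, toC (y + s • d) ∈ complexNhd G ρ →
      HasDerivAt (fun s : ℝ => fderiv ℂ h (toC (y + s • d)) (toC d))
        (fderiv ℂ (fderiv ℂ h) (toC (y + s • d)) (toC d) (toC d)) s := by
    intro s hs
    have h1 : DifferentiableAt ℂ (fderiv ℂ h) (toC (y + s • d)) :=
      (differentiableOn_fderiv hopen hh).differentiableAt (hopen.mem_nhds hs)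
    have h2 : HasDerivAt (fun s : ℝ => fderiv ℂ h (toC (y + s • d)))
        (fderiv ℂ (fderiv ℂ h) (toC (y + s • d)) (toC d)) s := by
      have h3 : HasFDerivAt (fderiv ℂ h)
          ((fderiv ℂ (fderiv ℂ h) (toC (y + s • d))).restrictScalars ℝ) (toC (y + s • d)) :=
        h1.hasFDerivAt.restrictScalars ℝ
      exact h3.comp_hasDerivAt s (hline s)
    have h4 : HasFDerivAt (fun T : CVec n →L[ℂ] ℂ => T (toC d))
        ((ContinuousLinearMap.apply ℂ ℂ (toC d)).restrictScalars ℝ)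
        (fderiv ℂ h (toC (y + s • d))) :=
      (ContinuousLinearMap.apply ℂ ℂ (toC d)).hasFDerivAt.restrictScalars ℝ
    exact h4.comp_hasDerivAt s h2
  have hreal : ∀ s : ℝ, toC (y + s • d) ∈ complexNhd G ρ →
      (fderiv ℂ h (toC (y + s • d)) (toC d)).im = 0 := by
    intro s hs
    refine im_fderiv_toC (hh.differentiableAt (hopen.mem_nhds hs)) ?_ d
    have : ∀ᶠ z : RVec n in 𝓝 (y + s • d), toC z ∈ complexNhd G ρ :=
      (toCL.continuous.continuousAt (x := y + s • d)).eventually (hopen.mem_nhds hs)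
    exact this.mono fun z hz => hre z hz
  have hreal2 : ∀ s : ℝ, toC (y + s • d) ∈ complexNhd G ρ →
      (fderiv ℂ (fderiv ℂ h) (toC (y + s • d)) (toC d) (toC d)).im = 0 := by
    intro s hs
    have h1 := Complex.imCLM.hasFDerivAt.comp_hasDerivAt s (hderiv s hs)
    have h2 : (Complex.imCLM ∘ fun s : ℝ => fderiv ℂ h (toC (y + s • d)) (toC d)) =ᶠ[𝓝 s]
        fun _ => 0 := by
      filter_upwards [hcont.continuousAt.eventually (hopen.mem_nhds hs)] with s hs
      exact hreal s hs
    exact (h2.hasDerivAt_iff.1 h1).unique (hasDerivAt_const s (0 : ℝ))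
  have hderiv' : ∀ s ∈ Icc (0 : ℝ) 1,
      HasDerivAt (fun s : ℝ => (fderiv ℂ h (toC (y + s • d)) (toC d)).re)
        (fderiv ℂ (fderiv ℂ h) (toC (y + s • d)) (toC d) (toC d)).re s := fun s hs =>
    Complex.reCLM.hasFDerivAt.comp_hasDerivAt s (hderiv s (hxy s hs))
  obtain ⟨c, hc1, hc2⟩ := exists_hasDerivAt_eq_slope _ _ (zero_lt_one' ℝ)
    (fun s hs => (hderiv' s hs).continuousAt.continuousWithinAt)
    (fun s hs => hderiv' s (Ioo_subset_Icc_self hs))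
  have hcm := hxy c (Ioo_subset_Icc_self hc1)
  have h1 := hc.le_norm_fderiv_fderiv hcm d
  rw [← Complex.re_add_im (fderiv ℂ (fderiv ℂ h) _ _ _), hreal2 c hcm, Complex.ofReal_zero,
    zero_mul, add_zero, Complex.norm_real, hc2, Real.norm_eq_abs] at h1
  have e1 : y + (1 : ℝ) • d = x := by rw [one_smul, hd]; abel
  have e0 : y + (0 : ℝ) • d = y := by rw [zero_smul, add_zero]
  rw [sub_zero, div_one, e1, e0] at h1
  exact h1

end Hessian

/-- A continuity argument: if `g` is at most `a` whenever it has been at most `b > a` before, then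
it is always at most `a`. -/
theorem le_of_forall_uIcc_le {g : ℝ → ℝ} {s : Set ℝ} (hs : s.OrdConnected) (hg : ContinuousOn g s)
    {a b t₀ : ℝ} (hab : a < b) (ht₀ : t₀ ∈ s) (h0 : g t₀ ≤ a)
    (h : ∀ t ∈ s, (∀ τ ∈ uIcc t₀ t, g τ ≤ b) → g t ≤ a) : ∀ t ∈ s, g t ≤ a := by
  intro t ht
  have hsub : uIcc t₀ t ⊆ s := hs.uIcc_subset ht₀ ht
  have hivt : ∀ τ ∈ uIcc t₀ t, b < g τ → ∃ τ' ∈ uIcc t₀ τ, g τ' = b := by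
    intro τ hτ hb
    have hc : ContinuousOn g (uIcc t₀ τ) :=
      hg.mono ((uIcc_subset_uIcc_left hτ).trans hsub)
    have := intermediate_value_uIcc hc
    exact this (mem_uIcc_of_le (h0.trans hab.le) hb.le)
  by_cases hne : (uIcc t₀ t ∩ g ⁻¹' {b}).Nonempty
  · have hcpt : IsCompact (uIcc t₀ t ∩ g ⁻¹' {b}) :=
      isCompact_uIcc.of_isClosed_subset ((hg.mono hsub).preimage_isClosed_of_isClosed
        isClosed_Icc isClosed_singleton) inter_subset_left
    obtain ⟨τ, ⟨hτ1, hτ2⟩, hmin⟩ := hcpt.exists_isMinOn hne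
      (f := fun τ => |τ - t₀|) (by fun_prop)
    exfalso
    have h1 : g τ ≤ a := by
      refine h τ (hsub hτ1) fun τ' hτ' => ?_
      by_contra hb
      obtain ⟨τ'', h3, h4⟩ := hivt τ' (uIcc_subset_uIcc_left hτ1 hτ') (not_le.1 hb)
      have h5 := hmin ⟨uIcc_subset_uIcc_left hτ1 (uIcc_subset_uIcc_left hτ' h3), h4⟩
      have h6 : |τ - t₀| ≤ |τ'' - t₀| := h5
      have h7 : τ'' = τ' := by
        rcases le_total t₀ τ with hle | hle
        · rw [uIcc_of_le hle] at hτ'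
          rw [uIcc_of_le hτ'.1] at h3
          rw [abs_of_nonneg (by linarith), abs_of_nonneg (by linarith [h3.1])] at h6
          linarith [h3.2, hτ'.2]
        · rw [uIcc_of_ge hle] at hτ'
          rw [uIcc_of_ge hτ'.2] at h3
          rw [abs_of_nonpos (by linarith), abs_of_nonpos (by linarith [h3.2])] at h6
          linarith [h3.1, hτ'.1]
      rw [h7] at h4
      exact hb h4.le
    have h2 : g τ = b := hτ2
    linarith
  · refine h t ht fun τ hτ => ?_
    by_contra hb
    obtain ⟨τ', h3, h4⟩ := hivt τ hτ (not_le.1 hb)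
    exact hne ⟨τ', uIcc_subset_uIcc_left hτ h3, h4⟩

end

end AperiodicNekhoroshev

namespace AperiodicNekhoroshev

noncomputable section

open Metric Set Filter Topology

/-! ### Orbits near a resonance -/

variable {n : ℕ} {G : Set (RVec n)} {ρ σ Cf M m ε μ : ℝ} {h : CVec n → ℂ}
  {f : CVec n × CVec n × ℂ → ℂ}

/-- A real point of phase space, with the slow time. -/
def realPoint (x y : RVec n) (ξ : ℝ) : Phase n := (toC x, toC y, (ξ : ℂ))

theorem toC_mem_angleStrip (hσ : 0 < σ) (y : RVec n) : toC y ∈ angleStrip n σ := by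
  intro j
  simpa [toC] using hσ

theorem ofReal_mem_timeStrip (hσ : 0 < σ) (ξ : ℝ) : (ξ : ℂ) ∈ timeStrip σ := by
  simpa [timeStrip] using hσ

theorem realPoint_mem (hσ : 0 < σ) {x : RVec n} (hx : toC x ∈ complexNhd G ρ) (y : RVec n) (ξ : ℝ) :
    realPoint x y ξ ∈ complexDomain G ρ σ :=
  ⟨hx, toC_mem_angleStrip (by positivity) y, ofReal_mem_timeStrip (by positivity) ξ⟩

theorem isOpen_complexDomain (G : Set (RVec n)) (ρ σ : ℝ) : IsOpen (complexDomain G ρ σ) :=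
  (isOpen_complexNhd G ρ).prod ((isOpen_angleStrip n _).prod (isOpen_timeStrip _))

theorem eventually_toC_mem {x : RVec n} (hx : toC x ∈ complexNhd G ρ) :
    ∀ᶠ y : RVec n in 𝓝 x, toC y ∈ complexNhd G ρ :=
  (toCL.continuous.continuousAt (x := x)).eventually ((isOpen_complexNhd G ρ).mem_nhds hx)

section

variable (hR : RegularityHyp G ρ σ Cf h f) (hσ : 0 < σ)

include hR hσ

theorem toC_gradient_hamiltonian_ang {x : RVec n} (hx : toC x ∈ complexNhd G ρ) (y : RVec n)
    (t : ℝ) : toC (gradient (fun y => hamiltonian h f ε μ x y t) y) =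
      WithLp.toLp 2 fun j => fderiv ℂ (fun z => (ε : ℂ) * f z) (realPoint x y (μ * t))
        (0, EuclideanSpace.single j 1, 0) := by
  have hfd : DifferentiableAt ℂ (fun z => (ε : ℂ) * f z) (realPoint x y (μ * t)) :=
    ((hR.f_holo _ (realPoint_mem hσ hx y _)).differentiableAt).const_mul _
  set F : CVec n → ℂ := fun w => h (toC x) + ε * f (toC x, w, ((μ * t : ℝ) : ℂ)) with hF
  have hFd : HasFDerivAt F ((fderiv ℂ (fun z => (ε : ℂ) * f z) (realPoint x y (μ * t))).comp
      ((0 : CVec n →L[ℂ] CVec n).prod ((ContinuousLinearMap.id ℂ (CVec n)).prod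
        (0 : CVec n →L[ℂ] ℂ)))) (toC y) := by
    have h1 : HasFDerivAt (fun w : CVec n => ((toC x, w, ((μ * t : ℝ) : ℂ)) : Phase n))
        ((0 : CVec n →L[ℂ] CVec n).prod ((ContinuousLinearMap.id ℂ (CVec n)).prod
        (0 : CVec n →L[ℂ] ℂ))) (toC y) :=
      (hasFDerivAt_const _ _).prodMk ((hasFDerivAt_id _).prodMk (hasFDerivAt_const _ _))
    exact (HasFDerivAt.comp (toC y) (g := fun z => (ε : ℂ) * f z) hfd.hasFDerivAt h1).const_add _
  have hreal : ∀ y' : RVec n, (F (toC y')).im = 0 := by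
    intro y'
    simp only [hF, Complex.add_im, Complex.im_ofReal_mul, hR.h_real x hx,
      hR.f_real x y' (μ * t) hx, mul_zero, add_zero]
  have h2 : (fun y => hamiltonian h f ε μ x y t) = fun y => (F (toC y)).re := by
    funext y'
    simp [hF, hamiltonian]
  rw [h2, toC_gradient hFd.differentiableAt (Eventually.of_forall hreal), hFd.fderiv]
  rfl

theorem toC_gradient_hamiltonian_act {x : RVec n} (hx : toC x ∈ complexNhd G ρ) (y : RVec n)
    (t : ℝ) : toC (gradient (fun x => hamiltonian h f ε μ x y t) x) =
      WithLp.toLp 2 fun j => fderiv ℂ h (toC x) (EuclideanSpace.single j 1) +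
        fderiv ℂ (fun z => (ε : ℂ) * f z) (realPoint x y (μ * t))
          (EuclideanSpace.single j 1, 0, 0) := by
  have hfd : DifferentiableAt ℂ (fun z => (ε : ℂ) * f z) (realPoint x y (μ * t)) :=
    ((hR.f_holo _ (realPoint_mem hσ hx y _)).differentiableAt).const_mul _
  have hhd : DifferentiableAt ℂ h (toC x) := (hR.h_holo _ hx).differentiableAt
  set F : CVec n → ℂ := fun w => h w + ε * f (w, toC y, ((μ * t : ℝ) : ℂ)) with hF
  have hFd : HasFDerivAt F (fderiv ℂ h (toC x) +
      (fderiv ℂ (fun z => (ε : ℂ) * f z) (realPoint x y (μ * t))).comp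
      ((ContinuousLinearMap.id ℂ (CVec n)).prod ((0 : CVec n →L[ℂ] CVec n).prod
        (0 : CVec n →L[ℂ] ℂ)))) (toC x) := by
    have h1 : HasFDerivAt (fun w : CVec n => ((w, toC y, ((μ * t : ℝ) : ℂ)) : Phase n))
        ((ContinuousLinearMap.id ℂ (CVec n)).prod ((0 : CVec n →L[ℂ] CVec n).prod
        (0 : CVec n →L[ℂ] ℂ))) (toC x) :=
      (hasFDerivAt_id _).prodMk ((hasFDerivAt_const _ _).prodMk (hasFDerivAt_const _ _))
    exact hhd.hasFDerivAt.add
      (HasFDerivAt.comp (toC x) (g := fun z => (ε : ℂ) * f z) hfd.hasFDerivAt h1)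
  have hreal : ∀ᶠ x' : RVec n in 𝓝 x, (F (toC x')).im = 0 := by
    filter_upwards [eventually_toC_mem hx] with x' hx'
    simp only [hF, Complex.add_im, Complex.im_ofReal_mul, hR.h_real x' hx',
      hR.f_real x' y (μ * t) hx', mul_zero, add_zero]
  have h2 : (fun x => hamiltonian h f ε μ x y t) = fun x => (F (toC x)).re := by
    funext x'
    simp [hF, hamiltonian]
  rw [h2, toC_gradient hFd.differentiableAt hreal, hFd.fderiv]
  rfl

/-- An orbit, as a curve in the complex phase space, follows the complex Hamiltonian field. -/
theorem IsOrbit.hasDerivWithinAt {J : Set ℝ} {I φ : ℝ → RVec n} (hO : IsOrbit G ρ h f ε μ J I φ)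
    {t : ℝ} (ht : t ∈ J) : HasDerivWithinAt (fun t => realPoint (I t) (φ t) (μ * t))
      (hamField h (fun z => (ε : ℂ) * f z) μ (realPoint (I t) (φ t) (μ * t))) J t := by
  have hx := hO.mem t ht
  have h1 : HasDerivWithinAt (fun t => toC (I t))
      (toC (-gradient (fun y => hamiltonian h f ε μ (I t) y t) (φ t))) J t :=
    toCL.toContinuousLinearMap.hasFDerivAt.comp_hasDerivWithinAt t (hO.deriv_I t ht)
  have h2 : HasDerivWithinAt (fun t => toC (φ t))
      (toC (gradient (fun x => hamiltonian h f ε μ x (φ t) t) (I t))) J t :=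
    toCL.toContinuousLinearMap.hasFDerivAt.comp_hasDerivWithinAt t (hO.deriv_φ t ht)
  have h3 : HasDerivWithinAt (fun t : ℝ => ((μ * t : ℝ) : ℂ)) (μ : ℂ) J t := by
    have := ((hasDerivAt_id t).const_mul μ).ofReal_comp.hasDerivWithinAt (s := J)
    simpa using this
  have h4 : toC (-gradient (fun y => hamiltonian h f ε μ (I t) y t) (φ t)) =
      WithLp.toLp 2 fun j => -fderiv ℂ (fun z => (ε : ℂ) * f z) (realPoint (I t) (φ t) (μ * t))
        (0, EuclideanSpace.single j 1, 0) := by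
    rw [← toCL_apply, map_neg, toCL_apply, toC_gradient_hamiltonian_ang hR hσ hx]
    rfl
  rw [h4] at h1
  rw [toC_gradient_hamiltonian_act hR hσ hx] at h2
  exact h1.prodMk (h2.prodMk h3)

end

/-- The change of an almost integral along an orbit. -/
theorem norm_almost_integral_sub_le {A : Frame n} {P : Hol A.dom} {z : ℝ → Phase n}
    {V : Phase n → Phase n} {S : Set ℝ} (hS : Convex ℝ S)
    (hz : ∀ t ∈ S, HasDerivWithinAt z (V (z t)) S t) (hzA : ∀ t ∈ S, z t ∈ A.dom) {B : ℝ}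
    (hB : ∀ t ∈ S, ‖fderiv ℂ P.fn (z t) (V (z t))‖ ≤ B) {t₁ t₂ : ℝ} (h1 : t₁ ∈ S) (h2 : t₂ ∈ S) :
    ‖P.fn (z t₂) - P.fn (z t₁)‖ ≤ B * |t₂ - t₁| := by
  rw [← Real.norm_eq_abs]
  refine hS.norm_image_sub_le_of_norm_hasDerivWithin_le (𝕜 := ℝ) (f := fun t => P.fn (z t))
    (f' := fun t => fderiv ℂ P.fn (z t) (V (z t))) (fun t ht => ?_) hB h1 h2
  have hd : HasFDerivAt P.fn ((fderiv ℂ P.fn (z t)).restrictScalars ℝ) (z t) :=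
    (P.differentiableAt (hzA t ht)).hasFDerivAt.restrictScalars ℝ
  exact hd.comp_hasDerivWithinAt t (hz t ht)

theorem linForm_toC (v x : RVec n) : Frame.linForm (fun j => (v j : ℂ)) (toC x) =
    ((inner ℝ v x : ℝ) : ℂ) := by
  rw [Frame.linForm_apply, PiLp.inner_apply]
  push_cast
  refine Finset.sum_congr rfl fun j _ => ?_
  simp [toC, mul_comm]

end

end AperiodicNekhoroshev

namespace AperiodicNekhoroshev

noncomputable section

open Metric Set Filter Topology

variable {n : ℕ} {G : Set (RVec n)} {ρ σ Cf M m ε μ : ℝ} {h : CVec n → ℂ}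
  {f : CVec n × CVec n × ℂ → ℂ}

theorem RegularityHyp.norm_le (hR : RegularityHyp G ρ σ Cf h f) {z : Phase n}
    (hz : z ∈ complexDomain G ρ σ) : ‖f z‖ ≤ Cf :=
  hR.f_norm.1 ⟨z, hz, rfl⟩

theorem RegularityHyp.Cf_nonneg (hR : RegularityHyp G ρ σ Cf h f) {z : Phase n}
    (hz : z ∈ complexDomain G ρ σ) : 0 ≤ Cf :=
  (norm_nonneg _).trans (hR.norm_le hz)

/-- The size of the perturbation in the normal form. -/
def pertSize (n : ℕ) (σ Cf ε : ℝ) : ℝ := ε * Cf * expSum n σ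

/-- The rate at which the almost integrals change along the orbits. -/
def driftRate (A : Frame n) (σ e : ℝ) : ℝ :=
  e * (1 / 2) ^ A.N * (A.K + n * (A.K + 4 / (σ / 2)))

/-- The drift of the actions orthogonal to the resonances. -/
theorem abs_inner_sub_le (hR : RegularityHyp G ρ σ Cf h f) (hσ : 0 < σ) (hε : 0 < ε) (hμ : 0 ≤ μ)
    {A : Frame n} {x₀ : RVec n} (hAc : A.c = toC x₀) (hAs : A.s = 2 * σ)
    (hball : ball (toC x₀) A.r ⊆ complexNhd G ρ) (hK : Real.exp (-(σ / 2 * A.K)) ≤ 1 / 16)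
    {α : ℝ} (hα : 0 < α)
    (hκ : A.Γ * (pertSize n σ Cf ε + A.c₀ * μ) / α ≤ 1 / 256)
    {v : RVec n} (hv : ‖v‖ ≤ 1)
    (hres : ∀ k : Fin n → ℤ, l1 k ≤ A.N * A.K → inner ℝ v (intVecR k) = 0 ∨
      ∀ I ∈ ball A.c A.r, α ≤ ‖fderiv ℂ h I (intVec k)‖)
    {J : Set ℝ} {I φ : ℝ → RVec n} (hO : IsOrbit G ρ h f ε μ J I φ) {t₁ t₂ : ℝ}
    (hJ : uIcc t₁ t₂ ⊆ J) (hI : ∀ t ∈ uIcc t₁ t₂, ‖I t - x₀‖ < A.r / 2) :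
    |inner ℝ v (I t₂ - I t₁)| ≤ 2 * (16 * A.K * pertSize n σ Cf ε / α) +
      driftRate A σ (pertSize n σ Cf ε) * |t₂ - t₁| := by
  have hdom : ∀ z ∈ A.dom, z ∈ complexDomain G ρ σ := by
    intro z hz
    obtain ⟨h1, h2, h3⟩ := A.mem_dom.1 hz
    rw [hAs] at h2 h3
    rw [hAc] at h1
    exact ⟨hball h1, h2, h3⟩
  have hzA : ∀ t ∈ uIcc t₁ t₂, realPoint (I t) (φ t) (μ * t) ∈ A.dom := by
    intro t ht
    refine A.mem_dom.2 ⟨?_, toC_mem_angleStrip A.hs _, ofReal_mem_timeStrip A.hs _⟩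
    have := hI t ht
    have := A.hr
    rw [mem_ball, dist_eq_norm, hAc]
    change ‖toC (I t) - toC x₀‖ < A.r
    rw [norm_toC_sub]
    linarith
  have hCf : 0 ≤ Cf := hR.Cf_nonneg (hdom _ (hzA t₁ left_mem_uIcc))
  have hS := expSum_nonneg n σ
  have hfd : DifferentiableOn ℂ (fun z => (ε : ℂ) * f z) A.dom := fun z hz =>
    ((hR.f_holo z (hdom z hz)).differentiableAt.const_mul _).differentiableWithinAt
  have hfb : ∀ z ∈ A.dom, ‖(ε : ℂ) * f z‖ ≤ ε * Cf := by
    intro z hz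
    rw [norm_mul, Complex.norm_real, Real.norm_of_nonneg hε.le]
    exact mul_le_mul_of_nonneg_left (hR.norm_le (hdom z hz)) hε.le
  have hper : AngPeriodic A fun z => (ε : ℂ) * f z := by
    rintro ⟨z1, z2, z3⟩ hz j
    have := hR.f_periodic z1 z2 z3 (hdom _ hz) j
    simp only [Prod.mk_add_mk, add_zero]
    rw [this]
  obtain ⟨F, hF, htail⟩ := exists_trig_approx A hfd hfb hper hσ hAs (by positivity) hK
  have hhd : DifferentiableOn ℂ h (ball A.c A.r) := by
    rw [hAc]
    exact fun z hz => (hR.h_holo z (hball hz)).differentiableAt.differentiableWithinAt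
  have hv' : ∀ j, ‖((v j : ℝ) : ℂ)‖ ≤ 1 := fun j => by
    rw [Complex.norm_real]
    exact (PiLp.norm_apply_le v j).trans hv
  have he : 0 ≤ pertSize n σ Cf ε := by unfold pertSize; positivity
  have hres' : ∀ k : Fin n → ℤ, l1 k ≤ A.N * A.K →
      Frame.linForm (fun j => ((v j : ℝ) : ℂ)) (intVec k) = 0 ∨
      ∀ I ∈ ball A.c A.r, α ≤ ‖fderiv ℂ h I (intVec k)‖ := by
    intro k hk
    rw [← toC_intVecR, linForm_toC, Complex.ofReal_eq_zero, toC_intVecR]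
    exact hres k hk
  obtain ⟨P, hP⟩ := Frame.exists_almost_integral hhd hfd hv' hα he hμ
    (half_pos hσ) (by rw [hAs]; linarith) hres' hκ hF htail
  have hPt : ∀ t ∈ uIcc t₁ t₂, _ := fun t ht => hP _ (hzA t ht) (by
      rw [mem_ball, dist_eq_norm, hAc]
      change ‖toC (I t) - toC x₀‖ < A.r / 2
      rw [norm_toC_sub]
      exact hI t ht) (Complex.ofReal_im _) fun j => Complex.ofReal_im _
  have hderiv : ∀ t ∈ uIcc t₁ t₂, HasDerivWithinAt (fun t => realPoint (I t) (φ t) (μ * t))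
      (hamField h (fun z => (ε : ℂ) * f z) μ (realPoint (I t) (φ t) (μ * t))) (uIcc t₁ t₂) t :=
    fun t ht => (hO.hasDerivWithinAt hR hσ (hJ ht)).mono hJ
  have h3 := norm_almost_integral_sub_le (convex_uIcc t₁ t₂) hderiv hzA
    (fun t ht => (hPt t ht).2) left_mem_uIcc right_mem_uIcc
  have h1 := (hPt t₁ left_mem_uIcc).1
  have h2 := (hPt t₂ right_mem_uIcc).1
  have e1 : ∀ t, Frame.linForm (fun j => ((v j : ℝ) : ℂ)) (realPoint (I t) (φ t) (μ * t)).1 =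
      ((inner ℝ v (I t) : ℝ) : ℂ) := fun t => linForm_toC v (I t)
  rw [e1] at h1 h2
  rw [inner_sub_right, ← Real.norm_eq_abs, ← Complex.norm_real, Complex.ofReal_sub]
  set z₁ := P.fn (realPoint (I t₁) (φ t₁) (μ * t₁))
  set z₂ := P.fn (realPoint (I t₂) (φ t₂) (μ * t₂))
  set w₁ : ℂ := ((inner ℝ v (I t₁) : ℝ) : ℂ)
  set w₂ : ℂ := ((inner ℝ v (I t₂) : ℝ) : ℂ)
  have e2 : w₂ - w₁ = (z₂ - z₁) - (z₂ - w₂) + (z₁ - w₁) := by ring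
  rw [e2]
  have e3 := norm_add_le ((z₂ - z₁) - (z₂ - w₂)) (z₁ - w₁)
  have e4 := norm_sub_le (z₂ - z₁) (z₂ - w₂)
  unfold driftRate
  linarith

/-- The frequency of a real action, as a linear form. -/
def freqForm (h : CVec n → ℂ) (x : RVec n) : RVec n →ₗ[ℝ] ℝ where
  toFun v := (fderiv ℂ h (toC x) (toC v)).re
  map_add' v w := by
    rw [← toCL_apply (v + w), map_add, map_add, Complex.add_re]
    rfl
  map_smul' c v := by
    rw [← toCL_apply (c • v), map_smul, ← Complex.coe_smul, map_smul]
    simp [toCL_apply]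

theorem freqForm_apply (h : CVec n → ℂ) (x v : RVec n) :
    freqForm h x v = (fderiv ℂ h (toC x) (toC v)).re := rfl

/-- **Trapping near a resonance.** An orbit that starts at a point whose frequency is nonresonant
outside `E` cannot leave a small ball, as long as the frequencies inside the ball are resonant with
respect to `E`: orthogonally to `E`, the actions are almost integrals, and in the direction of
`E`, convexity forces the resonant frequencies to change together with the actions. -/
theorem norm_sub_le_of_resonant (hR : RegularityHyp G ρ σ Cf h f) (hc : ConvexityHyp G ρ M m h)
    (hσ : 0 < σ) (hm : 0 < m) (hmM : m ≤ M) (hε : 0 < ε) (hμ : 0 ≤ μ)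
    {A : Frame n} {J S : Set ℝ} {I φ : ℝ → RVec n} (hO : IsOrbit G ρ h f ε μ J I φ) {t₀ : ℝ}
    (hAc : A.c = toC (I t₀)) (hAs : A.s = 2 * σ)
    (hball : ball (toC (I t₀)) A.r ⊆ complexNhd G ρ) (hK : Real.exp (-(σ / 2 * A.K)) ≤ 1 / 16)
    {α : ℝ} (hα : 0 < α)
    (hκ : A.Γ * (pertSize n σ Cf ε + A.c₀ * μ) / α ≤ m / (256 * M))
    {E : Submodule ℝ (RVec n)}
    (hres : ∀ k : Fin n → ℤ, l1 k ≤ A.N * A.K → intVecR k ∉ E →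
      ∀ z ∈ ball A.c A.r, α ≤ ‖fderiv ℂ h z (intVec k)‖)
    (hSJ : S ⊆ J) (hS : S.OrdConnected) (ht₀ : t₀ ∈ S)
    (htime : ∀ t ∈ S, driftRate A σ (pertSize n σ Cf ε) * |t - t₀| ≤ m * A.r / (64 * M))
    {δ : ℝ} (hδ : 16 * δ ≤ m * A.r)
    (hEδ : ∀ t ∈ S, ‖I t - I t₀‖ ≤ A.r / 3 → ∀ v ∈ E, |freqForm h (I t) v| ≤ δ * ‖v‖) :
    ∀ t ∈ S, ‖I t - I t₀‖ ≤ A.r / 4 := by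
  have hr := A.hr
  have hM : 0 < M := hm.trans_le hmM
  have hN1 : (1 : ℝ) ≤ A.N := by exact_mod_cast A.hN
  have hhd : DifferentiableOn ℂ h (complexNhd G ρ) := fun z hz =>
    (hR.h_holo z hz).differentiableAt.differentiableWithinAt
  have hcont : ContinuousOn (fun t => ‖I t - I t₀‖) S := fun t ht =>
    (((hO.deriv_I t (hSJ ht)).continuousWithinAt.mono hSJ).sub continuousWithinAt_const).norm
  have hκ' : A.Γ * (pertSize n σ Cf ε + A.c₀ * μ) / α ≤ 1 / 256 := by
    refine hκ.trans ?_
    rw [div_le_div_iff₀ (by positivity) (by positivity)]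
    linarith
  refine le_of_forall_uIcc_le hS hcont (b := A.r / 3) (by linarith) ht₀ (by simp; linarith)
    fun t ht hb => ?_
  set d := I t - I t₀ with hd
  set u : RVec n := E.starProjection d with hu
  set w : RVec n := d - u with hw
  have huE : u ∈ E := E.starProjection_apply_mem d
  have hwE : ∀ y ∈ E, inner ℝ w y = 0 := fun y hy => E.starProjection_inner_eq_zero d y hy
  have hul : ‖u‖ ≤ ‖d‖ := E.norm_starProjection_apply_le d
  have huIcc := hS.uIcc_subset ht₀ ht
  have hI1 : ∀ τ ∈ uIcc t₀ t, ‖I τ - I t₀‖ < A.r / 2 := fun τ hτ => by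
    have := hb τ hτ
    linarith
  have hinball : ∀ τ ∈ uIcc t₀ t, toC (I τ) ∈ ball (toC (I t₀)) A.r := fun τ hτ => by
    rw [mem_ball, dist_eq_norm, norm_toC_sub]
    have := hI1 τ hτ
    linarith
  have hxt := hinball t right_mem_uIcc
  have hx0 := hinball t₀ left_mem_uIcc
  -- the component orthogonal to the resonances
  have hwτ : ‖w‖ ≤ m * A.r / (32 * M) := by
    rcases eq_or_ne w 0 with h0 | h0
    · rw [h0, norm_zero]
      positivity
    have hwn : 0 < ‖w‖ := norm_pos_iff.2 h0
    set v : RVec n := ‖w‖⁻¹ • w with hv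
    have hvn : ‖v‖ ≤ 1 := by
      rw [hv, norm_smul, norm_inv, norm_norm, inv_mul_cancel₀ hwn.ne']
    have hvd : inner ℝ v d = ‖w‖ := by
      have : d = u + w := by rw [hw]; abel
      rw [this, inner_add_right, hv, inner_smul_left, inner_smul_left, hwE u huE,
        real_inner_self_eq_norm_sq]
      simp only [conj_trivial, mul_zero, zero_add]
      field_simp
    have h1 := abs_inner_sub_le hR hσ hε hμ hAc hAs hball hK hα hκ' hvn (fun k hk => by
      by_cases hkE : intVecR k ∈ E
      · left
        rw [hv, inner_smul_left, hwE _ hkE, mul_zero]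
      · exact Or.inr (hres k hk hkE)) hO (huIcc.trans hSJ) hI1
    rw [← hd, hvd, abs_of_nonneg hwn.le] at h1
    have h2 := htime t ht
    have hCf : 0 ≤ Cf := hR.Cf_nonneg (realPoint_mem hσ (hO.mem t₀ (hSJ ht₀)) (φ t₀) 0)
    have hS0 := expSum_nonneg n σ
    have he : 0 ≤ pertSize n σ Cf ε := by unfold pertSize; positivity
    have hc0 : 0 ≤ A.c₀ * μ := mul_nonneg A.c₀_pos.le hμ
    have h3 : 2 * (16 * A.K * pertSize n σ Cf ε / α) ≤ m * A.r / (64 * M) := by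
      have hΓ := A.Γ_pos
      have e1 : A.K * pertSize n σ Cf ε / α * A.N = A.r / 8 * (A.Γ * pertSize n σ Cf ε / α) := by
        unfold Frame.Γ; field_simp
      have e2 : A.K * pertSize n σ Cf ε / α ≤ A.K * pertSize n σ Cf ε / α * A.N :=
        le_mul_of_one_le_right (by positivity) hN1
      have e3 : A.Γ * pertSize n σ Cf ε / α ≤ m / (256 * M) := by
        refine le_trans ?_ hκ
        gcongr
        linarith
      calc 2 * (16 * A.K * pertSize n σ Cf ε / α) = 32 * (A.K * pertSize n σ Cf ε / α) := by ring
        _ ≤ 32 * (A.r / 8 * (m / (256 * M))) := by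
            rw [e1] at e2
            refine mul_le_mul_of_nonneg_left (e2.trans ?_) (by norm_num)
            exact mul_le_mul_of_nonneg_left e3 (by positivity)
        _ = _ := by field_simp; ring
    calc ‖w‖ ≤ m * A.r / (64 * M) + m * A.r / (64 * M) := h1.trans (add_le_add h3 h2)
      _ = _ := by field_simp; ring
  -- monotonicity of the frequencies
  have hseg : ∀ s ∈ Icc (0 : ℝ) 1, toC (I t₀ + s • (I t - I t₀)) ∈ complexNhd G ρ := by
    intro s hs
    refine hball ?_
    rw [mem_ball, dist_eq_norm, norm_toC_sub, add_sub_cancel_left, norm_smul,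
      Real.norm_of_nonneg hs.1]
    have e1 := hI1 t right_mem_uIcc
    have e2 : s * ‖I t - I t₀‖ ≤ ‖I t - I t₀‖ := mul_le_of_le_one_left (norm_nonneg _) hs.2
    linarith
  have hmono := le_abs_re_fderiv_toC_sub hhd hc hR.h_real hseg
  rw [← freqForm_apply, ← freqForm_apply, ← hd] at hmono
  have hsplit : freqForm h (I t) d - freqForm h (I t₀) d =
      (freqForm h (I t) u - freqForm h (I t₀) u) + (freqForm h (I t) w - freqForm h (I t₀) w) := by
    have : d = u + w := by rw [hw]; abel
    rw [this, map_add, map_add]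
    ring
  have hu1 : |freqForm h (I t) u - freqForm h (I t₀) u| ≤ 2 * δ * ‖u‖ := by
    have e1 := hEδ t ht (hb t right_mem_uIcc) u huE
    have e2 := hEδ t₀ ht₀ (by simp; linarith) u huE
    have e3 := abs_sub (freqForm h (I t) u) (freqForm h (I t₀) u)
    linarith
  have hw1 : |freqForm h (I t) w - freqForm h (I t₀) w| ≤ M * ‖w‖ * ‖d‖ := by
    have e1 := norm_fderiv_toC_sub_le hhd hc hball (convex_ball _ _) w hxt hx0
    rw [norm_toC_sub] at e1
    rw [freqForm_apply, freqForm_apply, ← Complex.sub_re]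
    exact (Complex.abs_re_le_norm _).trans e1
  have hδ0 : 0 ≤ δ * ‖u‖ := (abs_nonneg _).trans (hEδ t ht (hb t right_mem_uIcc) u huE)
  have htot : m * ‖d‖ ^ 2 ≤ m * (A.r / 4) * ‖d‖ := by
    rw [hsplit] at hmono
    have e1 := abs_add_le (freqForm h (I t) u - freqForm h (I t₀) u)
      (freqForm h (I t) w - freqForm h (I t₀) w)
    have e2 : 2 * δ * ‖u‖ ≤ m * A.r / 8 * ‖d‖ := by
      calc 2 * δ * ‖u‖ ≤ m * A.r / 8 * ‖u‖ :=
            mul_le_mul_of_nonneg_right (by linarith) (norm_nonneg u)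
        _ ≤ _ := mul_le_mul_of_nonneg_left hul (by positivity)
    have e3 : M * ‖w‖ * ‖d‖ ≤ m * A.r / 32 * ‖d‖ := by
      refine mul_le_mul_of_nonneg_right ?_ (norm_nonneg d)
      calc M * ‖w‖ ≤ M * (m * A.r / (32 * M)) := mul_le_mul_of_nonneg_left hwτ hM.le
        _ = _ := by field_simp
    have e4 : 0 ≤ m * A.r * ‖d‖ := by positivity
    linarith
  rcases (norm_nonneg d).eq_or_lt with h0 | h0
  · change ‖d‖ ≤ _
    rw [← h0]
    positivity
  · have : m * ‖d‖ * ‖d‖ ≤ m * (A.r / 4) * ‖d‖ := by nlinarith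
    exact le_of_mul_le_mul_left (le_of_mul_le_mul_right this h0) hm

end

end AperiodicNekhoroshev

namespace AperiodicNekhoroshev

noncomputable section

open Metric Set Filter Topology

/-! ### Confinement -/

variable {n : ℕ} {G : Set (RVec n)} {ρ σ Cf M m ε μ : ℝ} {h : CVec n → ℂ}
  {f : CVec n × CVec n × ℂ → ℂ}

/-- **Confinement.** As long as an orbit remains in the domain, it is trapped near its point of least
resonance, at the scale `δ j` of that resonance. The assumption `hE` is the smallness of the
perturbation compared with the finest scale, `hδn` the smallness of the coarsest scale compared with
the domain, and `hT` the smallness of the drift of the almost integrals in the time considered. -/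
theorem norm_sub_le_of_scales (hR : RegularityHyp G ρ σ Cf h f) (hc : ConvexityHyp G ρ M m h)
    (hρ1 : ρ ≤ 1) (hσ : 0 < σ) (hm : 0 < m) (hmM : m ≤ M) (hε : 0 < ε) (hμ : 0 ≤ μ)
    {J : Set ℝ} {I φ : ℝ → RVec n} (hO : IsOrbit G ρ h f ε μ J I φ) {t₀ : ℝ}
    (hJ : J.OrdConnected) (ht₀ : t₀ ∈ J) (hG : I t₀ ∈ G)
    {N K : ℕ} (hN : 1 ≤ N) (hK : 1 ≤ K) (hKσ : Real.exp (-(σ / 2 * K)) ≤ 1 / 16)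
    {C : ℝ} (hC : 128 * M ≤ C * m) {δ : ℕ → ℝ} (hδ0 : 0 < δ 0)
    (hδ : ∀ j, δ (j + 1) = C * ((N * K : ℕ) : ℝ) ^ (j + 1) * δ j)
    (hE : 65536 * M ^ 2 * (pertSize n σ Cf ε + μ / (4 * σ)) ≤ m * C ^ 2 * δ 0 ^ 2)
    (hδn : C * δ n / (8 * M) ≤ ρ / 4) {T : ℝ}
    (hT : pertSize n σ Cf ε * (1 / 2) ^ N * (K + n * (K + 4 / (σ / 2))) * (2 * T) ≤
      m * (C * δ 0 / (8 * M)) / (64 * M)) :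
    ∀ t ∈ J, |t - t₀| < T → ‖I t - I t₀‖ ≤ C * δ n / (16 * M) := by
  have hM : 0 < M := hm.trans_le hmM
  have hC128 : 128 ≤ C := by
    by_contra! h1
    nlinarith
  have hC0 : 0 < C := by linarith
  have hNK : (1 : ℝ) ≤ ((N * K : ℕ) : ℝ) := by exact_mod_cast Nat.mul_pos hN hK
  set L : ℝ := ((N * K : ℕ) : ℝ) with hL
  have hL0 : 0 < L := by linarith
  have hpow : ∀ j : ℕ, (1 : ℝ) ≤ L ^ j := fun j => one_le_pow₀ hNK
  have hδp : ∀ j, 0 < δ j := by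
    intro j
    induction j with
    | zero => exact hδ0
    | succ j ih => rw [hδ]; positivity
  have hδm : Monotone δ := monotone_nat_of_le_succ fun j => by
    rw [hδ]
    refine le_mul_of_one_le_left (hδp j).le ?_
    have := hpow (j + 1)
    nlinarith
  have hCf : 0 ≤ Cf := hR.Cf_nonneg (realPoint_mem hσ (hO.mem t₀ ht₀) (φ t₀) 0)
  have hS0 := expSum_nonneg n σ
  have he : 0 ≤ pertSize n σ Cf ε := by unfold pertSize; positivity
  have hρ0 : 0 < ρ := by
    have := hδp n
    have : 0 < C * δ n / (8 * M) := by positivity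
    linarith
  have hhd : DifferentiableOn ℂ h (complexNhd G ρ) := fun z hz =>
    (hR.h_holo z hz).differentiableAt.differentiableWithinAt
  have hSc : (J ∩ {t | |t - t₀| < T}).OrdConnected := by
    have e1 : {t : ℝ | |t - t₀| < T} = ball t₀ T := by
      ext t; simp [Real.dist_eq]
    rw [e1, Real.ball_eq_Ioo]
    exact hJ.inter ordConnected_Ioo
  intro t ht htT
  have hT0 : 0 < T := (abs_nonneg _).trans_lt htT
  have hcont : ContinuousOn (fun t => ‖I t - I t₀‖) (J ∩ {t | |t - t₀| < T}) := fun t ht =>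
    (((hO.deriv_I t ht.1).continuousWithinAt.mono inter_subset_left).sub
      continuousWithinAt_const).norm
  refine le_of_forall_uIcc_le hSc hcont (b := ρ / 4) ?_ (t₀ := t₀) ⟨ht₀, by simpa using hT0⟩
    (by simp only [sub_self, norm_zero]; have := hδp n; positivity) ?_ t ⟨ht, htT⟩
  · have : C * δ n / (16 * M) = C * δ n / (8 * M) / 2 := by field_simp; ring
    rw [this]
    linarith
  clear ht htT t
  rintro t ⟨ht, htT⟩ hb
  have huJ : uIcc t₀ t ⊆ J := hJ.uIcc_subset ht₀ ht
  have hne : Nonempty (uIcc t₀ t) := ⟨⟨t₀, left_mem_uIcc⟩⟩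
  -- the orbit visits a point of least resonance at the time `s`, between `t₀` and `t`
  obtain ⟨j, hjn, ⟨s, hs⟩, E, hE1, hE2⟩ :=
    exists_resonant_block (T := uIcc t₀ t) (fun τ => freqForm h (I τ)) (K := N * K) (δ := δ)
      (fun j => by
        rw [hδ, ← hL]
        have := hδp j
        gcongr
        linarith) (fun j => (hδp j).le)
  have hδj := hδp j
  have hr : 0 < C * δ j / (8 * M) := by positivity
  have hrn : C * δ j / (8 * M) ≤ C * δ n / (8 * M) := by
    have := hδm hjn
    gcongr
  -- in the complex ball of radius `C δ j / (8 M)`, the pairings of the frequency with the integer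
  -- vectors up to order `N K` change by at most half of the lower bound `α = C N K δ j / 4`
  let A : Frame n :=
    { c := toC (I s), r := C * δ j / (8 * M), s := 2 * σ, N := N, K := K, hr := hr,
      hs := by positivity, hN := hN, hK := hK }
  have hball : ball (toC (I s)) A.r ⊆ complexNhd G ρ :=
    ball_subset_complexNhd hG (hb s hs) (by change ρ / 4 + C * δ j / (8 * M) ≤ ρ; linarith)
  have hα : 0 < C * L * δ j / 4 := by positivity
  have hAr : M * L * A.r = C * L * δ j / 8 := by
    change M * L * (C * δ j / (8 * M)) = _
    field_simp
  have hkn : ∀ k : Fin n → ℤ, l1 k ≤ N * K → ‖intVecR k‖ ≤ L := fun k hk =>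
    (norm_intVecR_le k).trans (by rw [hL]; exact_mod_cast hk)
  have hlow : ∀ k : Fin n → ℤ, l1 k ≤ N * K → intVecR k ∉ E →
      2 * (C * L * δ j / 4) ≤ |freqForm h (I s) (intVecR k)| := fun k hk hkE => by
    refine le_trans (le_of_eq ?_) (hE1 k hk hkE)
    rw [hδ, ← hL]
    field_simp
    ring
  have hx0 : toC (I s) ∈ ball (toC (I s)) A.r := mem_ball_self hr
  have hvar : ∀ k : Fin n → ℤ, l1 k ≤ N * K → ∀ z ∈ ball (toC (I s)) A.r,
      ‖fderiv ℂ h z (toC (intVecR k)) - fderiv ℂ h (toC (I s)) (toC (intVecR k))‖ ≤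
        C * L * δ j / 8 := fun k hk z hz => by
    refine (norm_fderiv_toC_sub_le hhd hc hball (convex_ball _ _) _ hz hx0).trans ?_
    rw [← hAr]
    have := hkn k hk
    have h2 := (mem_ball_iff_norm.1 hz).le
    gcongr
  have htot := norm_sub_le_of_resonant hR hc hσ hm hmM hε hμ (A := A) (S := uIcc t₀ t) hO rfl rfl
    hball hKσ hα ?_ (E := E) (fun k hk hkE z hz => ?_) huJ ordConnected_uIcc hs (fun τ hτ => ?_)
    (δ := δ j) ?_ (fun τ hτ hτr => ?_)
  · have e1 := htot t right_mem_uIcc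
    have e2 := htot t₀ left_mem_uIcc
    have e3 : ‖I t - I t₀‖ ≤ ‖I t - I s‖ + ‖I t₀ - I s‖ := by
      have : I t - I t₀ = (I t - I s) - (I t₀ - I s) := by abel
      rw [this]
      exact norm_sub_le _ _
    have e4 : C * δ n / (16 * M) = C * δ n / (8 * M) / 2 := by field_simp; ring
    have e5 : A.r = C * δ j / (8 * M) := rfl
    rw [e4]
    linarith
  · have hΓ : A.Γ = 64 * M * L / (C * δ j) := by
      unfold Frame.Γ
      change 8 * (N : ℝ) * K / (C * δ j / (8 * M)) = _
      rw [hL, Nat.cast_mul]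
      field_simp
      ring
    have hc₀ : A.c₀ ≤ 1 / (4 * σ) := by
      rw [A.c₀_eq]
      change C * δ j / (8 * M) / (2 * K * (2 * σ)) ≤ _
      have hK1 : (1 : ℝ) ≤ K := by exact_mod_cast hK
      rw [div_le_div_iff₀ (by positivity) (by positivity)]
      have : C * δ j / (8 * M) ≤ 1 := by linarith
      nlinarith
    have e1 : pertSize n σ Cf ε + A.c₀ * μ ≤ pertSize n σ Cf ε + μ / (4 * σ) := by
      have : A.c₀ * μ ≤ 1 / (4 * σ) * μ := mul_le_mul_of_nonneg_right hc₀ hμ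
      have e : 1 / (4 * σ) * μ = μ / (4 * σ) := by ring
      linarith
    have e2 : m * C ^ 2 * δ 0 ^ 2 ≤ m * C ^ 2 * δ j ^ 2 := by
      have := hδm (Nat.zero_le j)
      gcongr
    have e3 : 65536 * M ^ 2 * (pertSize n σ Cf ε + A.c₀ * μ) ≤ m * C ^ 2 * δ j ^ 2 := by
      refine le_trans ?_ (hE.trans e2)
      gcongr
    rw [hΓ, div_le_div_iff₀ hα (by positivity)]
    have e4 : 64 * M * L / (C * δ j) * (pertSize n σ Cf ε + A.c₀ * μ) * (256 * M) =
        65536 * M ^ 2 * (pertSize n σ Cf ε + A.c₀ * μ) * (L / (C * δ j)) / 4 := by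
      field_simp
      ring
    rw [e4]
    have e5 : m * (C * L * δ j / 4) = m * C ^ 2 * δ j ^ 2 * (L / (C * δ j)) / 4 := by
      field_simp
    rw [e5]
    gcongr
  · have e1 := hlow k hk hkE
    have e2 := hvar k hk z hz
    rw [← toC_intVecR]
    have e3 := (Complex.abs_re_le_norm (fderiv ℂ h (toC (I s)) (toC (intVecR k))))
    rw [← freqForm_apply] at e3
    have e4 := norm_sub_norm_le (fderiv ℂ h (toC (I s)) (toC (intVecR k)))
      (fderiv ℂ h z (toC (intVecR k)))
    rw [norm_sub_rev] at e4
    linarith only [e1, e2, e3, e4, hα]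
  · have e1 : |τ - s| ≤ 2 * T := by
      have h1 : |τ - s| ≤ |t - t₀| := by
        exact abs_sub_le_of_uIcc_subset_uIcc (uIcc_subset_uIcc hs hτ)
      have h2 : |t - t₀| < T := htT
      linarith only [h1, h2, hT0]
    have e2 : (m * (C * δ 0 / (8 * M)) / (64 * M)) ≤ m * A.r / (64 * M) := by
      change _ ≤ m * (C * δ j / (8 * M)) / (64 * M)
      have := hδm (Nat.zero_le j)
      gcongr
    refine le_trans ?_ (hT.trans e2)
    unfold driftRate
    change pertSize n σ Cf ε * (1 / 2) ^ N * (K + n * (K + 4 / (σ / 2))) * |τ - s| ≤ _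
    gcongr
  · change 16 * δ j ≤ m * (C * δ j / (8 * M))
    rw [← mul_div_assoc, le_div_iff₀ (by positivity)]
    nlinarith
  · refine hE2 ⟨τ, hτ⟩ fun k hk hkE => ?_
    change L * δ j < |freqForm h (I τ) (intVecR k)|
    have hz : toC (I τ) ∈ ball (toC (I s)) A.r := by
      rw [mem_ball_iff_norm, norm_toC_sub]
      have : 0 < A.r := hr
      linarith
    have e1 := hlow k hk hkE
    have e2 := (Complex.abs_re_le_norm _).trans (hvar k hk _ hz)
    rw [Complex.sub_re, ← freqForm_apply, ← freqForm_apply] at e2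
    have e4 := abs_sub_abs_le_abs_sub (freqForm h (I s) (intVecR k)) (freqForm h (I τ) (intVecR k))
    rw [abs_sub_comm] at e4
    have e5 : 128 * (L * δ j) ≤ C * (L * δ j) := by gcongr
    have e6 : 0 < L * δ j := by positivity
    have e7 : C * (L * δ j) = C * L * δ j := by ring
    rw [e7] at e5
    linarith only [e1, e2, e4, e5, e6]

end

end AperiodicNekhoroshev

namespace AperiodicNekhoroshev

noncomputable section

open Metric Set Filter Topology

/-! ### The constants -/

variable {n : ℕ} {G : Set (RVec n)} {ρ σ Cf M m ε μ : ℝ} {h : CVec n → ℂ}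
  {f : CVec n × CVec n × ℂ → ℂ}

theorem mul_le_lam (hσ : 0 < σ) (hCf : 0 ≤ Cf) (hε : 0 < ε) (hμ : 0 ≤ μ) :
    ε * Cf ≤ lam n σ Cf ε μ := by
  have hx : Real.exp (-(σ / 2)) < 1 := by
    rw [Real.exp_lt_one_iff]
    linarith
  have hx0 := Real.exp_pos (-(σ / 2))
  have h1 : 1 ≤ (1 + Real.exp (-(σ / 2))) / (1 - Real.exp (-(σ / 2))) := by
    rw [le_div_iff₀ (by linarith)]
    linarith
  have h2 : 1 ≤ Real.exp 1 := Real.one_le_exp (by norm_num)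
  have h3 := one_le_pow₀ h1 (n := n)
  have h4 : Cf ≤ Ftilde n σ Cf := le_mul_of_one_le_right hCf h3
  have h5 : Ftilde n σ Cf ≤ Real.exp 1 * Ftilde n σ Cf :=
    le_mul_of_one_le_left (hCf.trans h4) h2
  unfold lam
  nlinarith

theorem exp_neg_le_of_ceil (hσ : 0 < σ) : Real.exp (-(σ / 2 * ⌈6 / σ⌉₊)) ≤ 1 / 16 := by
  have h1 : 6 / σ ≤ ⌈6 / σ⌉₊ := Nat.le_ceil _
  have h2 : (3 : ℝ) ≤ σ / 2 * ⌈6 / σ⌉₊ := by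
    rw [div_le_iff₀ hσ] at h1
    linarith
  have h3 : Real.exp (-(σ / 2 * ⌈6 / σ⌉₊)) ≤ Real.exp (-3) := Real.exp_le_exp.2 (by linarith)
  refine h3.trans ?_
  rw [Real.exp_neg, ← one_div]
  have h4 : (2.7 : ℝ) ≤ Real.exp 1 := by
    have := Real.exp_one_gt_d9
    linarith
  have h5 : Real.exp 3 = Real.exp 1 ^ 3 := by
    rw [← Real.exp_nat_mul]
    norm_num
  have h6 : (2.7 : ℝ) ^ 3 ≤ Real.exp 1 ^ 3 := by gcongr
  refine one_div_le_one_div_of_le (by norm_num) ?_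
  rw [h5]
  refine le_trans ?_ h6
  norm_num

theorem half_pow_ceil_le {s : ℝ} : ((1 : ℝ) / 2) ^ ⌈4 * s⌉₊ ≤ Real.exp (-(2 * s)) := by
  have h1 : (1 : ℝ) / 2 = Real.exp (-Real.log 2) := by
    rw [Real.exp_neg, Real.exp_log (by norm_num), one_div]
  have h2 : 4 * s ≤ ⌈4 * s⌉₊ := Nat.le_ceil _
  rw [h1, ← Real.exp_nat_mul]
  refine Real.exp_le_exp.2 ?_
  have h3 := Real.log_two_gt_d9
  have h4 : (0 : ℝ) ≤ ⌈4 * s⌉₊ := Nat.cast_nonneg _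
  nlinarith

/-- The scales of the resonances: the solution of `δ (j + 1) = C L^{j + 1} δ j` with `δ 0 = δ₀`. -/
def resScale (C L δ₀ : ℝ) (j : ℕ) : ℝ := C ^ j * L ^ (∑ i ∈ Finset.range (j + 1), i) * δ₀

theorem resScale_zero (C L δ₀ : ℝ) : resScale C L δ₀ 0 = δ₀ := by
  simp [resScale]

theorem resScale_succ (C L δ₀ : ℝ) (j : ℕ) :
    resScale C L δ₀ (j + 1) = C * L ^ (j + 1) * resScale C L δ₀ j := by
  rw [resScale, resScale, Finset.sum_range_succ _ (j + 1), pow_add L, pow_succ]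
  ring

set_option maxHeartbeats 1000000 in
/-- With the constants of the theorem, the orbits stay within the asserted distance of their
initial actions. With `b = n (n + 1) / 2` and `s = (Δλ)^{-1/(4b)}`, the normal form is taken up to
order `N ∼ s`, so that its remainder is `O(e^{-2s})`, while the scales of the resonances range from
`(Δλ)^{1/2}` to `N^b (Δλ)^{1/2} ∼ (Δλ)^{1/4}`. -/
theorem exists_confinement (n : ℕ) (hn : 1 ≤ n) (Cf : ℝ) (hρ : 0 < ρ) (hρ1 : ρ ≤ 1)
    (hσ : 0 < σ) (hm : 0 < m) (hmM : m ≤ M) :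
    ∃ Δs T : ℝ, 0 < Δs ∧ 0 < T ∧
      ∀ (G : Set (RVec n)) (h : CVec n → ℂ) (f : CVec n × CVec n × ℂ → ℂ),
        RegularityHyp G ρ σ Cf h f → ConvexityHyp G ρ M m h →
        ∀ ε μ : ℝ, 0 < ε → 0 ≤ μ → 0 < lam n σ Cf ε μ → lam n σ Cf ε μ < 1 / (3 ^ 4 * Δs) →
          ∀ (J : Set ℝ) (t₀ : ℝ) (I φ : ℝ → RVec n), J.OrdConnected → t₀ ∈ J →
            IsOrbit G ρ h f ε μ J I φ → I t₀ ∈ G →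
            ∀ t ∈ J, |t - t₀| < stabilityTime n Δs T ε (lam n σ Cf ε μ) →
              ‖I t - I t₀‖ ≤ (Δs * lam n σ Cf ε μ) ^ (1 / 4 : ℝ) * (ρ / 8) := by
  have hM : 0 < M := hm.trans_le hmM
  set b := ∑ i ∈ Finset.range (n + 1), i with hb
  have hb2 : ((2 * b : ℕ) : ℝ) = (n : ℝ) ^ 2 + n := by
    rw [mul_comm, hb, Finset.sum_range_id_mul_two]
    rw [Nat.add_sub_cancel]
    push_cast
    ring
  have hb0 : 0 < b := by
    by_contra! hb'
    have h1 : b = 0 := by omega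
    rw [h1] at hb2
    have h2 : (1 : ℝ) ≤ n := by exact_mod_cast hn
    push_cast at hb2
    nlinarith
  set K := ⌈6 / σ⌉₊
  have hK : 1 ≤ K := Nat.ceil_pos.2 (by positivity)
  have hKσ : Real.exp (-(σ / 2 * K)) ≤ 1 / 16 := exp_neg_le_of_ceil hσ
  clear_value K
  have hK1 : (1 : ℝ) ≤ K := by exact_mod_cast hK
  have hS := expSum_nonneg n σ
  set S := expSum n σ with hSdef
  set C : ℝ := 128 * M / m with hCdef
  have hC0 : 0 < C := by positivity
  -- the scale `δ 0` is `d (Δλ)^{1/2}`; this value of `d` makes `δ n` small enough for the domain,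
  -- since `N K ≤ 5 K s`
  set d : ℝ := 2 * M * ρ / (C ^ (n + 1) * (5 * K) ^ b) with hd
  have hd0 : 0 < d := by positivity
  -- equality in the smallness condition of the normal form on the scale `δ 0`
  set Δs : ℝ := 65536 * M ^ 2 * (S + 1 / (4 * σ)) / (m * C ^ 2 * d ^ 2) with hΔ
  have hΔ0 : 0 < Δs := by positivity
  set P : ℝ := K + n * (K + 4 / (σ / 2)) with hP
  have hP0 : 0 < P := by positivity
  -- the factorial comes from `s^{2b} / (2b)! ≤ e^s`, which bounds the drift by `δ 0 ∼ s^{-2b}`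
  set T : ℝ := m * C * d / (1024 * M ^ 2 * ((|Cf| + 1) * (S + 1) * P * (2 * b).factorial)) with hT
  have hT0 : 0 < T := by positivity
  clear_value b S C d Δs P T
  refine ⟨Δs, T, hΔ0, hT0, ?_⟩
  intro G h f hR hc ε μ hε hμ hl0 hl1 J t₀ I φ hJ ht₀ hO hG t ht htT
  set l := lam n σ Cf ε μ with hl
  have hCf : 0 ≤ Cf := hR.Cf_nonneg (realPoint_mem hσ (hO.mem t₀ ht₀) (φ t₀) 0)
  have hx0 : 0 < Δs * l := by positivity
  have hx1 : Δs * l < 1 := by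
    rw [lt_div_iff₀ (by positivity)] at hl1
    nlinarith
  set y := (Δs * l) ^ (1 / 4 : ℝ) with hy
  have hy0 : 0 < y := Real.rpow_pos_of_pos hx0 _
  have hy1 : y ≤ 1 := Real.rpow_le_one hx0.le hx1.le (by norm_num)
  have hy4 : y ^ 4 = Δs * l := by
    rw [hy, ← Real.rpow_natCast, ← Real.rpow_mul hx0.le]
    norm_num
  set s := (1 / (Δs * l)) ^ (1 / (2 * ((n : ℝ) ^ 2 + (n : ℝ)))) with hs
  have hs1 : 1 ≤ s := Real.one_le_rpow (one_le_one_div hx0 hx1.le) (by positivity)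
  have hsy : s ^ b * y = 1 := by
    rw [hs, ← hb2, ← Real.rpow_natCast, ← Real.rpow_mul (by positivity), one_div (Δs * l),
      Real.inv_rpow hx0.le]
    have : 1 / (2 * ((2 * b : ℕ) : ℝ)) * b = 1 / 4 := by
      have : (b : ℝ) ≠ 0 := by exact_mod_cast hb0.ne'
      push_cast
      field_simp
      norm_num
    rw [this, ← hy]
    exact inv_mul_cancel₀ hy0.ne'
  set N := ⌈4 * s⌉₊ with hN
  have hN1 : 1 ≤ N := Nat.ceil_pos.2 (by linarith)
  have hN5 : (N : ℝ) ≤ 5 * s := by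
    have := Nat.ceil_lt_add_one (a := 4 * s) (by linarith)
    linarith
  set L : ℝ := ((N * K : ℕ) : ℝ) with hL
  have hL0 : 0 ≤ L := Nat.cast_nonneg _
  have hL5 : L ≤ 5 * K * s := by
    rw [hL]
    push_cast
    nlinarith
  have hδn : C * resScale C L (d * y ^ 2) n / (8 * M) ≤ y * (ρ / 4) := by
    have h1 : L ^ b ≤ (5 * K) ^ b * s ^ b := by
      rw [← mul_pow]
      gcongr
    have h2 : C * resScale C L (d * y ^ 2) n ≤
        C ^ (n + 1) * ((5 * K) ^ b * s ^ b) * (d * y ^ 2) := by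
      unfold resScale
      rw [← hb]
      calc C * (C ^ n * L ^ b * (d * y ^ 2)) = C ^ (n + 1) * L ^ b * (d * y ^ 2) := by ring
        _ ≤ _ := by gcongr
    have h3 : C ^ (n + 1) * ((5 * K) ^ b * s ^ b) * (d * y ^ 2) =
        C ^ (n + 1) * (5 * K) ^ b * d * y * (s ^ b * y) := by ring
    have h4 : C ^ (n + 1) * (5 * K) ^ b * d = 2 * M * ρ := by
      rw [hd]
      field_simp
    rw [h3, hsy, h4] at h2
    rw [div_le_iff₀ (by positivity)]
    linarith
  have hhalf : (1 / 2 : ℝ) ^ N ≤ Real.exp (-(2 * s)) := half_pow_ceil_le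
  clear_value s y N
  have hmain := norm_sub_le_of_scales hR hc hρ1 hσ hm hmM hε hμ hO hJ ht₀ hG hN1 hK
    hKσ (C := C) (by rw [hCdef]; field_simp; rfl)
    (δ := resScale C L (d * y ^ 2)) (by rw [resScale_zero]; positivity) (resScale_succ C L _)
    ?_ ?_ ?_ t ht htT
  · refine hmain.trans ?_
    have : C * resScale C L (d * y ^ 2) n / (16 * M) =
      C * resScale C L (d * y ^ 2) n / (8 * M) / 2 := by field_simp; ring
    rw [this]
    linarith
  · rw [resScale_zero]
    have h1 : m * C ^ 2 * (d * y ^ 2) ^ 2 = m * C ^ 2 * d ^ 2 * y ^ 4 := by ring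
    have h2 : m * C ^ 2 * d ^ 2 * (Δs * l) = 65536 * M ^ 2 * ((S + 1 / (4 * σ)) * l) := by
      rw [hΔ]
      field_simp
    rw [h1, hy4, h2]
    have h3 : ε * Cf ≤ l := mul_le_lam hσ hCf hε hμ
    have h4 : μ ≤ l := by
      rw [hl]
      unfold lam Ftilde
      have hx : Real.exp (-(σ / 2)) < 1 := by
        rw [Real.exp_lt_one_iff]
        linarith
      have : 0 < 1 - Real.exp (-(σ / 2)) := by linarith
      have : 0 ≤ Real.exp 1 * (Cf * ((1 + Real.exp (-(σ / 2))) / (1 - Real.exp (-(σ / 2)))) ^ n)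
        * ε := by positivity
      linarith
    have h5 : pertSize n σ Cf ε + μ / (4 * σ) ≤ (S + 1 / (4 * σ)) * l := by
      unfold pertSize
      rw [← hSdef]
      have e1 : ε * Cf * S ≤ l * S := by gcongr
      have e2 : μ / (4 * σ) ≤ l / (4 * σ) := by gcongr
      have e3 : (S + 1 / (4 * σ)) * l = l * S + l / (4 * σ) := by ring
      rw [e3]
      exact add_le_add e1 e2
    gcongr
  · exact hδn.trans (mul_le_of_le_one_left (by positivity) hy1)
  · rw [resScale_zero]
    unfold stabilityTime pertSize
    rw [← hs, ← hP, ← hSdef]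
    have h2 : s ^ (2 * b) / (2 * b).factorial ≤ Real.exp s :=
      Real.pow_div_factorial_le_exp s (by linarith) _
    have h3 : Real.exp (-(2 * s)) * Real.exp s = Real.exp (-s) := by
      rw [← Real.exp_add]
      congr 1
      ring
    have h4 : Real.exp (-s) ≤ (2 * b).factorial * y ^ 2 := by
      rw [Real.exp_neg, inv_le_comm₀ (Real.exp_pos s) (by positivity)]
      refine le_trans (le_of_eq ?_) h2
      have : s ^ (2 * b) * y ^ 2 = 1 := by
        rw [mul_comm 2 b, pow_mul, ← mul_pow, hsy, one_pow]
      field_simp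
      linarith
    have h5 : Cf * S ≤ (|Cf| + 1) * (S + 1) := by
      have : Cf ≤ |Cf| + 1 := by linarith [le_abs_self Cf]
      gcongr
      linarith
    calc ε * Cf * S * (1 / 2) ^ N * P * (2 * (T / ε * Real.exp s))
        ≤ ε * Cf * S * Real.exp (-(2 * s)) * P * (2 * (T / ε * Real.exp s)) := by gcongr
      _ = Cf * S * P * 2 * T * (Real.exp (-(2 * s)) * Real.exp s) := by field_simp
      _ ≤ ((|Cf| + 1) * (S + 1)) * P * 2 * T * ((2 * b).factorial * y ^ 2) := by
          rw [h3]
          gcongr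
      _ = _ := by
          rw [hT]
          field_simp
          ring

end

end AperiodicNekhoroshev

namespace AperiodicNekhoroshev

noncomputable section

open Metric Set Filter Topology
open scoped NNReal

/-! ### Existence of orbits -/

section Lipschitz

variable {X W W' : Type*} [NormedAddCommGroup X] [NormedAddCommGroup W] [NormedAddCommGroup W']

/-- The function `u` is bounded and Lipschitz, with a common constant. -/
def BddLip (u : X → W) : Prop :=
  ∃ B : ℝ, (∀ x, ‖u x‖ ≤ B) ∧ ∀ x y, ‖u x - u y‖ ≤ B * ‖x - y‖

theorem BddLip.const (w : W) : BddLip fun _ : X => w :=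
  ⟨‖w‖, fun _ => le_rfl, fun x y => by
    rw [sub_self, norm_zero]
    positivity⟩

theorem BddLip.add {u v : X → W} (hu : BddLip u) (hv : BddLip v) : BddLip fun x => u x + v x := by
  obtain ⟨B, h1, h2⟩ := hu
  obtain ⟨B', h1', h2'⟩ := hv
  refine ⟨B + B', fun x => (norm_add_le _ _).trans (add_le_add (h1 x) (h1' x)), fun x y => ?_⟩
  rw [add_sub_add_comm, add_mul]
  exact (norm_add_le _ _).trans (add_le_add (h2 x y) (h2' x y))

theorem BddLip.neg {u : X → W} (hu : BddLip u) : BddLip fun x => -u x := by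
  obtain ⟨B, h1, h2⟩ := hu
  refine ⟨B, fun x => by rw [norm_neg]; exact h1 x, fun x y => ?_⟩
  rw [← neg_sub', norm_neg]
  exact h2 x y

theorem BddLip.sum {ι : Type*} (s : Finset ι) {u : ι → X → W} (hu : ∀ i, BddLip (u i)) :
    BddLip fun x => ∑ i ∈ s, u i x := by
  classical
  induction s using Finset.induction_on with
  | empty => simpa using BddLip.const (0 : W)
  | insert i s hi ih => simpa [Finset.sum_insert hi] using (hu i).add ih

theorem BddLip.prodMk {u : X → W} {v : X → W'} (hu : BddLip u) (hv : BddLip v) :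
    BddLip fun x => (u x, v x) := by
  obtain ⟨B, h1, h2⟩ := hu
  obtain ⟨B', h1', h2'⟩ := hv
  refine ⟨max B B', fun x => max_le_max (h1 x) (h1' x), fun x y => ?_⟩
  rw [Prod.mk_sub_mk, Prod.norm_mk]
  refine max_le ((h2 x y).trans ?_) ((h2' x y).trans ?_)
  · gcongr
    exact le_max_left _ _
  · gcongr
    exact le_max_right _ _

theorem BddLip.clm_comp [NormedSpace ℝ W] [NormedSpace ℝ W'] {u : X → W} (hu : BddLip u)
    (L : W →L[ℝ] W') : BddLip fun x => L (u x) := by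
  obtain ⟨B, h1, h2⟩ := hu
  refine ⟨‖L‖ * B, fun x => (L.le_opNorm _).trans ?_, fun x y => ?_⟩
  · gcongr
    exact h1 x
  · rw [← map_sub, mul_assoc]
    refine (L.le_opNorm _).trans ?_
    gcongr
    exact h2 x y

theorem BddLip.toLp {n : ℕ} {u : Fin n → X → ℝ} (hu : ∀ j, BddLip (u j)) :
    BddLip fun x => (WithLp.toLp 2 fun j => u j x : RVec n) := by
  have h : (fun x => (WithLp.toLp 2 fun j => u j x : RVec n)) =
      fun x => ∑ j, ContinuousLinearMap.toSpanSingleton ℝ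
        (EuclideanSpace.single j 1 : RVec n) (u j x) := by
    funext x
    ext i
    simp [Finset.sum_apply, Pi.single_apply]
  rw [h]
  exact BddLip.sum _ fun j => (hu j).clm_comp _

/-- The solutions of a bounded Lipschitz differential equation are global. -/
theorem BddLip.exists_solution [NormedSpace ℝ X] [CompleteSpace X] {V : X → X} (hV : BddLip V)
    (x₀ : X) (t₀ : ℝ) {T : ℝ} (hT : 0 ≤ T) : ∃ α : ℝ → X, α t₀ = x₀ ∧
      ∀ t ∈ Icc (t₀ - T) (t₀ + T), HasDerivWithinAt α (V (α t)) (Icc (t₀ - T) (t₀ + T)) t := by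
  obtain ⟨B, h1, h2⟩ := hV
  have hB : 0 ≤ B := (norm_nonneg _).trans (h1 0)
  lift B to ℝ≥0 using hB
  lift T to ℝ≥0 using hT
  have hP : IsPicardLindelof (fun _ => V) (tmin := t₀ - T) (tmax := t₀ + T)
      ⟨t₀, by simp⟩ x₀ (B * T) 0 B B := by
    refine .of_time_independent (fun x _ => h1 x) ?_ (by simp)
    refine LipschitzOnWith.of_dist_le_mul fun x _ y _ => ?_
    rw [dist_eq_norm, dist_eq_norm]
    exact h2 x y
  exact hP.exists_eq_forall_mem_Icc_hasDerivWithinAt₀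

end Lipschitz

/-- A nonexpansive retraction onto a ball. -/
theorem exists_retraction {F : Type*} [NormedAddCommGroup F] [InnerProductSpace ℝ F]
    [CompleteSpace F] (c : F) {R : ℝ} (hR : 0 ≤ R) : ∃ p : F → F,
      (∀ x, p x ∈ closedBall c R) ∧ (∀ x ∈ closedBall c R, p x = x) ∧
      ∀ x y, ‖p x - p y‖ ≤ ‖x - y‖ := by
  have hconv := convex_closedBall c R
  have hex := exists_norm_eq_iInf_of_complete_convex (K := closedBall c R)
    ⟨c, mem_closedBall_self hR⟩
    isClosed_closedBall.isComplete hconv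
  choose p hp hp2 using hex
  have hin : ∀ x, ∀ w ∈ closedBall c R, inner ℝ (x - p x) (w - p x) ≤ 0 := fun x =>
    (norm_eq_iInf_iff_real_inner_le_zero hconv (hp x)).1 (hp2 x)
  refine ⟨p, hp, fun x hx => ?_, fun x y => ?_⟩
  · have h1 := hin x x hx
    rw [real_inner_self_nonpos, sub_eq_zero] at h1
    exact h1.symm
  · have h1 := hin x (p y) (hp y)
    have h2 := hin y (p x) (hp x)
    have h3 : inner ℝ (x - p x) (p y - p x) + inner ℝ (y - p y) (p x - p y) =
        ‖p x - p y‖ ^ 2 - inner ℝ (x - y) (p x - p y) := by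
      rw [← real_inner_self_eq_norm_sq, ← neg_sub (p x) (p y), inner_neg_right]
      simp only [inner_sub_left]
      ring
    have h4 := real_inner_le_norm (x - y) (p x - p y)
    rcases (norm_nonneg (p x - p y)).eq_or_lt with h0 | h0
    · rw [← h0]
      exact norm_nonneg _
    · refine le_of_mul_le_mul_right ?_ h0
      nlinarith

/-- Cauchy's estimates: at a distance from the boundary, the directional derivatives of a bounded
holomorphic function are bounded and Lipschitz. -/
theorem bddLip_fderiv_apply {E X : Type*} [NormedAddCommGroup E] [NormedSpace ℂ E]
    [FiniteDimensional ℂ E] [NormedAddCommGroup X] {U Q : Set E} (hU : IsOpen U) {g : E → ℂ}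
    (hg : DifferentiableOn ℂ g U) {B : ℝ} (hB : ∀ z ∈ U, ‖g z‖ ≤ B) (hQ : Convex ℝ Q) {r : ℝ}
    (hr : 0 < r) (hQU : ∀ z ∈ Q, closedBall z (2 * r) ⊆ U) {w : E} (hw : ‖w‖ ≤ 1) {q : X → E}
    (hq : ∀ x, q x ∈ Q) (hql : ∀ x y, ‖q x - q y‖ ≤ ‖x - y‖) :
    BddLip fun x => fderiv ℂ g (q x) w := by
  have h1 : ∀ z, closedBall z r ⊆ U → ‖fderiv ℂ g z w‖ ≤ B / r := by
    intro z hz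
    refine norm_fderiv_apply_le hU hg hr fun ζ hζ => ?_
    have : z + ζ • w ∈ U := hz (by
      rw [mem_closedBall_iff_norm, add_sub_cancel_left, norm_smul]
      exact (mul_le_of_le_one_right (norm_nonneg _) hw).trans hζ)
    exact ⟨this, hB _ this⟩
  have h2 : ∀ z ∈ Q, ∀ v, ‖fderiv ℂ (fun z => fderiv ℂ g z w) z v‖ ≤ B / r / r * ‖v‖ := by
    intro z hz v
    rcases eq_or_ne v 0 with rfl | hv
    · simp
    have hv0 : 0 < ‖v‖ := norm_pos_iff.2 hv
    have h3 : ∀ ζ : ℂ, ‖ζ‖ ≤ r / ‖v‖ → z + ζ • v ∈ U ∧ ‖fderiv ℂ g (z + ζ • v) w‖ ≤ B / r := by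
      intro ζ hζ
      rw [le_div_iff₀ hv0, ← norm_smul] at hζ
      refine ⟨hQU z hz ?_, h1 _ fun y hy => hQU z hz ?_⟩
      · rw [mem_closedBall_iff_norm, add_sub_cancel_left]
        linarith
      · rw [mem_closedBall_iff_norm] at hy ⊢
        have : y - z = (y - (z + ζ • v)) + ζ • v := by abel
        rw [this]
        refine (norm_add_le _ _).trans ?_
        linarith
    refine (norm_fderiv_apply_le hU (differentiableOn_fderiv_apply hU hg w)
      (div_pos hr hv0) h3).trans (le_of_eq ?_)
    field_simp
  have hUQ : ∀ z ∈ Q, z ∈ U := fun z hz => hQU z hz (mem_closedBall_self (by positivity))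
  refine ⟨max (B / r) (B / r / r), fun x => (h1 _ fun y hy => hQU _ (hq x)
    (closedBall_subset_closedBall (by linarith) hy)).trans (le_max_left _ _), fun x y => ?_⟩
  have hBr : 0 ≤ B / r / r := by
    have := (norm_nonneg _).trans (hB _ (hUQ _ (hq x)))
    positivity
  have h4 := hQ.norm_image_sub_le_of_norm_hasFDerivWithin_le (𝕜 := ℂ)
    (f := fun z => fderiv ℂ g z w) (f' := fun z => fderiv ℂ (fun z => fderiv ℂ g z w) z)
    (C := B / r / r) (fun z hz => ((differentiableOn_fderiv_apply hU hg w).differentiableAt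
      (hU.mem_nhds (hUQ z hz))).hasFDerivAt.hasFDerivWithinAt)
    (fun z hz => ContinuousLinearMap.opNorm_le_bound _ hBr (h2 z hz)) (hq y) (hq x)
  refine h4.trans ?_
  gcongr
  · exact le_max_right _ _
  · exact hql x y

end

end AperiodicNekhoroshev

namespace AperiodicNekhoroshev

noncomputable section

open Metric Set Filter Topology

variable {n : ℕ} {G : Set (RVec n)} {ρ σ Cf M m ε μ : ℝ} {h : CVec n → ℂ}
  {f : CVec n × CVec n × ℂ → ℂ}

theorem norm_realPoint_sub_le {x x' y y' : RVec n} {ξ ξ' : ℝ} {a : ℝ} (h1 : ‖x - x'‖ ≤ a)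
    (h2 : ‖y - y'‖ ≤ a) (h3 : ‖ξ - ξ'‖ ≤ a) : ‖realPoint x y ξ - realPoint x' y' ξ'‖ ≤ a := by
  rw [realPoint, realPoint, Prod.mk_sub_mk, Prod.mk_sub_mk, Prod.norm_mk, Prod.norm_mk,
    norm_toC_sub, norm_toC_sub, ← Complex.ofReal_sub, Complex.norm_real]
  exact max_le h1 (max_le h2 h3)

theorem convex_realPoint (x₀ : RVec n) (R : ℝ) :
    Convex ℝ {z : Phase n | ∃ x ∈ closedBall x₀ R, ∃ y ξ, z = realPoint x y ξ} := by
  rintro _ ⟨x, hx, y, ξ, rfl⟩ _ ⟨x', hx', y', ξ', rfl⟩ a b ha hb hab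
  refine ⟨a • x + b • x', convex_closedBall x₀ R hx hx' ha hb hab, a • y + b • y',
    a • ξ + b • ξ', ?_⟩
  refine Prod.ext ?_ (Prod.ext ?_ ?_)
  · ext j
    simp [realPoint, toC]
  · ext j
    simp [realPoint, toC]
  · simp [realPoint]

theorem closedBall_realPoint_subset (hσ : 0 < σ) {x : RVec n} {r : ℝ}
    (hx : closedBall (toC x) r ⊆ complexNhd G ρ) (hr : r ≤ σ) (y : RVec n) (ξ : ℝ) :
    closedBall (realPoint x y ξ) r ⊆ complexDomain G ρ σ := by
  rintro ⟨z1, z2, z3⟩ hz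
  rw [mem_closedBall_iff_norm, realPoint, Prod.mk_sub_mk, Prod.mk_sub_mk, Prod.norm_mk,
    Prod.norm_mk, max_le_iff, max_le_iff] at hz
  refine ⟨hx (mem_closedBall_iff_norm.2 hz.1), fun j => ?_, ?_⟩
  · have h1 : ‖(z2 - toC y) j‖ ≤ r := (PiLp.norm_apply_le _ j).trans hz.2.1
    have h2 := (Complex.abs_im_le_norm _).trans h1
    have h3 : ((z2 - toC y) j).im = (z2 j).im := by simp [toC]
    rw [h3] at h2
    change |(z2 j).im| < 2 * σ
    linarith
  · have h2 := (Complex.abs_im_le_norm _).trans hz.2.2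
    rw [Complex.sub_im, Complex.ofReal_im, sub_zero] at h2
    change |z3.im| < 2 * σ
    linarith

/-- A real vector is determined by its complexification. -/
theorem eq_toLp_re_of_toC_eq {x : RVec n} {c : Fin n → ℂ} (hx : toC x = WithLp.toLp 2 c) :
    x = WithLp.toLp 2 fun j => (c j).re := by
  ext j
  have : (toC x) j = c j := by rw [hx]
  change x j = (c j).re
  rw [← this]
  simp [toC]

/-- For arbitrarily long times there is a curve which solves Hamilton's equations as long as its
actions remain near their initial value: an orbit of the field in which the actions are first
retracted to a ball, so that it is bounded and Lipschitz. -/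
theorem exists_curve (hR : RegularityHyp G ρ σ Cf h f) (hρ : 0 < ρ) (hσ : 0 < σ) {I₀ : RVec n}
    (hI₀ : I₀ ∈ G) (φ₀ : RVec n) (t₀ : ℝ) {T : ℝ} (hT : 0 ≤ T) :
    ∃ I φ : ℝ → RVec n, I t₀ = I₀ ∧ φ t₀ = φ₀ ∧ ContinuousOn I (Icc (t₀ - T) (t₀ + T)) ∧
      ∀ S ⊆ Icc (t₀ - T) (t₀ + T), (∀ t ∈ S, ‖I t - I₀‖ ≤ ρ / 2) →
        IsOrbit G ρ h f ε μ S I φ := by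
  obtain ⟨p, hp1, hp2, hp3⟩ := exists_retraction I₀ (R := ρ / 2) (by positivity)
  set r : ℝ := min ρ σ / 8 with hr
  have hm0 : 0 < min ρ σ := lt_min hρ hσ
  have hr0 : 0 < r := by positivity
  have hrρ : 2 * r ≤ ρ / 4 := by
    have := min_le_left ρ σ
    linarith
  have hrσ : 2 * r ≤ σ := by
    have := min_le_right ρ σ
    linarith
  have hnhd : ∀ x ∈ closedBall I₀ (ρ / 2), closedBall (toC x) (2 * r) ⊆ complexNhd G ρ :=
    fun x hx => (closedBall_subset_ball (by linarith : 2 * r < ρ / 2)).trans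
      (ball_subset_complexNhd hI₀ (mem_closedBall_iff_norm.1 hx) (by linarith))
  have hhd : DifferentiableOn ℂ h (complexNhd G ρ) := fun z hz =>
    (hR.h_holo z hz).differentiableAt.differentiableWithinAt
  have hfd : DifferentiableOn ℂ (fun z => (ε : ℂ) * f z) (complexDomain G ρ σ) := fun z hz =>
    ((hR.f_holo z hz).differentiableAt.const_mul _).differentiableWithinAt
  obtain ⟨Bh, hBh⟩ := hR.h_bdd
  have hBf : ∀ z ∈ complexDomain G ρ σ, ‖(ε : ℂ) * f z‖ ≤ |ε| * Cf := fun z hz => by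
    rw [norm_mul, Complex.norm_real]
    exact mul_le_mul_of_nonneg_left (hR.norm_le hz) (abs_nonneg _)
  let X := RVec n × RVec n × ℝ
  have hfst : ∀ z w : X, ‖z.1 - w.1‖ ≤ ‖z - w‖ := fun z w => norm_fst_le (z - w)
  have hsnd : ∀ z w : X, ‖z.2 - w.2‖ ≤ ‖z - w‖ := fun z w => norm_snd_le (z - w)
  have hF : ∀ w : Phase n, ‖w‖ ≤ 1 → BddLip fun z : X =>
      fderiv ℂ (fun z => (ε : ℂ) * f z) (realPoint (p z.1) z.2.1 z.2.2) w := by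
    intro w hw
    refine bddLip_fderiv_apply (isOpen_complexDomain G ρ σ) hfd hBf (convex_realPoint I₀ (ρ / 2))
      hr0 ?_ hw (fun z => ⟨p z.1, hp1 _, _, _, rfl⟩) fun z w => norm_realPoint_sub_le
        ((hp3 _ _).trans (hfst z w)) ((norm_fst_le (z.2 - w.2)).trans (hsnd z w))
        ((norm_snd_le (z.2 - w.2)).trans (hsnd z w))
    rintro _ ⟨x, hx, y, ξ, rfl⟩
    exact closedBall_realPoint_subset hσ (hnhd x hx) hrσ y ξ
  have hH : ∀ w : CVec n, ‖w‖ ≤ 1 → BddLip fun z : X => fderiv ℂ h (toC (p z.1)) w := by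
    intro w hw
    refine bddLip_fderiv_apply (isOpen_complexNhd G ρ) hhd hBh
      (Q := toCL '' closedBall I₀ (ρ / 2))
      ((convex_closedBall I₀ (ρ / 2)).linear_image toCL.toLinearMap)
      hr0 ?_ hw (fun z => ⟨p z.1, hp1 _, rfl⟩) fun z w => ?_
    · rintro _ ⟨x, hx, rfl⟩
      exact hnhd x hx
    · rw [norm_toC_sub]
      exact (hp3 _ _).trans (hfst z w)
  have he : ∀ j : Fin n, ‖(EuclideanSpace.single j 1 : CVec n)‖ ≤ 1 := fun j => by simp
  have hV : BddLip fun z : X =>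
      ((WithLp.toLp 2 fun j => (-fderiv ℂ (fun z => (ε : ℂ) * f z)
          (realPoint (p z.1) z.2.1 z.2.2) (0, EuclideanSpace.single j 1, 0)).re,
        WithLp.toLp 2 fun j => (fderiv ℂ h (toC (p z.1)) (EuclideanSpace.single j 1) +
          fderiv ℂ (fun z => (ε : ℂ) * f z) (realPoint (p z.1) z.2.1 z.2.2)
            (EuclideanSpace.single j 1, 0, 0)).re, μ) : X) := by
    refine .prodMk (.toLp fun j => ?_) (.prodMk (.toLp fun j => ?_) (.const μ))
    · exact (hF _ (by simp [Prod.norm_mk])).neg.clm_comp Complex.reCLM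
    · exact ((hH _ (he j)).add (hF _ (by simp [Prod.norm_mk]))).clm_comp Complex.reCLM
  obtain ⟨α, hα0, hα⟩ := hV.exists_solution (I₀, φ₀, μ * t₀) t₀ hT
  have hd1 := fun t ht => (hasFDerivAt_fst (𝕜 := ℝ) (p := α t)).comp_hasDerivWithinAt t (hα t ht)
  have hd2 := fun t ht => (hasFDerivAt_fst (𝕜 := ℝ) (p := (α t).2)).comp_hasDerivWithinAt t
    ((hasFDerivAt_snd (𝕜 := ℝ) (p := α t)).comp_hasDerivWithinAt t (hα t ht))
  have hd3 := fun t ht => (hasFDerivAt_snd (𝕜 := ℝ) (p := (α t).2)).comp_hasDerivWithinAt t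
    ((hasFDerivAt_snd (𝕜 := ℝ) (p := α t)).comp_hasDerivWithinAt t (hα t ht))
  have hμ : ∀ t ∈ Icc (t₀ - T) (t₀ + T), (α t).2.2 = μ * t := by
    intro t ht
    have h1 : ∀ t ∈ Icc (t₀ - T) (t₀ + T), HasDerivWithinAt (fun t => (α t).2.2 - μ * t) 0
        (Icc (t₀ - T) (t₀ + T)) t := fun t ht => by
      have e1 : HasDerivWithinAt (fun t => (α t).2.2) μ (Icc (t₀ - T) (t₀ + T)) t := hd3 t ht
      have e2 : HasDerivWithinAt (fun t => μ * t) μ (Icc (t₀ - T) (t₀ + T)) t := by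
        simpa using ((hasDerivAt_id t).const_mul μ).hasDerivWithinAt
      exact (e1.sub e2).congr_deriv (sub_self μ)
    have h2 := (convex_Icc (t₀ - T) (t₀ + T)).norm_image_sub_le_of_norm_hasDerivWithin_le (C := 0)
      h1 (fun t _ => by simp) (x := t₀) ⟨by linarith, by linarith⟩ ht
    rw [zero_mul, norm_le_zero_iff, hα0] at h2
    simp only at h2
    linarith
  refine ⟨fun t => (α t).1, fun t => (α t).2.1, congrArg (·.1) hα0, congrArg (·.2.1) hα0,
    fun t ht => (hd1 t ht).continuousWithinAt, fun S hS hSI => ⟨fun t ht => ?_, fun t ht => ?_,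
      fun t ht => ?_⟩⟩
  · exact hnhd _ (mem_closedBall_iff_norm.2 (hSI t ht)) (mem_closedBall_self (by positivity))
  · have hb := mem_closedBall_iff_norm.2 (hSI t ht)
    have hx : toC (α t).1 ∈ complexNhd G ρ := hnhd _ hb (mem_closedBall_self (by positivity))
    have h1 := (hd1 t (hS ht)).mono hS
    have h2 := eq_toLp_re_of_toC_eq
      (toC_gradient_hamiltonian_ang (ε := ε) (μ := μ) hR hσ hx (α t).2.1 t)
    refine h1.congr_deriv ?_
    rw [h2]
    simp only [ContinuousLinearMap.coe_fst']
    rw [hp2 _ hb, hμ t (hS ht)]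
    ext j
    simp
  · have hb := mem_closedBall_iff_norm.2 (hSI t ht)
    have hx : toC (α t).1 ∈ complexNhd G ρ := hnhd _ hb (mem_closedBall_self (by positivity))
    have h1 := (hd2 t (hS ht)).mono hS
    have h2 := eq_toLp_re_of_toC_eq
      (toC_gradient_hamiltonian_act (ε := ε) (μ := μ) hR hσ hx (α t).2.1 t)
    refine h1.congr_deriv ?_
    rw [h2]
    simp only [ContinuousLinearMap.coe_fst', ContinuousLinearMap.coe_snd']
    rw [hp2 _ hb, hμ t (hS ht)]

end

end AperiodicNekhoroshev

open AperiodicNekhoroshev in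
theorem theorem2p1 (n : ℕ) (hn : 1 ≤ n) (ρ σ M m Cf : ℝ)
    (hρ : 0 < ρ) (hρ1 : ρ ≤ 1) (hσ : 0 < σ) (hσ1 : σ ≤ 1) (hm : 0 < m) (hmM : m ≤ M) :
    ∃ Δs T : ℝ, 0 < Δs ∧ 0 < T ∧
      ∀ (G : Set (RVec n)) (h : CVec n → ℂ) (f : CVec n × CVec n × ℂ → ℂ), IsOpen G →
        RegularityHyp G ρ σ Cf h f → ConvexityHyp G ρ M m h →
        ∀ ε μ : ℝ, 0 < ε → 0 ≤ μ → 0 < lam n σ Cf ε μ → lam n σ Cf ε μ < 1 / (3 ^ 4 * Δs) →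
          (∀ I₀ ∈ G, ∀ (φ₀ : RVec n) (t₀ : ℝ), ∃ I φ : ℝ → RVec n,
            I t₀ = I₀ ∧ φ t₀ = φ₀ ∧
            IsOrbit G ρ h f ε μ
              {t | |t - t₀| < stabilityTime n Δs T ε (lam n σ Cf ε μ)} I φ) ∧
          (∀ (J : Set ℝ) (t₀ : ℝ) (I φ : ℝ → RVec n), J.OrdConnected → t₀ ∈ J →
            IsOrbit G ρ h f ε μ J I φ → I t₀ ∈ G →
            ∀ t ∈ J, |t - t₀| < stabilityTime n Δs T ε (lam n σ Cf ε μ) →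
              ‖I t - I t₀‖ < (Δs * lam n σ Cf ε μ) ^ (1 / 4 : ℝ) * ρ) := by
  obtain ⟨Δs, T, hΔ, hT, hconf⟩ := exists_confinement n hn Cf hρ hρ1 hσ hm hmM
  refine ⟨Δs, T, hΔ, hT, fun G h f _ hR hc ε μ hε hμ hl0 hl1 => ?_⟩
  have hx0 : 0 < Δs * lam n σ Cf ε μ := mul_pos hΔ hl0
  have hx1 : Δs * lam n σ Cf ε μ ≤ 1 := by
    rw [lt_div_iff₀ (by positivity)] at hl1
    nlinarith
  have hy0 := Real.rpow_pos_of_pos hx0 (1 / 4)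
  have hy1 := Real.rpow_le_one hx0.le hx1 (z := 1 / 4) (by norm_num)
  have key := hconf G h f hR hc ε μ hε hμ hl0 hl1
  refine ⟨fun I₀ hI₀ φ₀ t₀ => ?_, fun J t₀ I φ hJ ht₀ hO hG t ht htT =>
    (key J t₀ I φ hJ ht₀ hO hG t ht htT).trans_lt (by gcongr; linarith)⟩
  set τ := stabilityTime n Δs T ε (lam n σ Cf ε μ) with hτ
  have hτ0 : 0 < τ := by
    rw [hτ, stabilityTime]
    positivity
  obtain ⟨I, φ, hI, hφ, hcont, horb⟩ := exists_curve (ε := ε) (μ := μ) hR hρ hσ hI₀ φ₀ t₀ hτ0.le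
  have hball : {t | |t - t₀| < τ} = Set.Ioo (t₀ - τ) (t₀ + τ) := by
    ext t
    rw [Set.mem_ofPred_eq, abs_lt, Set.mem_Ioo]
    constructor <;> rintro ⟨h1, h2⟩ <;> constructor <;> linarith
  have hsub : {t | |t - t₀| < τ} ⊆ Set.Icc (t₀ - τ) (t₀ + τ) := hball ▸ Set.Ioo_subset_Icc_self
  have hord : {t | |t - t₀| < τ}.OrdConnected := hball ▸ Set.ordConnected_Ioo
  have hmem : t₀ ∈ {t | |t - t₀| < τ} := by simpa using hτ0
  -- as long as the actions stay in the ball the curve is an orbit, which the a priori bound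
  -- confines to a smaller ball
  have hbd : ∀ t ∈ {t | |t - t₀| < τ}, ‖I t - I₀‖ ≤ ρ / 8 := by
    refine le_of_forall_uIcc_le (g := fun t => ‖I t - I₀‖) hord
      ((hcont.mono hsub).sub continuousOn_const).norm
      (b := ρ / 2) (by linarith) hmem (by beta_reduce; rw [hI, sub_self, norm_zero]; positivity)
      fun t ht hb => ?_
    have hO := horb (Set.uIcc t₀ t) ((hord.uIcc_subset hmem ht).trans hsub) hb
    have h1 := key _ t₀ I φ Set.ordConnected_uIcc Set.left_mem_uIcc hO (hI.symm ▸ hI₀) t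
      Set.right_mem_uIcc ht
    rw [hI] at h1
    exact h1.trans (mul_le_of_le_one_left (by positivity) hy1)
  exact ⟨I, φ, hI, hφ, horb _ hsub fun t ht => (hbd t ht).trans (by linarith)⟩
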